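/- Let $q\in\mathbb C^\times$ not be a root of unity and let $U_q=U_q(\mathfrak{gl}_n)$ be the $\mathbb C$-algebra with Chevalley generators $e_{\alpha},f_{\alpha}$ ($\alpha$ simple) and $q^{\pm h_{\varepsilon_i}}$, with comultiplication $\Delta(e_\alpha)=e_\alpha\otimes1+q^{h_\alpha}\otimes e_\alpha$, $\Delta(f_\alpha)=1\otimes f_\alpha+f_\alpha\otimes q^{-h_\alpha}$ and $q^{h}$ group-like. Let $\mathbb C^n$ be the natural representation with standard basis $w_1,\dots,w_n$, let $\rho$ be the half-sum of positive roots, and $[z]_q=\frac{q^z-q^{-z}}{q-q^{-1}}$. For a weight $\mu$, put $\mu_i=(\mu,\varepsilon_i)$ (only the arbitrary non-zero numbers $q^{\mu_i}$ matter) and $\hat x_i^\mu=q^{2\mu_i-2i+2}$. Let $\hat M_\mu$ be the Verma module with highest weight vector $v_\mu$. Let $\check f_\alpha(\mu)$ be the dynamical root vectors specialized at $\mu$: $\check f_0=1$, $\check f_{\alpha}=f_\alpha$ for simple $\alpha$, and $\check f_{\alpha_i+\beta}=[(\mu+\rho,\beta)]_q f_{\alpha_i}\check f_\beta-[(\mu+\rho,\beta)-1]_q\check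 f_\beta f_{\alpha_i}$ for $\beta=\alpha_{i+1}+\dots+\alpha_j$, $j>i$. Put $$\hat u_m=\sum_{i=1}^m(-q)^{i-1}\prod_{j=1}^{i-1}[\mu_j-\mu_m+m-j-1]_q\; w_i\otimes\check f_{\varepsilon_i-\varepsilon_m}v_\mu\in\mathbb C^n\otimes\hat M_\mu .$$ Let $\mathcal Q=(\pi\otimes\mathrm{id})(\mathcal R_{21}\mathcal R)$ be the invariant operator on $\mathbb C^n\otimes M$, where $\pi$ is the natural representation and $\mathcal R$ is the universal R-matrix with $\mathcal R\Delta=\Delta^{op}\mathcal R$ and Cartan part $q^{\sum_i h_{\varepsilon_i}\otimes h_{\varepsilon_i}}$. Let $n=n_1+\dots+n_k$ with all $n_i\ge1$, let $m_i=n_1+\dots+n_{i-1}+1$, and call $\{m_i,\dots,m_i+n_i-1\}$ the $i$-th block. Let $\lambda$ be a weight such that $q^{\lambda_a}$ is constant for $a$ in each block. Let $\sigma\in S_n$ be increasing on every block, let $\sigma\cdot\lambda=\sigma(\lambda+\rho)-\rho$, and let $M_{\sigma\cdot\lambda}$ be the quotient of $\hat M_{\sigma\cdot\lambda}$ by the submodule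 generated by the vectors $\check f_{\varepsilon_{\sigma(a)}-\varepsilon_{\sigma(a+1)}}v_{\sigma\cdot\lambda}$, for $a,a+1$ in the same block. Let $\varpi:\hat M_{\sigma\cdot\lambda}\to M_{\sigma\cdot\lambda}$ be the projection and $v$ the image of $v_{\sigma\cdot\lambda}$. Put $p_i=\sigma(m_i)$, $x_i=\hat x^{\lambda}_{m_i}=\hat x^{\sigma\cdot\lambda}_{p_i}$ and $\hat x_l=\hat x_l^{\sigma\cdot\lambda}$, and $$u_i^\sigma=\prod_{j:\,p_j<p_i}(\mathcal Q-x_j)\,(w_{p_i}\otimes v),\qquad \bar C_i=\prod_{l<p_i,\ l\notin\{p_1,\dots,p_k\}}(x_i-\hat x_l),\qquad M_i^{\sigma\cdot\lambda}=U_q\,u_i^\sigma\subset\mathbb C^n\otimes M_{\sigma\cdot\lambda}.$$ (The summands are indexed by the blocks; numbering them by increasing $p_i$ only permutes them.) (a) If $\mathbb C^n\otimes M_{\sigma\cdot\lambda}=M_1^{\sigma\cdot\lambda}\oplus\dots\oplus M_k^{\sigma\cdot\lambda}$, then $x_1,\dots,x_k$ are pairwise distinct. (b) Suppose that whenever $a,a+1$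 are in the same block and $\sigma(a)<r<\sigma(a+1)$, one has $\hat x_r\ne\hat x_{\sigma(a+1)}$ (no condition if $\sigma(a+1)=\sigma(a)+1$ for all such $a$). Then: 1. $\mathbb C^n\otimes M_{\sigma\cdot\lambda}=M_1^{\sigma\cdot\lambda}\oplus\dots\oplus M_k^{\sigma\cdot\lambda}$ if and only if $x_1,\dots,x_k$ are pairwise distinct. 2. The set of eigenvalues of $\mathcal Q$ on $\mathbb C^n\otimes M_{\sigma\cdot\lambda}$ is $\{x_1,\dots,x_k\}$. 3. Every $u_i^\sigma$ has weight $\sigma\cdot\lambda+\varepsilon_{p_i}$, is annihilated by all $e_\alpha$, and is a renormalization of $(\mathrm{id}\otimes\varpi)(\hat u_{p_i})$: there is $\kappa_i\in\mathbb C^\times$ with $\bar C_i\,u_i^\sigma=\kappa_i\,(\mathrm{id}\otimes\varpi)(\hat u_{p_i})$. 4. If $x_1,\dots,x_k$ are pairwise distinct, all $u_i^\sigma$ are non-zero; so each summand is a highest weight submodule generated by the singular vector $u_i^\sigma$. -/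

import Mathlib

open scoped TensorProduct

noncomputable section

namespace QuantumGL

/-! ### The quantum group `U_q(gl_n)` as an algebra over `ℂ` -/

/-- All indices start at `0`: the simple root `α_j`, `j : Fin (n - 1)`, is
`ε_{lo j} - ε_{hi j}` with `lo j = j` and `hi j = j + 1`. -/
def lo {n : ℕ} (j : Fin (n - 1)) : Fin n := ⟨j, by omega⟩

/-- The index `j + 1`. -/
def hi {n : ℕ} (j : Fin (n - 1)) : Fin n := ⟨j + 1, by omega⟩

/-- The inner product `(ε_i, α_j)`. -/
def epsRoot {n : ℕ} (i : Fin n) (j : Fin (n - 1)) : ℤ :=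
  (if i = lo j then 1 else 0) - (if i = hi j then 1 else 0)

/-- The inner product `(α_i, α_j)`. -/
def rootRoot {n : ℕ} (i j : Fin (n - 1)) : ℤ := epsRoot (lo i) j - epsRoot (hi i) j

/-- The integral power `q ^ m` as a complex number. -/
def qpow (q : ℂˣ) (m : ℤ) : ℂ := ((q ^ m : ℂˣ) : ℂ)

/-- The generators: `k i` stands for `q^{h_{ε_i}}`, `kinv i` for `q^{-h_{ε_i}}`, and `e j`, `f j`
for the Chevalley generators of the simple root `α_j`. -/
inductive Gen (n : ℕ) : Type
  | k (i : Fin n)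
  | kinv (i : Fin n)
  | e (j : Fin (n - 1))
  | f (j : Fin (n - 1))

/-- A generator as an element of the free algebra. -/
abbrev gen {n : ℕ} (x : Gen n) : FreeAlgebra ℂ (Gen n) := FreeAlgebra.ι ℂ x

/-- The defining relations of `U_q(gl_n)`. The relation
`[e_j, f_j] = (q^{h_{α_j}} - q^{-h_{α_j}}) / (q - q⁻¹)` is written without denominators. -/
inductive Rel (q : ℂˣ) (n : ℕ) : FreeAlgebra ℂ (Gen n) → FreeAlgebra ℂ (Gen n) → Prop
  | k_kinv (i) : Rel q n (gen (.k i) * gen (.kinv i)) 1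
  | kinv_k (i) : Rel q n (gen (.kinv i) * gen (.k i)) 1
  | k_comm (i j) : Rel q n (gen (.k i) * gen (.k j)) (gen (.k j) * gen (.k i))
  | k_e (i j) : Rel q n (gen (.k i) * gen (.e j))
      (qpow q (epsRoot i j) • (gen (.e j) * gen (.k i)))
  | k_f (i j) : Rel q n (gen (.k i) * gen (.f j))
      (qpow q (-epsRoot i j) • (gen (.f j) * gen (.k i)))
  | e_f_same (j) : Rel q n
      (((q : ℂ) - (q : ℂ)⁻¹) • (gen (.e j) * gen (.f j) - gen (.f j) * gen (.e j)))
      (gen (.k (lo j)) * gen (.kinv (hi j)) - gen (.kinv (lo j)) * gen (.k (hi j)))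
  | e_f_ne (i j) (h : i ≠ j) : Rel q n (gen (.e i) * gen (.f j)) (gen (.f j) * gen (.e i))
  | e_comm (i j) (h : rootRoot i j = 0) :
      Rel q n (gen (.e i) * gen (.e j)) (gen (.e j) * gen (.e i))
  | f_comm (i j) (h : rootRoot i j = 0) :
      Rel q n (gen (.f i) * gen (.f j)) (gen (.f j) * gen (.f i))
  | e_serre (i j) (h : rootRoot i j = -1) : Rel q n
      (gen (.e i) * gen (.e i) * gen (.e j) -
        ((q : ℂ) + (q : ℂ)⁻¹) • (gen (.e i) * gen (.e j) * gen (.e i)) +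
        gen (.e j) * gen (.e i) * gen (.e i)) 0
  | f_serre (i j) (h : rootRoot i j = -1) : Rel q n
      (gen (.f i) * gen (.f i) * gen (.f j) -
        ((q : ℂ) + (q : ℂ)⁻¹) • (gen (.f i) * gen (.f j) * gen (.f i)) +
        gen (.f j) * gen (.f i) * gen (.f i)) 0

/-- The quantum group `U_q(gl_n)`. -/
def Uq (q : ℂˣ) (n : ℕ) : Type := RingQuot (Rel q n)

instance (q : ℂˣ) (n : ℕ) : Ring (Uq q n) := inferInstanceAs (Ring (RingQuot (Rel q n)))

instance (q : ℂˣ) (n : ℕ) : Algebra ℂ (Uq q n) :=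
  inferInstanceAs (Algebra ℂ (RingQuot (Rel q n)))

section Generators

variable (q : ℂˣ) {n : ℕ}

/-- The quotient map from the free algebra. -/
def Uq.mk : FreeAlgebra ℂ (Gen n) →ₐ[ℂ] Uq q n := RingQuot.mkAlgHom ℂ (Rel q n)

/-- `q^{h_{ε_i}}`. -/
def Uq.k (i : Fin n) : Uq q n := Uq.mk q (gen (.k i))

/-- `q^{-h_{ε_i}}`. -/
def Uq.kinv (i : Fin n) : Uq q n := Uq.mk q (gen (.kinv i))

/-- `e_{α_j}`. -/
def Uq.e (j : Fin (n - 1)) : Uq q n := Uq.mk q (gen (.e j))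

/-- `f_{α_j}`. -/
def Uq.f (j : Fin (n - 1)) : Uq q n := Uq.mk q (gen (.f j))

/-- `q^{h_{α_j}}`. -/
def Uq.kRoot (j : Fin (n - 1)) : Uq q n := Uq.k q (lo j) * Uq.kinv q (hi j)

/-- `q^{-h_{α_j}}`. -/
def Uq.kRootInv (j : Fin (n - 1)) : Uq q n := Uq.kinv q (lo j) * Uq.k q (hi j)

theorem Uq.mk_rel {x y : FreeAlgebra ℂ (Gen n)} (h : Rel q n x y) : Uq.mk q x = Uq.mk q y :=
  RingQuot.mkAlgHom_rel ℂ h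

/-- The algebra homomorphism from `U_q(gl_n)` with prescribed values on the generators. -/
def Uq.lift {A : Type*} [Ring A] [Algebra ℂ A] (x : Gen n → A)
    (h : ∀ ⦃a b⦄, Rel q n a b → FreeAlgebra.lift ℂ x a = FreeAlgebra.lift ℂ x b) :
    Uq q n →ₐ[ℂ] A :=
  RingQuot.liftAlgHom ℂ ⟨FreeAlgebra.lift ℂ x, h⟩

theorem Uq.lift_mk {A : Type*} [Ring A] [Algebra ℂ A] (x : Gen n → A)
    (h : ∀ ⦃a b⦄, Rel q n a b → FreeAlgebra.lift ℂ x a = FreeAlgebra.lift ℂ x b)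
    (a : FreeAlgebra ℂ (Gen n)) : Uq.lift q x h (Uq.mk q a) = FreeAlgebra.lift ℂ x a :=
  RingQuot.liftAlgHom_mkAlgHom_apply ℂ _ h a

end Generators

/-! ### Relations used to construct the comultiplication -/

theorem qpow_add (q : ℂˣ) (a b : ℤ) : qpow q (a + b) = qpow q a * qpow q b := by
  simp [qpow, zpow_add]

theorem qpow_zero (q : ℂˣ) : qpow q 0 = 1 := by simp [qpow]

theorem qpow_one (q : ℂˣ) : qpow q 1 = q := by simp [qpow]

theorem qpow_neg_one (q : ℂˣ) : qpow q (-1) = (q : ℂ)⁻¹ := by simp [qpow]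

theorem qpow_two (q : ℂˣ) : qpow q 2 = (q : ℂ) * q := by
  rw [← one_add_one_eq_two, qpow_add, qpow_one]

theorem qpow_mul_neg (q : ℂˣ) (a : ℤ) : qpow q a * qpow q (-a) = 1 := by
  rw [← qpow_add, add_neg_cancel, qpow_zero]

section Relations

variable (q : ℂˣ) {n : ℕ}

theorem k_kinv (i : Fin n) : Uq.k q i * Uq.kinv q i = 1 := by
  simpa [Uq.k, Uq.kinv] using Uq.mk_rel q (Rel.k_kinv (q := q) i)

theorem kinv_k (i : Fin n) : Uq.kinv q i * Uq.k q i = 1 := by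
  simpa [Uq.k, Uq.kinv] using Uq.mk_rel q (Rel.kinv_k (q := q) i)

theorem k_comm (i j : Fin n) : Uq.k q i * Uq.k q j = Uq.k q j * Uq.k q i := by
  simpa [Uq.k] using Uq.mk_rel q (Rel.k_comm (q := q) i j)

theorem k_e (i : Fin n) (j : Fin (n - 1)) :
    Uq.k q i * Uq.e q j = qpow q (epsRoot i j) • (Uq.e q j * Uq.k q i) := by
  simpa [Uq.k, Uq.e] using Uq.mk_rel q (Rel.k_e (q := q) i j)

theorem k_f (i : Fin n) (j : Fin (n - 1)) :
    Uq.k q i * Uq.f q j = qpow q (-epsRoot i j) • (Uq.f q j * Uq.k q i) := by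
  simpa [Uq.k, Uq.f] using Uq.mk_rel q (Rel.k_f (q := q) i j)

theorem e_f_same (j : Fin (n - 1)) :
    ((q : ℂ) - (q : ℂ)⁻¹) • (Uq.e q j * Uq.f q j - Uq.f q j * Uq.e q j) =
      Uq.kRoot q j - Uq.kRootInv q j := by
  simpa [Uq.k, Uq.kinv, Uq.e, Uq.f, Uq.kRoot, Uq.kRootInv] using
    Uq.mk_rel q (Rel.e_f_same (q := q) j)

theorem e_f_ne (i j : Fin (n - 1)) (h : i ≠ j) : Uq.e q i * Uq.f q j = Uq.f q j * Uq.e q i := by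
  simpa [Uq.e, Uq.f] using Uq.mk_rel q (Rel.e_f_ne (q := q) i j h)

theorem e_comm (i j : Fin (n - 1)) (h : rootRoot i j = 0) :
    Uq.e q i * Uq.e q j = Uq.e q j * Uq.e q i := by
  simpa [Uq.e] using Uq.mk_rel q (Rel.e_comm (q := q) i j h)

theorem f_comm (i j : Fin (n - 1)) (h : rootRoot i j = 0) :
    Uq.f q i * Uq.f q j = Uq.f q j * Uq.f q i := by
  simpa [Uq.f] using Uq.mk_rel q (Rel.f_comm (q := q) i j h)

theorem e_serre (i j : Fin (n - 1)) (h : rootRoot i j = -1) :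
    Uq.e q i * Uq.e q i * Uq.e q j -
      ((q : ℂ) + (q : ℂ)⁻¹) • (Uq.e q i * Uq.e q j * Uq.e q i) +
      Uq.e q j * Uq.e q i * Uq.e q i = 0 := by
  simpa [Uq.e] using Uq.mk_rel q (Rel.e_serre (q := q) i j h)

theorem f_serre (i j : Fin (n - 1)) (h : rootRoot i j = -1) :
    Uq.f q i * Uq.f q i * Uq.f q j -
      ((q : ℂ) + (q : ℂ)⁻¹) • (Uq.f q i * Uq.f q j * Uq.f q i) +
      Uq.f q j * Uq.f q i * Uq.f q i = 0 := by
  simpa [Uq.f] using Uq.mk_rel q (Rel.f_serre (q := q) i j h)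

theorem kinv_comm_k (i j : Fin n) : Uq.kinv q i * Uq.k q j = Uq.k q j * Uq.kinv q i := by
  calc Uq.kinv q i * Uq.k q j
      = Uq.kinv q i * (Uq.k q j * Uq.k q i) * Uq.kinv q i := by
        rw [mul_assoc, mul_assoc, k_kinv, mul_one]
    _ = (Uq.kinv q i * Uq.k q i) * Uq.k q j * Uq.kinv q i := by
        rw [k_comm q j i]; simp only [mul_assoc]
    _ = Uq.k q j * Uq.kinv q i := by rw [kinv_k, one_mul]

theorem kinv_comm (i j : Fin n) : Uq.kinv q i * Uq.kinv q j = Uq.kinv q j * Uq.kinv q i := by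
  calc Uq.kinv q i * Uq.kinv q j
      = Uq.kinv q j * (Uq.k q j * Uq.kinv q i) * Uq.kinv q j := by
        rw [← mul_assoc, kinv_k, one_mul]
    _ = Uq.kinv q j * Uq.kinv q i * (Uq.k q j * Uq.kinv q j) := by
        rw [← kinv_comm_k]; simp only [mul_assoc]
    _ = Uq.kinv q j * Uq.kinv q i := by rw [k_kinv, mul_one]

/-- If `a x = s x a` and `b` is inverse to `a`, then `b x = s⁻¹ x b`. -/
theorem inv_commute {A : Type*} [Ring A] [Algebra ℂ A] {a b x : A} {s t : ℂ} (hst : s * t = 1)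
    (hab : a * b = 1) (hba : b * a = 1) (h : a * x = s • (x * a)) : b * x = t • (x * b) := by
  have h1 : x = s • (b * x * a) := by
    calc x = b * (a * x) := by rw [← mul_assoc, hba, one_mul]
      _ = s • (b * x * a) := by rw [h, mul_smul_comm, mul_assoc]
  calc b * x = (t * s) • (b * x) := by rw [mul_comm, hst, one_smul]
    _ = t • ((s • (b * x * a)) * b) := by
        rw [smul_mul_assoc, mul_assoc (b * x), hab, mul_one, smul_smul]
    _ = t • (x * b) := by rw [← h1]

theorem kinv_e (i : Fin n) (j : Fin (n - 1)) :
    Uq.kinv q i * Uq.e q j = qpow q (-epsRoot i j) • (Uq.e q j * Uq.kinv q i) :=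
  inv_commute (qpow_mul_neg q _) (k_kinv q i) (kinv_k q i) (k_e q i j)

theorem kinv_f (i : Fin n) (j : Fin (n - 1)) :
    Uq.kinv q i * Uq.f q j = qpow q (epsRoot i j) • (Uq.f q j * Uq.kinv q i) :=
  inv_commute (by rw [mul_comm, qpow_mul_neg]) (k_kinv q i) (kinv_k q i) (k_f q i j)

theorem kRoot_e (i j : Fin (n - 1)) :
    Uq.kRoot q i * Uq.e q j = qpow q (rootRoot i j) • (Uq.e q j * Uq.kRoot q i) := by
  rw [Uq.kRoot, mul_assoc, kinv_e, mul_smul_comm, ← mul_assoc, k_e, smul_mul_assoc, smul_smul,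
    ← qpow_add, mul_assoc, rootRoot]
  congr 2; ring

theorem kRoot_f (i j : Fin (n - 1)) :
    Uq.kRoot q i * Uq.f q j = qpow q (-rootRoot i j) • (Uq.f q j * Uq.kRoot q i) := by
  rw [Uq.kRoot, mul_assoc, kinv_f, mul_smul_comm, ← mul_assoc, k_f, smul_mul_assoc, smul_smul,
    ← qpow_add, mul_assoc, rootRoot]
  congr 2; ring

theorem kRoot_kRootInv (i : Fin (n - 1)) : Uq.kRoot q i * Uq.kRootInv q i = 1 := by
  rw [Uq.kRoot, Uq.kRootInv, kinv_comm_k, mul_assoc, ← mul_assoc (Uq.kinv q (hi i)), kinv_k,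
    one_mul, k_kinv]

theorem kRootInv_kRoot (i : Fin (n - 1)) : Uq.kRootInv q i * Uq.kRoot q i = 1 := by
  rw [Uq.kRoot, Uq.kRootInv, ← kinv_comm_k q (hi i) (lo i), mul_assoc,
    ← mul_assoc (Uq.k q (hi i)), k_kinv, one_mul, kinv_k]

theorem kRootInv_e (i j : Fin (n - 1)) :
    Uq.kRootInv q i * Uq.e q j = qpow q (-rootRoot i j) • (Uq.e q j * Uq.kRootInv q i) :=
  inv_commute (qpow_mul_neg q _) (kRoot_kRootInv q i) (kRootInv_kRoot q i) (kRoot_e q i j)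

theorem kRootInv_f (i j : Fin (n - 1)) :
    Uq.kRootInv q i * Uq.f q j = qpow q (rootRoot i j) • (Uq.f q j * Uq.kRootInv q i) :=
  inv_commute (by rw [mul_comm, qpow_mul_neg]) (kRoot_kRootInv q i) (kRootInv_kRoot q i)
    (kRoot_f q i j)

theorem k_kRoot (i : Fin n) (j : Fin (n - 1)) :
    Uq.k q i * Uq.kRoot q j = Uq.kRoot q j * Uq.k q i := by
  rw [Uq.kRoot, ← mul_assoc, k_comm, mul_assoc, mul_assoc, kinv_comm_k]

theorem k_kRootInv (i : Fin n) (j : Fin (n - 1)) :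
    Uq.k q i * Uq.kRootInv q j = Uq.kRootInv q j * Uq.k q i := by
  rw [Uq.kRootInv, ← mul_assoc, ← kinv_comm_k, mul_assoc, mul_assoc, k_comm]

theorem kRoot_comm (i j : Fin (n - 1)) :
    Uq.kRoot q i * Uq.kRoot q j = Uq.kRoot q j * Uq.kRoot q i := by
  have h : Uq.kinv q (hi i) * Uq.kRoot q j = Uq.kRoot q j * Uq.kinv q (hi i) := by
    rw [Uq.kRoot, ← mul_assoc, kinv_comm_k, mul_assoc, mul_assoc, kinv_comm]
  rw [Uq.kRoot, mul_assoc, h, ← mul_assoc, k_kRoot, mul_assoc]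

theorem kRootInv_comm (i j : Fin (n - 1)) :
    Uq.kRootInv q i * Uq.kRootInv q j = Uq.kRootInv q j * Uq.kRootInv q i := by
  have h : Uq.kinv q (lo i) * Uq.kRootInv q j = Uq.kRootInv q j * Uq.kinv q (lo i) := by
    rw [Uq.kRootInv, ← mul_assoc, kinv_comm, mul_assoc, mul_assoc, kinv_comm_k]
  rw [Uq.kRootInv, mul_assoc, k_kRootInv, ← mul_assoc, h, mul_assoc]

theorem rootRoot_self (i : Fin (n - 1)) : rootRoot i i = 2 := by
  have : lo i ≠ hi i := by simp [lo, hi]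
  simp [rootRoot, epsRoot, this, this.symm]

theorem rootRoot_comm (i j : Fin (n - 1)) : rootRoot i j = rootRoot j i := by
  simp only [rootRoot, epsRoot, lo, hi, Fin.mk.injEq]
  split_ifs <;> omega

/-- The computation behind the compatibility of the comultiplication with the Serre relations. -/
theorem serre_add {A : Type*} [Ring A] [Algebra ℂ A] {a b c d : A}
    (hba : b * a = ((q : ℂ) * q) • (a * b)) (hbc : b * c = (q : ℂ)⁻¹ • (c * b))
    (hda : d * a = (q : ℂ)⁻¹ • (a * d))
    (hac : a * a * c - ((q : ℂ) + (q : ℂ)⁻¹) • (a * c * a) + c * a * a = 0)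
    (hbd : b * b * d - ((q : ℂ) + (q : ℂ)⁻¹) • (b * d * b) + d * b * b = 0) :
    (a + b) * (a + b) * (c + d) - ((q : ℂ) + (q : ℂ)⁻¹) • ((a + b) * (c + d) * (a + b)) +
      (c + d) * (a + b) * (a + b) = 0 := by
  have hq : (q : ℂ) ≠ 0 := q.ne_zero
  have e1 : d * a * a = ((q : ℂ)⁻¹ * (q : ℂ)⁻¹) • (a * a * d) := by
    rw [hda, smul_mul_assoc, mul_assoc, hda, mul_smul_comm, smul_smul, mul_assoc]
  have e2 : a * d * a = (q : ℂ)⁻¹ • (a * a * d) := by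
    rw [mul_assoc, hda, mul_smul_comm, mul_assoc]
  have e3 : b * b * c = ((q : ℂ)⁻¹ * (q : ℂ)⁻¹) • (c * b * b) := by
    rw [mul_assoc, hbc, mul_smul_comm, ← mul_assoc, hbc, smul_mul_assoc, smul_smul]
  have e4 : b * c * b = (q : ℂ)⁻¹ • (c * b * b) := by rw [hbc, smul_mul_assoc]
  have e5 : a * b * c = (q : ℂ)⁻¹ • (a * c * b) := by
    rw [mul_assoc, hbc, mul_smul_comm, mul_assoc]
  have e6 : b * a * c = (q : ℂ) • (a * c * b) := by
    rw [hba, smul_mul_assoc, e5, smul_smul]; congr 1; field_simp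
  have e7 : b * c * a = (q : ℂ) • (c * a * b) := by
    rw [hbc, smul_mul_assoc, mul_assoc, hba, mul_smul_comm, smul_smul, mul_assoc]
    congr 1; field_simp
  have e8 : c * b * a = ((q : ℂ) * q) • (c * a * b) := by
    rw [mul_assoc, hba, mul_smul_comm, mul_assoc]
  have e9 : b * a * d = ((q : ℂ) * q) • (a * b * d) := by rw [hba, smul_mul_assoc]
  have e10 : b * d * a = (q : ℂ) • (a * b * d) := by
    rw [mul_assoc, hda, mul_smul_comm, ← mul_assoc, e9, smul_smul]; congr 1; field_simp
  have e11 : d * a * b = (q : ℂ)⁻¹ • (a * d * b) := by rw [hda, smul_mul_assoc]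
  have e12 : d * b * a = (q : ℂ) • (a * d * b) := by
    rw [mul_assoc, hba, mul_smul_comm, ← mul_assoc, e11, smul_smul]; congr 1; field_simp
  have hac' : c * a * a = ((q : ℂ) + (q : ℂ)⁻¹) • (a * c * a) - a * a * c := by
    rw [← sub_eq_zero, ← hac]; abel
  have hbd' : d * b * b = ((q : ℂ) + (q : ℂ)⁻¹) • (b * d * b) - b * b * d := by
    rw [← sub_eq_zero, ← hbd]; abel
  simp only [mul_add, add_mul]
  rw [e1, e2, e3, e4, e5, e6, e7, e8, e9, e10, e11, e12, hac', hbd']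
  match_scalars <;> field_simp <;> ring

end Relations

/-! ### The comultiplication and the natural representation -/

/-- The values of the comultiplication on the generators. -/
def comulGen (q : ℂˣ) (n : ℕ) : Gen n → Uq q n ⊗[ℂ] Uq q n
  | .k i => Uq.k q i ⊗ₜ Uq.k q i
  | .kinv i => Uq.kinv q i ⊗ₜ Uq.kinv q i
  | .e j => Uq.e q j ⊗ₜ 1 + Uq.kRoot q j ⊗ₜ Uq.e q j
  | .f j => 1 ⊗ₜ Uq.f q j + Uq.f q j ⊗ₜ Uq.kRootInv q j

theorem comulGen_rel (q : ℂˣ) (n : ℕ) ⦃a b : FreeAlgebra ℂ (Gen n)⦄ (h : Rel q n a b) :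
    FreeAlgebra.lift ℂ (comulGen q n) a = FreeAlgebra.lift ℂ (comulGen q n) b := by
  have hq : (q : ℂ) ≠ 0 := q.ne_zero
  cases h with
  | k_kinv i => simp [comulGen, k_kinv, Algebra.TensorProduct.one_def]
  | kinv_k i => simp [comulGen, kinv_k, Algebra.TensorProduct.one_def]
  | k_comm i j => simp [comulGen, k_comm q i j]
  | k_e i j =>
    simp [comulGen, mul_add, add_mul, k_e, k_kRoot, TensorProduct.smul_tmul', smul_add]
  | k_f i j =>
    simp [comulGen, mul_add, add_mul, k_f, k_kRootInv, TensorProduct.smul_tmul', smul_add]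
  | e_f_same j =>
    have h1 : (Uq.kRoot q j * Uq.f q j) ⊗ₜ[ℂ] (Uq.e q j * Uq.kRootInv q j) =
        (Uq.f q j * Uq.kRoot q j) ⊗ₜ[ℂ] (Uq.kRootInv q j * Uq.e q j) := by
      rw [kRoot_f, kRootInv_e, TensorProduct.tmul_smul, TensorProduct.smul_tmul']
    have h2 : FreeAlgebra.lift ℂ (comulGen q n)
        (gen (.k (lo j)) * gen (.kinv (hi j)) - gen (.kinv (lo j)) * gen (.k (hi j))) =
        Uq.kRoot q j ⊗ₜ Uq.kRoot q j - Uq.kRootInv q j ⊗ₜ Uq.kRootInv q j := by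
      simp [comulGen, Uq.kRoot, Uq.kRootInv]
    rw [h2]
    simp only [map_sub, map_mul, map_smul, FreeAlgebra.lift_ι_apply, comulGen, mul_add, add_mul,
      Algebra.TensorProduct.tmul_mul_tmul, one_mul, mul_one, h1]
    calc _ = (((q : ℂ) - (q : ℂ)⁻¹) • (Uq.e q j * Uq.f q j - Uq.f q j * Uq.e q j)) ⊗ₜ[ℂ]
            Uq.kRootInv q j + Uq.kRoot q j ⊗ₜ[ℂ]
            (((q : ℂ) - (q : ℂ)⁻¹) • (Uq.e q j * Uq.f q j - Uq.f q j * Uq.e q j)) := by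
          rw [TensorProduct.tmul_smul, ← TensorProduct.smul_tmul', ← smul_add,
            TensorProduct.sub_tmul, TensorProduct.tmul_sub]
          congr 1
          abel
      _ = _ := by
          rw [e_f_same, TensorProduct.sub_tmul, TensorProduct.tmul_sub]
          abel
  | e_f_ne i j h =>
    have h1 : (Uq.kRoot q i * Uq.f q j) ⊗ₜ[ℂ] (Uq.e q i * Uq.kRootInv q j) =
        (Uq.f q j * Uq.kRoot q i) ⊗ₜ[ℂ] (Uq.kRootInv q j * Uq.e q i) := by
      rw [kRoot_f, kRootInv_e, TensorProduct.tmul_smul, TensorProduct.smul_tmul',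
        rootRoot_comm]
    simp only [map_mul, FreeAlgebra.lift_ι_apply, comulGen, mul_add, add_mul,
      Algebra.TensorProduct.tmul_mul_tmul, one_mul, mul_one, h1, e_f_ne q i j h]
    abel
  | e_comm i j h =>
    have h' : rootRoot j i = 0 := by rw [rootRoot_comm, h]
    simp only [map_mul, FreeAlgebra.lift_ι_apply, comulGen, mul_add, add_mul,
      Algebra.TensorProduct.tmul_mul_tmul, one_mul, mul_one, e_comm q i j h, kRoot_comm q i j,
      kRoot_e, h, h', qpow_zero, one_smul]
    abel
  | f_comm i j h =>
    have h' : rootRoot j i = 0 := by rw [rootRoot_comm, h]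
    simp only [map_mul, FreeAlgebra.lift_ι_apply, comulGen, mul_add, add_mul,
      Algebra.TensorProduct.tmul_mul_tmul, one_mul, mul_one, f_comm q i j h, kRootInv_comm q i j,
      kRootInv_f, h, h', qpow_zero, one_smul]
    abel
  | e_serre i j h =>
    have h' : rootRoot j i = -1 := by rw [rootRoot_comm, h]
    simp only [map_add, map_sub, map_mul, map_smul, FreeAlgebra.lift_ι_apply, map_zero, comulGen]
    refine serre_add q ?_ ?_ ?_ ?_ ?_
    · simp only [Algebra.TensorProduct.tmul_mul_tmul, one_mul, mul_one, kRoot_e, rootRoot_self,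
        TensorProduct.smul_tmul', qpow_two]
    · simp only [Algebra.TensorProduct.tmul_mul_tmul, one_mul, mul_one, kRoot_e, h,
        TensorProduct.smul_tmul', qpow_neg_one]
    · simp only [Algebra.TensorProduct.tmul_mul_tmul, one_mul, mul_one, kRoot_e, h',
        TensorProduct.smul_tmul', qpow_neg_one]
    · simp only [Algebra.TensorProduct.tmul_mul_tmul, one_mul, TensorProduct.smul_tmul',
        ← TensorProduct.sub_tmul, ← TensorProduct.add_tmul]
      rw [e_serre q i j h, TensorProduct.zero_tmul]
    · have e1 : Uq.kRoot q i * Uq.kRoot q j * Uq.kRoot q i =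
          Uq.kRoot q i * Uq.kRoot q i * Uq.kRoot q j := by
        rw [mul_assoc, kRoot_comm q j i, mul_assoc]
      have e2 : Uq.kRoot q j * Uq.kRoot q i * Uq.kRoot q i =
          Uq.kRoot q i * Uq.kRoot q i * Uq.kRoot q j := by
        rw [kRoot_comm q j i, e1]
      simp only [Algebra.TensorProduct.tmul_mul_tmul, e1, e2, ← TensorProduct.tmul_smul]
      rw [← TensorProduct.tmul_sub, ← TensorProduct.tmul_add, e_serre q i j h,
        TensorProduct.tmul_zero]
  | f_serre i j h =>
    have h' : rootRoot j i = -1 := by rw [rootRoot_comm, h]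
    simp only [map_add, map_sub, map_mul, map_smul, FreeAlgebra.lift_ι_apply, map_zero, comulGen]
    refine serre_add q ?_ ?_ ?_ ?_ ?_
    · simp only [Algebra.TensorProduct.tmul_mul_tmul, one_mul, mul_one, kRootInv_f, rootRoot_self,
        ← TensorProduct.tmul_smul, qpow_two]
    · simp only [Algebra.TensorProduct.tmul_mul_tmul, one_mul, mul_one, kRootInv_f, h,
        ← TensorProduct.tmul_smul, qpow_neg_one]
    · simp only [Algebra.TensorProduct.tmul_mul_tmul, one_mul, mul_one, kRootInv_f, h',
        ← TensorProduct.tmul_smul, qpow_neg_one]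
    · simp only [Algebra.TensorProduct.tmul_mul_tmul, one_mul, ← TensorProduct.tmul_smul,
        ← TensorProduct.tmul_sub, ← TensorProduct.tmul_add]
      rw [f_serre q i j h, TensorProduct.tmul_zero]
    · have e1 : Uq.kRootInv q i * Uq.kRootInv q j * Uq.kRootInv q i =
          Uq.kRootInv q i * Uq.kRootInv q i * Uq.kRootInv q j := by
        rw [mul_assoc, kRootInv_comm q j i, mul_assoc]
      have e2 : Uq.kRootInv q j * Uq.kRootInv q i * Uq.kRootInv q i =
          Uq.kRootInv q i * Uq.kRootInv q i * Uq.kRootInv q j := by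
        rw [kRootInv_comm q j i, e1]
      simp only [Algebra.TensorProduct.tmul_mul_tmul, e1, e2, TensorProduct.smul_tmul']
      rw [← TensorProduct.sub_tmul, ← TensorProduct.add_tmul, f_serre q i j h,
        TensorProduct.zero_tmul]

/-- The comultiplication `Δ(e_α) = e_α ⊗ 1 + q^{h_α} ⊗ e_α`, `Δ(f_α) = 1 ⊗ f_α + f_α ⊗ q^{-h_α}`,
with `q^{h}` group-like. -/
def Uq.comul (q : ℂˣ) (n : ℕ) : Uq q n →ₐ[ℂ] Uq q n ⊗[ℂ] Uq q n :=
  Uq.lift q (comulGen q n) (comulGen_rel q n)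

/-- The values of the natural representation on the generators. -/
def natGen (q : ℂˣ) (n : ℕ) : Gen n → Matrix (Fin n) (Fin n) ℂ
  | .k i => Matrix.diagonal fun a => if a = i then (q : ℂ) else 1
  | .kinv i => Matrix.diagonal fun a => if a = i then (q : ℂ)⁻¹ else 1
  | .e j => Matrix.single (lo j) (hi j) 1
  | .f j => Matrix.single (hi j) (lo j) 1

theorem natGen_rel (q : ℂˣ) (n : ℕ) ⦃a b : FreeAlgebra ℂ (Gen n)⦄ (h : Rel q n a b) :
    FreeAlgebra.lift ℂ (natGen q n) a = FreeAlgebra.lift ℂ (natGen q n) b := by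
  have hq : (q : ℂ) ≠ 0 := q.ne_zero
  have hlh : ∀ j : Fin (n - 1), lo j ≠ hi j := fun j => by simp [lo, hi]
  have hll : ∀ i j : Fin (n - 1), lo i = lo j ↔ i = j := fun i j => by
    simp [lo, Fin.ext_iff]
  have hhh : ∀ i j : Fin (n - 1), hi i = hi j ↔ i = j := fun i j => by
    simp [hi, Fin.ext_iff]
  have hss : ∀ i j k l : Fin n, (Matrix.single i j 1 * Matrix.single k l 1 :
      Matrix (Fin n) (Fin n) ℂ) = if j = k then Matrix.single i l 1 else 0 := by
    intro i j k l
    split_ifs with h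
    · subst h; simp
    · simp [h]
  have hadj : ∀ i j : Fin (n - 1), rootRoot i j = 0 → hi i ≠ lo j ∧ hi j ≠ lo i := by
    intro i j
    simp only [rootRoot, epsRoot, lo, hi, Fin.mk.injEq, ne_eq]
    split_ifs <;> omega
  cases h with
  | k_kinv i =>
    simp only [map_mul, FreeAlgebra.lift_ι_apply, map_one, natGen, Matrix.diagonal_mul_diagonal]
    rw [← Matrix.diagonal_one]
    congr 1; funext a; split_ifs <;> simp [hq]
  | kinv_k i =>
    simp only [map_mul, FreeAlgebra.lift_ι_apply, map_one, natGen, Matrix.diagonal_mul_diagonal]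
    rw [← Matrix.diagonal_one]
    congr 1; funext a; split_ifs <;> simp [hq]
  | k_comm i j =>
    simp only [map_mul, FreeAlgebra.lift_ι_apply, natGen, Matrix.diagonal_mul_diagonal, mul_comm]
  | k_e i j =>
    simp only [map_mul, map_smul, FreeAlgebra.lift_ι_apply, natGen]
    ext a b
    simp only [Matrix.diagonal_mul, Matrix.smul_apply, Matrix.mul_diagonal, Matrix.single_apply,
      epsRoot, smul_eq_mul]
    have := hlh j
    by_cases h1 : lo j = a <;> by_cases h2 : hi j = b
    · subst h1; subst h2
      by_cases h3 : i = lo j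
      · subst h3; simp [this, this.symm, qpow_one]
      · by_cases h4 : i = hi j
        · subst h4; simp [this, this.symm, qpow_neg_one]
        · simp [h3, h4, Ne.symm h3, Ne.symm h4, qpow_zero]
    all_goals simp [h1, h2]
  | k_f i j =>
    simp only [map_mul, map_smul, FreeAlgebra.lift_ι_apply, natGen]
    ext a b
    simp only [Matrix.diagonal_mul, Matrix.smul_apply, Matrix.mul_diagonal, Matrix.single_apply,
      epsRoot, smul_eq_mul]
    have := hlh j
    by_cases h1 : hi j = a <;> by_cases h2 : lo j = b
    · subst h1; subst h2
      by_cases h3 : i = lo j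
      · subst h3; simp [this, this.symm, qpow_neg_one]
      · by_cases h4 : i = hi j
        · subst h4; simp [this, this.symm, qpow_one]
        · simp [h3, h4, Ne.symm h3, Ne.symm h4, qpow_zero]
    all_goals simp [h1, h2]
  | e_f_same j =>
    simp only [map_mul, map_sub, map_smul, FreeAlgebra.lift_ι_apply, natGen, hss, if_true,
      Matrix.diagonal_mul_diagonal]
    have := hlh j
    ext a b
    simp only [Matrix.sub_apply, Matrix.smul_apply, Matrix.single_apply, Matrix.diagonal_apply,
      smul_eq_mul]
    by_cases hab : a = b
    · subst hab
      by_cases h3 : a = lo j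
      · subst h3; simp [this, this.symm]
      · by_cases h4 : a = hi j
        · subst h4; simp [this, this.symm]
        · simp [h3, h4, Ne.symm h3, Ne.symm h4]
    · have h5 : ¬ (lo j = a ∧ lo j = b) := fun h => hab (h.1.symm.trans h.2)
      have h6 : ¬ (hi j = a ∧ hi j = b) := fun h => hab (h.1.symm.trans h.2)
      simp [hab, h5, h6]
  | e_f_ne i j h =>
    simp only [map_mul, FreeAlgebra.lift_ι_apply, natGen, hss, hhh, hll, h, Ne.symm h, if_false]
  | e_comm i j h =>
    obtain ⟨h1, h2⟩ := hadj i j h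
    simp only [map_mul, FreeAlgebra.lift_ι_apply, natGen, hss, h1, h2, if_false]
  | f_comm i j h =>
    obtain ⟨h1, h2⟩ := hadj i j h
    simp only [map_mul, FreeAlgebra.lift_ι_apply, natGen, hss, Ne.symm h1, Ne.symm h2, if_false]
  | e_serre i j h =>
    have h1 : ¬ (hi i = lo j ∧ hi j = lo i) := by
      simp only [lo, hi, Fin.mk.injEq]; omega
    simp only [map_add, map_sub, map_mul, map_smul, FreeAlgebra.lift_ι_apply, map_zero, natGen]
    rw [mul_assoc (Matrix.single (lo j) (hi j) 1)]
    simp only [hss, (hlh i).symm, if_false, zero_mul, mul_zero]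
    by_cases h2 : hi i = lo j
    · have h3 : hi j ≠ lo i := fun h3 => h1 ⟨h2, h3⟩
      simp [h2, hss, h3]
    · simp [h2]
  | f_serre i j h =>
    have h1 : ¬ (lo i = hi j ∧ lo j = hi i) := by
      simp only [lo, hi, Fin.mk.injEq]; omega
    simp only [map_add, map_sub, map_mul, map_smul, FreeAlgebra.lift_ι_apply, map_zero, natGen]
    rw [mul_assoc (Matrix.single (hi j) (lo j) 1)]
    simp only [hss, hlh i, if_false, zero_mul, mul_zero]
    by_cases h2 : lo i = hi j
    · have h3 : lo j ≠ hi i := fun h3 => h1 ⟨h2, h3⟩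
      simp [h2, hss, h3]
    · simp [h2]

/-- The natural representation `π` of `U_q(gl_n)` by matrices. -/
def natRep (q : ℂˣ) (n : ℕ) : Uq q n →ₐ[ℂ] Matrix (Fin n) (Fin n) ℂ :=
  Uq.lift q (natGen q n) (natGen_rel q n)

/-- The vector space `ℂ^n ⊗ M`. -/
def NatTensor (_q : ℂˣ) (n : ℕ) (M : Type*) [AddCommGroup M] [Module ℂ M] : Type _ :=
  (Fin n → ℂ) ⊗[ℂ] M

section NatTensor

variable (q : ℂˣ) (n : ℕ) (M : Type*) [AddCommGroup M] [Module ℂ M]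

instance : AddCommGroup (NatTensor q n M) := inferInstanceAs (AddCommGroup ((Fin n → ℂ) ⊗[ℂ] M))

instance : Module ℂ (NatTensor q n M) := inferInstanceAs (Module ℂ ((Fin n → ℂ) ⊗[ℂ] M))

variable [Module (Uq q n) M] [IsScalarTower ℂ (Uq q n) M]

/-- The tensor product of the natural representation and a module `M`. -/
def natTensorRep : Uq q n →ₐ[ℂ] Module.End ℂ ((Fin n → ℂ) ⊗[ℂ] M) :=
  (Module.endTensorEndAlgHom (R := ℂ) (S := ℂ) (A := ℂ)).comp
    ((Algebra.TensorProduct.map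
      ((Matrix.toLinAlgEquiv' : Matrix (Fin n) (Fin n) ℂ ≃ₐ[ℂ] _).toAlgHom.comp (natRep q n))
      (Algebra.lsmul ℂ ℂ M)).comp (Uq.comul q n))

instance : Module (Uq q n) (NatTensor q n M) :=
  Module.compHom ((Fin n → ℂ) ⊗[ℂ] M) (natTensorRep q n M).toRingHom

instance : IsScalarTower ℂ (Uq q n) (NatTensor q n M) where
  smul_assoc c x u := LinearMap.congr_fun (map_smul (natTensorRep q n M) c x) u

variable {M}

/-- The vector `w_i ⊗ y`, where `w_i` is the `i`-th standard basis vector of `ℂ^n`. -/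
def wTensor (i : Fin n) (y : M) : NatTensor q n M :=
  (Pi.single i (1 : ℂ) : Fin n → ℂ) ⊗ₜ[ℂ] y

/-- The map `id ⊗ φ : ℂ^n ⊗ M → ℂ^n ⊗ M'`. -/
def idTensor {M' : Type*} [AddCommGroup M'] [Module ℂ M'] (φ : M →ₗ[ℂ] M') :
    NatTensor q n M →ₗ[ℂ] NatTensor q n M' :=
  LinearMap.lTensor (Fin n → ℂ) φ

end NatTensor

/-! ### The invariant operator `𝒬` -/

section QOperator

variable (q : ℂˣ) {n : ℕ}

/-- The root vector of the root `ε_i - ε_{i+d+1}`: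
`e_i` for `d = 0`, and `[e_i, e_{i+1,j}]_{q⁻¹}` recursively. -/
def eRoot : (d i : ℕ) → i + d + 1 < n → Uq q n
  | 0, i, h => Uq.e q ⟨i, by omega⟩
  | d + 1, i, h =>
      Uq.e q ⟨i, by omega⟩ * eRoot d (i + 1) (by omega) -
        (q : ℂ)⁻¹ • (eRoot d (i + 1) (by omega) * Uq.e q ⟨i, by omega⟩)

/-- The root vector of the root `ε_{i+d+1} - ε_i`:
`f_i` for `d = 0`, and `[f_{i+1,j}, f_i]_{q⁻¹}` recursively. -/
def fRoot : (d i : ℕ) → i + d + 1 < n → Uq q n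
  | 0, i, h => Uq.f q ⟨i, by omega⟩
  | d + 1, i, h =>
      fRoot d (i + 1) (by omega) * Uq.f q ⟨i, by omega⟩ -
        (q : ℂ)⁻¹ • (Uq.f q ⟨i, by omega⟩ * fRoot d (i + 1) (by omega))

/-- The lower triangular matrix `(π ⊗ id)(ℛ)`, where `ℛ` is the universal R-matrix normalized by
`ℛ Δ = Δ^op ℛ` and by its Cartan part `q^{∑ h_{ε_i} ⊗ h_{ε_i}}`. -/
def lMinus : Matrix (Fin n) (Fin n) (Uq q n) := fun i j =>
  if i = j then Uq.k q i
  else if h : j < i then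
    ((q : ℂ) - (q : ℂ)⁻¹) • (Uq.k q i * eRoot q (i - j - 1) j (by omega))
  else 0

/-- The upper triangular matrix `(π ⊗ id)(ℛ₂₁)`. -/
def lPlus : Matrix (Fin n) (Fin n) (Uq q n) := fun i j =>
  if i = j then Uq.k q i
  else if h : i < j then
    ((q : ℂ) - (q : ℂ)⁻¹) • (Uq.k q i * fRoot q (j - i - 1) i (by omega))
  else 0

/-- The matrix `𝒬 = (π ⊗ id)(ℛ₂₁ ℛ)` with entries in `U_q(gl_n)`. -/
def qMatrix : Matrix (Fin n) (Fin n) (Uq q n) := lPlus q * lMinus q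

/-- The operator by which `𝒬 = ∑ e_{ij} ⊗ 𝒬_{ij}` acts on `ℂ^n ⊗ M`. -/
def qOperator (n : ℕ) (M : Type*) [AddCommGroup M] [Module ℂ M] [Module (Uq q n) M]
    [IsScalarTower ℂ (Uq q n) M] : Module.End ℂ (NatTensor q n M) :=
  ∑ i : Fin n, ∑ j : Fin n,
    (TensorProduct.map (Matrix.toLin' (Matrix.single i j (1 : ℂ)))
      (Algebra.lsmul ℂ ℂ M (qMatrix q i j)) :
      (Fin n → ℂ) ⊗[ℂ] M →ₗ[ℂ] (Fin n → ℂ) ⊗[ℂ] M)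

end QOperator

/-! ### Verma modules, dynamical root vectors, and the modules `M_{σ·λ}` -/

section Verma

variable (q : ℂˣ) {n : ℕ}

/-- The left ideal defining the Verma module. A weight `μ` enters through `z i = q^{(μ, ε_i)}`,
an arbitrary family of non-zero complex numbers. -/
def vermaIdeal (z : Fin n → ℂˣ) : Submodule (Uq q n) (Uq q n) :=
  Submodule.span (Uq q n)
    (Set.range (fun j => Uq.e q j) ∪
      Set.range fun i => Uq.k q i - algebraMap ℂ (Uq q n) (z i))

/-- The Verma module `M̂_μ`. -/
abbrev Verma (z : Fin n → ℂˣ) : Type := Uq q n ⧸ vermaIdeal q z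

/-- The highest weight vector `v_μ` of `M̂_μ`. -/
def vermaVec (z : Fin n → ℂˣ) : Verma q z := (vermaIdeal q z).mkQ 1

/-- For `a = q^x`, the quantum number `[x]_q`. -/
def qNumber (a : ℂˣ) : ℂ := ((a : ℂ) - (a : ℂ)⁻¹) / ((q : ℂ) - (q : ℂ)⁻¹)

/-- The dynamical root vector `f̌_{ε_i - ε_{i+d}}`, specialized at the weight `μ`, where
`q^{(μ + ρ, ε_{i+1} - ε_{i+d})} = (z (i+1) / z (i+d)) q^{d-1}`; it is `1` for `d = 0`. -/
def dynRootAux (z : Fin n → ℂˣ) : (d i : ℕ) → i + d < n → Uq q n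
  | 0, _, _ => 1
  | 1, i, h => Uq.f q ⟨i, by omega⟩
  | d + 2, i, h =>
      let b : ℂˣ := z ⟨i + 1, by omega⟩ / z ⟨i + (d + 2), h⟩ * q ^ (d + 1)
      qNumber q b • (Uq.f q ⟨i, by omega⟩ * dynRootAux z (d + 1) (i + 1) (by omega)) -
        qNumber q (b / q) • (dynRootAux z (d + 1) (i + 1) (by omega) * Uq.f q ⟨i, by omega⟩)

/-- The specialized dynamical root vector `f̌_{ε_i - ε_j}(μ)`, equal to `1` for `i = j` and to `0`
for `i > j`. -/
def dynRoot (z : Fin n → ℂˣ) (i j : Fin n) : Uq q n :=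
  if h : i ≤ j then dynRootAux q z (j - i) i (by omega) else 0

/-- The vector
`û_m = ∑_{i ≤ m} (-q)^i ∏_{j < i} [μ_j - μ_m + m - j - 1]_q w_i ⊗ f̌_{ε_i - ε_m} v_μ`
of `ℂ^n ⊗ M̂_μ` (indices start at `0`). -/
def uHat (z : Fin n → ℂˣ) (m : Fin n) : NatTensor q n (Verma q z) :=
  ∑ i ∈ Finset.univ.filter (fun i : Fin n => i ≤ m),
    ((-(q : ℂ)) ^ (i : ℕ) *
      ∏ j ∈ Finset.univ.filter (fun j : Fin n => j < i),
        qNumber q (z j / z m * q ^ ((m : ℤ) - (j : ℤ) - 1))) •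
      wTensor q n i (dynRoot q z i m • vermaVec q z)

/-- `x̂_i = q^{2 (μ, ε_i) - 2 i}` (indices start at `0`). -/
def xHat (z : Fin n → ℂˣ) (i : Fin n) : ℂ := ((z i ^ 2 * q ^ (-2 * (i : ℤ)) : ℂˣ) : ℂ)

end Verma

section Levi

variable {n : ℕ}

/-- The composition `c` of `n` describes `𝔩 = gl(n_1) ⊕ ... ⊕ gl(n_k)`. The elements `ε_i - ε_j`
of `Π⁺_𝔩` are given by the consecutive indices `i, j` of the same block. -/
def IsLeviSimple (c : Composition n) (i j : Fin n) : Prop :=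
  (j : ℕ) = i + 1 ∧ c.index i = c.index j

/-- A permutation is admissible if it is increasing on every block. -/
def Admissible (c : Composition n) (σ : Equiv.Perm (Fin n)) : Prop :=
  ∀ i j : Fin n, c.index i = c.index j → i < j → σ i < σ j

/-- The first index `m_i` of the `i`-th block. -/
def blockHead (c : Composition n) (i : Fin c.length) : Fin n :=
  c.embedding i ⟨0, c.one_le_blocksFun i⟩

variable (q : ℂˣ)

/-- The weight `λ` orthogonal to `Π⁺_𝔩` with `q^{(λ, ε_a)} = t i` for all `a` in block `i`. -/
def leviWeight (c : Composition n) (t : Fin c.length → ℂˣ) (a : Fin n) : ℂˣ := t (c.index a)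

/-- The shifted action `σ·μ = σ(μ + ρ) - ρ`, that is,
`(σ·μ, ε_i) = (μ, ε_{σ⁻¹ i}) + i - σ⁻¹ i`. -/
def dotAction (σ : Equiv.Perm (Fin n)) (z : Fin n → ℂˣ) (i : Fin n) : ℂˣ :=
  z (σ.symm i) * q ^ ((i : ℤ) - ((σ.symm i : Fin n) : ℤ))

variable (c : Composition n) (σ : Equiv.Perm (Fin n)) (t : Fin c.length → ℂˣ)

/-- The weight `σ·λ`. -/
def sigmaWeight : Fin n → ℂˣ := dotAction q σ (leviWeight c t)

/-- The submodule of `M̂_{σ·λ}` generated by the vectors `f̌_{σ(α)} v_{σ·λ}`, `α ∈ Π⁺_𝔩`. -/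
def sigmaSub : Submodule (Uq q n) (Verma q (sigmaWeight q c σ t)) :=
  Submodule.span (Uq q n)
    {y | ∃ i j : Fin n, IsLeviSimple c i j ∧
      y = dynRoot q (sigmaWeight q c σ t) (σ i) (σ j) • vermaVec q (sigmaWeight q c σ t)}

/-- The module `M_{σ·λ}`. -/
abbrev SigmaModule : Type := Verma q (sigmaWeight q c σ t) ⧸ sigmaSub q c σ t

/-- The projection `ϖ : M̂_{σ·λ} → M_{σ·λ}`. -/
def sigmaProj : Verma q (sigmaWeight q c σ t) →ₗ[ℂ] SigmaModule q c σ t :=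
  (sigmaSub q c σ t).mkQ.restrictScalars ℂ

/-- The image of the highest weight vector in `M_{σ·λ}`. -/
def sigmaVec : SigmaModule q c σ t := sigmaProj q c σ t (vermaVec q _)

/-- `x_i = x̂_{m_i} = q^{2 (λ, ε_{m_i}) - 2 m_i}`, the value of `x̂` for the weight `λ` at the
head of block `i` (indices start at `0`). -/
def xEig (i : Fin c.length) : ℂ := xHat q (leviWeight c t) (blockHead c i)

/-- The image `p_i = σ(m_i)` of the head of block `i`. The set `{p_i}` is `I_𝔩^σ`. -/
def headPos (i : Fin c.length) : Fin n := σ (blockHead c i)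

/-- The renormalizing factor of `û_m`, `m = p_i`: the product of `x_i - x̂_l` over all `l < m`
outside of `I_𝔩^σ`, where `x̂_l` belongs to the weight `σ·λ`. -/
def cBar (i : Fin c.length) : ℂ :=
  ∏ l ∈ Finset.univ.filter
      (fun l : Fin n => l < headPos c σ i ∧ ∀ j, headPos c σ j ≠ l),
    (xEig q c t i - xHat q (sigmaWeight q c σ t) l)

open Polynomial in
/-- The renormalized vector `u_i^σ`, i.e. the regular continuation in `λ` of
`(id ⊗ ϖ)(û_{p_i})` divided by `cBar`, up to a non-zero scalar factor. It is obtained from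
`w_{p_i} ⊗ v` by applying the factors `𝒬 - x_j` for all `j` with `p_j < p_i`. -/
def uSigma (i : Fin c.length) : NatTensor q n (SigmaModule q c σ t) :=
  aeval (qOperator q n (SigmaModule q c σ t))
    (∏ j ∈ Finset.univ.filter (fun j => headPos c σ j < headPos c σ i),
      (X - C (xEig q c t j)))
    (wTensor q n (headPos c σ i) (sigmaVec q c σ t))

/-- The submodule generated by `u_i^σ`. -/
def sigmaSummand (i : Fin c.length) :
    Submodule (Uq q n) (NatTensor q n (SigmaModule q c σ t)) :=
  Submodule.span (Uq q n) {uSigma q c σ t i}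

/-- For `α ∈ Π⁺_𝔩` and `σ(α) = ε_l - ε_m`, the number `x̂_m` differs from `x̂_r` for all `r` strictly
between `l` and `m`; here `x̂` belongs to the weight `σ·λ`. -/
def PrincipalRegular : Prop :=
  ∀ i j : Fin n, IsLeviSimple c i j → ∀ r : Fin n, σ i < r → r < σ j →
    xHat q (sigmaWeight q c σ t) r ≠ xHat q (sigmaWeight q c σ t) (σ j)

end Levi

/-- The equations of a singular vector of weight `z`: `u` is annihilated by all `e_α`, and
`q^{h_{ε_i}}` acts on it as multiplication by `z i`. A singular vector is a non-zero solution. -/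
def SingularEquations (q : ℂˣ) {n : ℕ} {M : Type*} [AddCommGroup M] [Module ℂ M]
    [Module (Uq q n) M] (z : Fin n → ℂˣ) (u : M) : Prop :=
  (∀ j : Fin (n - 1), Uq.e q j • u = 0) ∧ ∀ i : Fin n, Uq.k q i • u = (z i : ℂ) • u

/-- The weight `μ + ε_m`. -/
def addEps (q : ℂˣ) {n : ℕ} (z : Fin n → ℂˣ) (m a : Fin n) : ℂˣ := if a = m then z a * q else z a

end QuantumGL

end

/-!
Write `M` for a module generated by a highest weight vector `v`. The tensor product `ℂ^n ⊗ M` is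
generated by the vectors `w_1 ⊗ v, ..., w_n ⊗ v`, and it is filtered by the submodules `flag`
generated by the first `m` of them. The operator `𝒬` commutes with the action of `U_q(gl_n)`
(`qOperator_smul`), since `ℛ` intertwines `Δ` and `Δ^op` in the natural representation. On `w_r ⊗ v`
it acts by `x̂_r` modulo the preceding step of the filtration (`qOperator_wN_sub_mem`). So
`∏ (𝒬 - x̂_l)` annihilates `ℂ^n ⊗ M`, where `l` runs over the indices at which the filtration jumps
(`aeval_headPoly_eq_zero`).

The vectors `û_m` enter through the dynamical root vectors: modulo the steps of the filtration,
`𝒬 - x̂_r` maps the part of `û_m` with indices greater than `r` to a non-zero multiple of the part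
with indices at least `r` (`qOperator_uN_sub_mem`). Hence `û_m` is proportional to
`∏_{l < m} (𝒬 - x̂_l) (w_m ⊗ v)` (`exists_aeval_prod_eq_uN`). In `M_{σ·λ}` some of the dynamical
root vectors annihilate `v`. Applying such a root vector of `ε_m - ε_l` to `w_l ⊗ v` gives a
partial sum of `û_m`, in which `w_m ⊗ v` has a non-zero coefficient under the regularity
assumption; so the filtration does not jump at `m` (`wN_mem_flag_of_dynN_smul_eq_zero`). The only
possible jumps are the `p_i`. Therefore `u_i`, the product of `𝒬 - x_j` over `p_j < p_i` applied
to `w_{p_i} ⊗ v`, is an eigenvector of `𝒬` with eigenvalue `x_i` or zero, it satisfies the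
equations of a singular vector, and the remaining factors `𝒬 - x̂_l` multiply it by `C̄_i` and
turn it into `û_{p_i}`, up to a non-zero factor. If the `x_i` are distinct, then the `u_i`
generate, and the summands are independent as parts of different eigenspaces.

It remains to show that the filtration does jump at every `p_i`, even without the regularity
assumption. For this, the Verma module is realized on words in the `f_j` modulo the Serre
relations. The matrix units `E_{j,j+1}` satisfy the Serre relations, so that `f_j ↦ E_{j,j+1}`,
`v ↦ w_m` defines a map from the Verma module to columns (`nonempty_columnMap_verma`). For
`m = p_i` it descends to `M_{σ·λ}` (`nonempty_columnMap_sigma`). A rescaled sum of its coordinates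
is a functional on `ℂ^n ⊗ M_{σ·λ}` that annihilates the image of every `f_j` and the step `p_i` of
the filtration, has the value `1` on `w_{p_i} ⊗ v`, and is an eigenvector of the transpose of `𝒬`
with eigenvalue `x_i` (`ColumnMap.exists_functional`). It detects that `u_i` is not zero if `x_i`
differs from the `x_j` with `p_j < p_i`. If `x_i = x_j` for some `p_j < p_i`, it vanishes on all
summands, so that their sum is not the whole module. -/

set_option linter.unusedSectionVars false

open scoped TensorProduct

noncomputable section

namespace QuantumGL

/-! ### Root vectors in an algebra with Chevalley generators -/

theorem smul_eq_of_sub_add {R : Type*} [Ring R] [Algebra ℂ R] {s : ℂ} (hs : s ≠ 0) {x y z : R}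
    (h : x - s • y + z = 0) : y = s⁻¹ • (x + z) := by
  have : s • y = x + z := by rw [← sub_eq_zero, ← neg_eq_zero, ← h]; abel
  rw [← this, smul_smul, inv_mul_cancel₀ hs, one_smul]

/-- The middle one `b` of three consecutive generators `a`, `b`, `c` commutes with the root vector
`[a, [b, c]_{s⁻¹}]_{s⁻¹}`. This is where `s + s⁻¹ ≠ 0` is needed: the Serre relations are solved
for `b a b` and `b c b`. -/
theorem commute_middle {R : Type*} [Ring R] [Algebra ℂ R] {s : ℂ} (hs : s + s⁻¹ ≠ 0)
    {a b c : R} (hac : a * c = c * a)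
    (h1 : b * b * a - (s + s⁻¹) • (b * a * b) + a * b * b = 0)
    (h2 : b * b * c - (s + s⁻¹) • (b * c * b) + c * b * b = 0) :
    b * (a * (b * c - s⁻¹ • (c * b)) - s⁻¹ • ((b * c - s⁻¹ • (c * b)) * a)) =
      (a * (b * c - s⁻¹ • (c * b)) - s⁻¹ • ((b * c - s⁻¹ • (c * b)) * a)) * b := by
  have hs0 : s ≠ 0 := by rintro rfl; simp at hs
  have k1 := smul_eq_of_sub_add hs h1
  have k2 := smul_eq_of_sub_add hs h2
  have e1 : b * (a * (b * c)) = (s + s⁻¹)⁻¹ • (b * (b * (c * a)) + a * (b * (b * c))) := by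
    calc b * (a * (b * c)) = (b * a * b) * c := by simp only [mul_assoc]
      _ = _ := by rw [k1]; simp only [smul_mul_assoc, add_mul, mul_assoc, hac]
  have e2 : c * (b * (a * b)) = (s + s⁻¹)⁻¹ • (c * (b * (b * a)) + a * (c * (b * b))) := by
    calc c * (b * (a * b)) = c * (b * a * b) := by simp only [mul_assoc]
      _ = _ := by
        rw [k1, mul_smul_comm, mul_add]; simp only [← mul_assoc, hac]
  have e3 : a * (b * (c * b)) = (s + s⁻¹)⁻¹ • (a * (b * (b * c)) + a * (c * (b * b))) := by
    calc a * (b * (c * b)) = a * (b * c * b) := by simp only [mul_assoc]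
      _ = _ := by rw [k2, mul_smul_comm, mul_add]; simp only [mul_assoc]
  have e4 : b * (c * (b * a)) = (s + s⁻¹)⁻¹ • (b * (b * (c * a)) + c * (b * (b * a))) := by
    calc b * (c * (b * a)) = (b * c * b) * a := by simp only [mul_assoc]
      _ = _ := by rw [k2]; simp only [smul_mul_assoc, add_mul, mul_assoc]
  have e5 : b * (a * (c * b)) = b * (c * (a * b)) := by
    rw [← mul_assoc a, hac, mul_assoc]
  have e6 : (s + s⁻¹)⁻¹ * (s + s⁻¹) = 1 := inv_mul_cancel₀ hs
  simp only [mul_sub, sub_mul, smul_mul_assoc, mul_smul_comm, mul_assoc, smul_sub, smul_smul]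
  rw [e1, e2, e3, e4, e5]
  -- the coefficients are now polynomials in `s`, `s⁻¹` and `t`, subject to `e6` and `e7`
  generalize (s + s⁻¹)⁻¹ = t at *
  have e7 : s * s⁻¹ = 1 := mul_inv_cancel₀ hs0
  match_scalars
  all_goals first
    | ring1
    | linear_combination s⁻¹ * e6 - t * e7
    | linear_combination -s⁻¹ * e6 + t * e7

/-- The inner product of `ε_a` with `ε_i - ε_j`, for indices in `ℕ`. -/
def epsR (a i j : ℕ) : ℤ := (if a = i then 1 else 0) - (if a = j then 1 else 0)

/-- Elements `x j`, `y j`, `k i`, `k' i = (k i)⁻¹` of an algebra satisfying the relations of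
`U_q(gl_n)` between the `k i` and the `x j`, among the `x j`, and of the `x i` with the `y j`.
The `x j` may be the `e_j` in `U_q(gl_n)` as well as the `f_j` in the opposite algebra.
The families are indexed by `ℕ`, and extended beyond their range by `0` or `1`. -/
structure BorelData (q : ℂˣ) (n : ℕ) (R : Type*) [Ring R] [Algebra ℂ R] where
  (x y k k' : ℕ → R)
  k_mul_k' : ∀ i, k i * k' i = 1
  k'_mul_k : ∀ i, k' i * k i = 1
  k_mul_x : ∀ i j, k i * x j = qpow q (epsR i j (j + 1)) • (x j * k i)
  x_mul_y_of_ne : ∀ i j, i ≠ j → x i * y j = y j * x i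
  x_mul_y_self : ∀ j, j + 1 < n →
    ((q : ℂ) - (q : ℂ)⁻¹) • (x j * y j - y j * x j) = k j * k' (j + 1) - k' j * k (j + 1)
  x_comm : ∀ i j, i + 1 < j → x i * x j = x j * x i
  serre_left : ∀ i, x i * x i * x (i + 1) - ((q : ℂ) + (q : ℂ)⁻¹) • (x i * x (i + 1) * x i) +
    x (i + 1) * x i * x i = 0
  serre_right : ∀ i, x (i + 1) * x (i + 1) * x i -
    ((q : ℂ) + (q : ℂ)⁻¹) • (x (i + 1) * x i * x (i + 1)) + x i * x (i + 1) * x (i + 1) = 0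

namespace BorelData

variable {q : ℂˣ} {n : ℕ} {R : Type*} [Ring R] [Algebra ℂ R] (D : BorelData q n R)

/-- The root vector `[x_i, [x_{i+1}, ..., x_{i+d}]_{q⁻¹}]_{q⁻¹}` of the root
`ε_i - ε_{i+d+1}`. -/
def root (D : BorelData q n R) : (d i : ℕ) → R
  | 0, i => D.x i
  | d + 1, i => D.x i * root D d (i + 1) - (q : ℂ)⁻¹ • (root D d (i + 1) * D.x i)

theorem root_zero (i : ℕ) : D.root 0 i = D.x i := rfl

theorem root_succ (d i : ℕ) : D.root (d + 1) i =
    D.x i * D.root d (i + 1) - (q : ℂ)⁻¹ • (D.root d (i + 1) * D.x i) := rfl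

theorem commute_root {z : R} {d i : ℕ} (h : ∀ j, i ≤ j → j ≤ i + d → Commute z (D.x j)) :
    Commute z (D.root d i) := by
  induction d generalizing i with
  | zero => exact h i le_rfl le_rfl
  | succ d ih =>
    have h1 := ih (i := i + 1) fun j hj hj' => h j (by omega) (by omega)
    have h2 := h i le_rfl (by omega)
    exact (h2.mul_right h1).sub_right ((h1.mul_right h2).smul_right (q : ℂ)⁻¹)

theorem x_commute {i j : ℕ} (h : i + 1 < j ∨ j + 1 < i) : Commute (D.x i) (D.x j) := by
  rcases h with h | h
  · exact D.x_comm i j h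
  · exact (D.x_comm j i h).symm

theorem x_commute_root {k d i : ℕ} (h : k + 1 < i ∨ i + d + 1 < k) :
    Commute (D.x k) (D.root d i) :=
  D.commute_root fun j _ _ => D.x_commute (by omega)

/-- The root vectors can also be built up from the other end. -/
theorem root_succ' (d i : ℕ) : D.root (d + 1) i =
    D.root d i * D.x (i + d + 1) - (q : ℂ)⁻¹ • (D.x (i + d + 1) * D.root d i) := by
  induction d generalizing i with
  | zero => rfl
  | succ d ih =>
    have hc : D.x i * D.x (i + 1 + d + 1) = D.x (i + 1 + d + 1) * D.x i :=
      D.x_comm _ _ (by omega)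
    rw [root_succ, ih (i + 1), root_succ D d i]
    have e : i + (d + 1) + 1 = i + 1 + d + 1 := by omega
    rw [e]
    generalize D.root d (i + 1) = Z at *
    generalize D.x (i + 1 + d + 1) = w at *
    generalize D.x i = v at *
    simp only [mul_sub, sub_mul, smul_mul_assoc, mul_smul_comm, mul_assoc, smul_sub, smul_smul,
      hc]
    rw [← mul_assoc v w, hc, mul_assoc]
    match_scalars <;> ring

/-- A root vector `q`-commutes with the first generator in its support. -/
theorem x_mul_root (d i : ℕ) :
    D.x i * D.root (d + 1) i = (q : ℂ) • (D.root (d + 1) i * D.x i) := by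
  have hq : (q : ℂ) ≠ 0 := q.ne_zero
  induction d with
  | zero =>
    rw [← sub_eq_zero, root_succ, root_zero]
    rw [← D.serre_left i]
    simp only [mul_sub, sub_mul, smul_mul_assoc, mul_smul_comm, mul_assoc, smul_sub, smul_smul]
    match_scalars <;> field_simp
    ring
  | succ d ih =>
    have hc : D.x i * D.x (i + (d + 1) + 1) = D.x (i + (d + 1) + 1) * D.x i :=
      D.x_comm _ _ (by omega)
    rw [root_succ' D (d + 1) i]
    generalize D.root (d + 1) i = Z at *
    generalize D.x (i + (d + 1) + 1) = w at *
    generalize D.x i = v at *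
    have h1 : v * (Z * w) = (q : ℂ) • (Z * (w * v)) := by
      rw [← mul_assoc, ih, smul_mul_assoc, mul_assoc, hc]
    have h2 : v * (w * Z) = (q : ℂ) • (w * (Z * v)) := by
      rw [← mul_assoc, hc, mul_assoc, ih, mul_smul_comm]
    simp only [mul_sub, sub_mul, smul_mul_assoc, mul_smul_comm, mul_assoc, smul_sub, smul_smul,
      h1, h2]
    match_scalars <;> ring

/-- A root vector `q`-commutes with the last generator in its support. -/
theorem root_mul_x (d i : ℕ) : D.root (d + 1) i * D.x (i + d + 1) =
    (q : ℂ) • (D.x (i + d + 1) * D.root (d + 1) i) := by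
  have hq : (q : ℂ) ≠ 0 := q.ne_zero
  induction d generalizing i with
  | zero =>
    rw [← sub_eq_zero, root_succ, root_zero]
    rw [← D.serre_right i]
    simp only [mul_sub, sub_mul, smul_mul_assoc, mul_smul_comm, mul_assoc, smul_sub, smul_smul,
      add_zero]
    match_scalars <;> field_simp
    ring
  | succ d ih =>
    have hc : D.x i * D.x (i + 1 + d + 1) = D.x (i + 1 + d + 1) * D.x i :=
      D.x_comm _ _ (by omega)
    have ih := ih (i + 1)
    rw [root_succ D (d + 1) i]
    have e : i + (d + 1) + 1 = i + 1 + d + 1 := by omega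
    rw [e]
    generalize D.root (d + 1) (i + 1) = Z at *
    generalize D.x (i + 1 + d + 1) = w at *
    generalize D.x i = v at *
    have h1 : v * (Z * w) = (q : ℂ) • (w * (v * Z)) := by
      rw [ih, mul_smul_comm, ← mul_assoc, hc, mul_assoc]
    have h2 : Z * (w * v) = (q : ℂ) • (w * (Z * v)) := by
      rw [← mul_assoc, ih, smul_mul_assoc, mul_assoc]
    simp only [mul_sub, sub_mul, smul_mul_assoc, mul_smul_comm, mul_assoc, smul_sub, smul_smul,
      hc, h1, h2]
    match_scalars <;> ring

/-- A generator commutes with the root vectors of the roots in whose support it is interior. -/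
theorem x_commute_root_of_interior (hq : (q : ℂ) + (q : ℂ)⁻¹ ≠ 0) {d i k : ℕ} (h1 : i < k)
    (h2 : k < i + d) : Commute (D.x k) (D.root d i) := by
  induction d generalizing i with
  | zero => omega
  | succ d ih =>
    by_cases h3 : i + 1 < k
    · have h4 := ih (i := i + 1) (by omega) (by omega)
      have h5 : Commute (D.x k) (D.x i) := D.x_commute (by omega)
      rw [root_succ]
      exact (h5.mul_right h4).sub_right ((h4.mul_right h5).smul_right (q : ℂ)⁻¹)
    obtain rfl : k = i + 1 := by omega
    -- if `k = i + 1` is not the last but one index, the last generator is split off instead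
    by_cases h4 : i + 1 < i + d
    · have h4 := ih (i := i) (by omega) (by omega)
      have h5 : Commute (D.x (i + 1)) (D.x (i + d + 1)) := D.x_commute (by omega)
      rw [root_succ']
      exact (h4.mul_right h5).sub_right ((h5.mul_right h4).smul_right (q : ℂ)⁻¹)
    obtain rfl : d = 1 := by omega
    exact commute_middle hq (D.x_comm i (i + 2) (by omega)) (D.serre_right i)
      (D.serre_left (i + 1))

theorem k'_mul_x (i j : ℕ) : D.k' i * D.x j = qpow q (-epsR i j (j + 1)) • (D.x j * D.k' i) :=
  inv_commute (qpow_mul_neg q _) (D.k_mul_k' i) (D.k'_mul_k i) (D.k_mul_x i j)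

theorem k_mul_root (a d i : ℕ) :
    D.k a * D.root d i = qpow q (epsR a i (i + d + 1)) • (D.root d i * D.k a) := by
  induction d generalizing i with
  | zero => exact D.k_mul_x a i
  | succ d ih =>
    have e : epsR a i (i + (d + 1) + 1) = epsR a i (i + 1) + epsR a (i + 1) (i + 1 + d + 1) := by
      rw [show i + (d + 1) + 1 = i + 1 + d + 1 by omega]; simp only [epsR]; ring
    rw [root_succ, mul_sub, mul_smul_comm, ← mul_assoc, ← mul_assoc, ih, k_mul_x,
      smul_mul_assoc, smul_mul_assoc, mul_assoc, mul_assoc, ih, k_mul_x, sub_mul, smul_sub, e,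
      qpow_add]
    simp only [smul_mul_assoc, mul_smul_comm, mul_assoc, smul_smul]
    match_scalars <;> ring

theorem k'_mul_root (a d i : ℕ) :
    D.k' a * D.root d i = qpow q (-epsR a i (i + d + 1)) • (D.root d i * D.k' a) :=
  inv_commute (qpow_mul_neg q _) (D.k_mul_k' a) (D.k'_mul_k a) (D.k_mul_root a d i)

theorem root_commute_y_of_lt {d i j : ℕ} (h : j < i ∨ i + d < j) :
    Commute (D.root d i) (D.y j) :=
  (D.commute_root fun l _ _ => (D.x_mul_y_of_ne l j (by omega)).symm).symm

/-- The commutator of a root vector with the `y` of the first simple root in its support. -/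
theorem root_mul_y_left {d i : ℕ} (h : i + 1 < n) :
    ((q : ℂ) - (q : ℂ)⁻¹) • (D.root (d + 1) i * D.y i - D.y i * D.root (d + 1) i) =
      -(((q : ℂ) - (q : ℂ)⁻¹) • (D.root d (i + 1) * (D.k' i * D.k (i + 1)))) := by
  have hq : (q : ℂ) ≠ 0 := q.ne_zero
  have h1 := D.x_mul_y_self i h
  have h2 : D.root d (i + 1) * D.y i = D.y i * D.root d (i + 1) :=
    D.root_commute_y_of_lt (by omega)
  have h3 : D.k i * D.k' (i + 1) * D.root d (i + 1) =
      (q : ℂ)⁻¹ • (D.root d (i + 1) * (D.k i * D.k' (i + 1))) := by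
    rw [mul_assoc, k'_mul_root, mul_smul_comm, ← mul_assoc, k_mul_root, smul_mul_assoc, smul_smul,
      mul_assoc, ← qpow_add, ← qpow_neg_one]
    congr 2
    simp only [epsR]; split_ifs <;> omega
  have h4 : D.k' i * D.k (i + 1) * D.root d (i + 1) =
      (q : ℂ) • (D.root d (i + 1) * (D.k' i * D.k (i + 1))) := by
    rw [mul_assoc, k_mul_root, mul_smul_comm, ← mul_assoc, k'_mul_root, smul_mul_assoc, smul_smul,
      mul_assoc, ← qpow_add, ← qpow_one]
    congr 2
    simp only [epsR]; split_ifs <;> omega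
  rw [root_succ]
  generalize D.root d (i + 1) = Z at *
  generalize D.k i * D.k' (i + 1) = K at *
  generalize D.k' i * D.k (i + 1) = K' at *
  generalize D.x i = x at *
  generalize D.y i = y at *
  generalize hs : ((q : ℂ) - (q : ℂ)⁻¹) = s at *
  calc s • ((x * Z - (q : ℂ)⁻¹ • (Z * x)) * y - y * (x * Z - (q : ℂ)⁻¹ • (Z * x)))
      = (s • (x * y - y * x)) * Z - (q : ℂ)⁻¹ • (Z * (s • (x * y - y * x))) := by
        have e1 : x * (Z * y) = x * (y * Z) := by rw [h2]
        have e2 : y * (Z * x) = Z * (y * x) := by rw [← mul_assoc, ← h2, mul_assoc]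
        simp only [mul_sub, sub_mul, smul_mul_assoc, mul_smul_comm, mul_assoc, smul_sub,
          smul_smul, e1, e2]
        match_scalars <;> ring
    _ = _ := by
        rw [h1, sub_mul, h3, h4, mul_sub, ← hs]
        match_scalars <;> ring

/-- The commutator of a root vector with the `y` of the last simple root in its support. -/
theorem root_mul_y_right {d i : ℕ} (h : i + d + 2 < n) :
    ((q : ℂ) - (q : ℂ)⁻¹) • (D.root (d + 1) i * D.y (i + d + 1) -
        D.y (i + d + 1) * D.root (d + 1) i) =
      ((q : ℂ) - (q : ℂ)⁻¹) • (D.k (i + d + 1) * D.k' (i + d + 2) * D.root d i) := by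
  have hq : (q : ℂ) ≠ 0 := q.ne_zero
  have h1 := D.x_mul_y_self (i + d + 1) h
  have h2 : D.root d i * D.y (i + d + 1) = D.y (i + d + 1) * D.root d i :=
    D.root_commute_y_of_lt (by omega)
  have h3 : D.k (i + d + 1) * D.k' (i + d + 2) * D.root d i =
      (q : ℂ)⁻¹ • (D.root d i * (D.k (i + d + 1) * D.k' (i + d + 2))) := by
    rw [mul_assoc, k'_mul_root, mul_smul_comm, ← mul_assoc, k_mul_root, smul_mul_assoc, smul_smul,
      mul_assoc, ← qpow_add, ← qpow_neg_one]
    congr 2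
    simp only [epsR]; split_ifs <;> omega
  have h4 : D.k' (i + d + 1) * D.k (i + d + 2) * D.root d i =
      (q : ℂ) • (D.root d i * (D.k' (i + d + 1) * D.k (i + d + 2))) := by
    rw [mul_assoc, k_mul_root, mul_smul_comm, ← mul_assoc, k'_mul_root, smul_mul_assoc, smul_smul,
      mul_assoc, ← qpow_add, ← qpow_one]
    congr 2
    simp only [epsR]; split_ifs <;> omega
  rw [root_succ']
  rw [h3]
  rw [show i + d + 1 + 1 = i + d + 2 by omega] at h1
  generalize D.root d i = Z at *
  generalize D.k (i + d + 1) * D.k' (i + d + 2) = K at *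
  generalize D.k' (i + d + 1) * D.k (i + d + 2) = K' at *
  generalize D.x (i + d + 1) = x at *
  generalize D.y (i + d + 1) = y at *
  generalize hs : ((q : ℂ) - (q : ℂ)⁻¹) = s at *
  calc s • ((Z * x - (q : ℂ)⁻¹ • (x * Z)) * y - y * (Z * x - (q : ℂ)⁻¹ • (x * Z)))
      = Z * (s • (x * y - y * x)) - (q : ℂ)⁻¹ • ((s • (x * y - y * x)) * Z) := by
        have e1 : x * (Z * y) = x * (y * Z) := by rw [h2]
        have e2 : y * (Z * x) = Z * (y * x) := by rw [← mul_assoc, ← h2, mul_assoc]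
        simp only [mul_sub, sub_mul, smul_mul_assoc, mul_smul_comm, mul_assoc, smul_sub,
          smul_smul, e1, e2]
        match_scalars <;> ring
    _ = _ := by
        rw [h1, sub_mul, h3, h4, mul_sub, ← hs]
        match_scalars <;> field_simp
        ring

/-- A `y` commutes with the root vectors of the roots in whose support it is interior. -/
theorem root_commute_y_of_interior (hq : (q : ℂ) - (q : ℂ)⁻¹ ≠ 0) {d i j : ℕ} (hn : j + 1 < n)
    (h1 : i < j) (h2 : j < i + d) : Commute (D.root d i) (D.y j) := by
  have hq0 : (q : ℂ) ≠ 0 := q.ne_zero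
  induction d generalizing i with
  | zero => omega
  | succ d ih =>
    have h5 : Commute (D.x i) (D.y j) := D.x_mul_y_of_ne _ _ (by omega)
    by_cases h3 : i + 1 < j
    · have h4 := ih (i := i + 1) (by omega) (by omega)
      rw [root_succ]
      exact (h5.mul_left h4).sub_left ((h4.mul_left h5).smul_left (q : ℂ)⁻¹)
    obtain rfl : j = i + 1 := by omega
    obtain ⟨d, rfl⟩ : ∃ d', d = d' + 1 := ⟨d - 1, by omega⟩
    have h6 := D.root_mul_y_left (d := d) hn
    rw [← smul_neg] at h6
    have h6 := smul_right_injective R hq h6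
    have h7 : Commute (D.x i) (D.root d (i + 1 + 1)) := D.x_commute_root (by omega)
    have h8 : D.k' (i + 1) * D.k (i + 2) * D.x i = (q : ℂ) • (D.x i * (D.k' (i + 1) *
        D.k (i + 2))) := by
      rw [mul_assoc, k_mul_x, mul_smul_comm, ← mul_assoc, k'_mul_x, smul_mul_assoc, smul_smul,
        mul_assoc, ← qpow_add, ← qpow_one]
      congr 2
      simp only [epsR]; split_ifs <;> omega
    rw [root_succ]
    rw [show i + 1 + 1 = i + 2 by omega] at *
    have h9 : D.root (d + 1) (i + 1) * D.y (i + 1) = D.y (i + 1) * D.root (d + 1) (i + 1) -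
        D.root d (i + 2) * (D.k' (i + 1) * D.k (i + 2)) := by
      rw [sub_eq_add_neg, ← h6]; abel
    have h5 := h5.eq
    have h7 := h7.eq
    rw [commute_iff_eq]
    generalize D.root (d + 1) (i + 1) = W at *
    generalize D.root d (i + 2) = Z at *
    generalize D.k' (i + 1) * D.k (i + 2) = K at *
    generalize D.x i = x at *
    generalize D.y (i + 1) = y at *
    simp only [mul_sub, sub_mul, smul_mul_assoc, mul_smul_comm, mul_assoc, h9, h5]
    rw [← mul_assoc W y, h9, sub_mul, ← mul_assoc x y, h5, mul_assoc Z, h8, mul_smul_comm,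
      ← mul_assoc Z x, ← h7]
    simp only [mul_assoc]
    match_scalars <;> field_simp
    ring

end BorelData

/-! ### The generators of `U_q(gl_n)` indexed by natural numbers -/

section NatIndexed

variable (q : ℂˣ) (n : ℕ)

/-- `e_j`, extended by `0`. -/
def eN (j : ℕ) : Uq q n := if h : j < n - 1 then Uq.e q ⟨j, h⟩ else 0

/-- `f_j`, extended by `0`. -/
def fN (j : ℕ) : Uq q n := if h : j < n - 1 then Uq.f q ⟨j, h⟩ else 0

/-- `q^{h_{ε_i}}`, extended by `1`. -/
def kN (i : ℕ) : Uq q n := if h : i < n then Uq.k q ⟨i, h⟩ else 1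

/-- `q^{-h_{ε_i}}`, extended by `1`. -/
def kiN (i : ℕ) : Uq q n := if h : i < n then Uq.kinv q ⟨i, h⟩ else 1

variable {q n}

theorem eN_of_lt {j : ℕ} (h : j < n - 1) : eN q n j = Uq.e q ⟨j, h⟩ := dif_pos h
theorem fN_of_lt {j : ℕ} (h : j < n - 1) : fN q n j = Uq.f q ⟨j, h⟩ := dif_pos h
theorem kN_of_lt {j : ℕ} (h : j < n) : kN q n j = Uq.k q ⟨j, h⟩ := dif_pos h
theorem kiN_of_lt {j : ℕ} (h : j < n) : kiN q n j = Uq.kinv q ⟨j, h⟩ := dif_pos h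
theorem eN_val (j : Fin (n - 1)) : eN q n j = Uq.e q j := eN_of_lt j.2
theorem fN_val (j : Fin (n - 1)) : fN q n j = Uq.f q j := fN_of_lt j.2
theorem kN_val (j : Fin n) : kN q n j = Uq.k q j := kN_of_lt j.2
theorem kiN_val (j : Fin n) : kiN q n j = Uq.kinv q j := kiN_of_lt j.2
theorem eN_of_le {j : ℕ} (h : n ≤ j + 1) : eN q n j = 0 := dif_neg (by omega)
theorem fN_of_le {j : ℕ} (h : n ≤ j + 1) : fN q n j = 0 := dif_neg (by omega)

theorem epsRoot_eq (i : Fin n) (j : Fin (n - 1)) : epsRoot i j = epsR i j (j + 1) := by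
  simp [epsRoot, epsR, lo, hi, Fin.ext_iff]

theorem epsRoot_mk {i j : ℕ} (h : i < n) (h' : j < n - 1) :
    epsRoot (⟨i, h⟩ : Fin n) ⟨j, h'⟩ = epsR i j (j + 1) := epsRoot_eq _ _

theorem kN_mul_kiN (i : ℕ) : kN q n i * kiN q n i = 1 := by
  unfold kN kiN; split_ifs
  · exact k_kinv q _
  · simp

theorem kiN_mul_kN (i : ℕ) : kiN q n i * kN q n i = 1 := by
  unfold kN kiN; split_ifs
  · exact kinv_k q _
  · simp

theorem kN_comm (i j : ℕ) : kN q n i * kN q n j = kN q n j * kN q n i := by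
  unfold kN; split_ifs
  · exact k_comm q _ _
  all_goals simp

theorem kiN_comm_kN (i j : ℕ) : kiN q n i * kN q n j = kN q n j * kiN q n i := by
  unfold kN kiN; split_ifs
  · exact kinv_comm_k q _ _
  all_goals simp

theorem kN_mul_eN (i j : ℕ) :
    kN q n i * eN q n j = qpow q (epsR i j (j + 1)) • (eN q n j * kN q n i) := by
  unfold kN eN; split_ifs with h1 h2 h2
  · rw [k_e, epsRoot_mk]
  · simp
  · have : epsR i j (j + 1) = 0 := by simp only [epsR]; split_ifs <;> omega
    simp [this, qpow_zero]
  · simp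

theorem kN_mul_fN (i j : ℕ) :
    kN q n i * fN q n j = qpow q (-epsR i j (j + 1)) • (fN q n j * kN q n i) := by
  unfold kN fN; split_ifs with h1 h2 h2
  · rw [k_f, epsRoot_mk]
  · simp
  · have : epsR i j (j + 1) = 0 := by simp only [epsR]; split_ifs <;> omega
    simp [this, qpow_zero]
  · simp

theorem fN_mul_kN (i j : ℕ) :
    fN q n j * kN q n i = qpow q (epsR i j (j + 1)) • (kN q n i * fN q n j) := by
  rw [kN_mul_fN, smul_smul, qpow_mul_neg, one_smul]

theorem eN_mul_kN (i j : ℕ) :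
    eN q n j * kN q n i = qpow q (-epsR i j (j + 1)) • (kN q n i * eN q n j) := by
  rw [kN_mul_eN, smul_smul, mul_comm, qpow_mul_neg, one_smul]

theorem eN_mul_fN_of_ne {i j : ℕ} (h : i ≠ j) : eN q n i * fN q n j = fN q n j * eN q n i := by
  unfold eN fN; split_ifs
  · exact e_f_ne q _ _ (by simpa using h)
  all_goals simp

theorem eN_mul_fN_self {j : ℕ} (h : j + 1 < n) :
    ((q : ℂ) - (q : ℂ)⁻¹) • (eN q n j * fN q n j - fN q n j * eN q n j) =
      kN q n j * kiN q n (j + 1) - kiN q n j * kN q n (j + 1) := by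
  have h' : j < n - 1 := by omega
  rw [eN_of_lt h', fN_of_lt h', kN_of_lt h, kiN_of_lt h, kN_of_lt (by omega : j < n),
    kiN_of_lt (by omega : j < n)]
  exact e_f_same q ⟨j, h'⟩

theorem rootRoot_mk {i j : ℕ} (h : i < n - 1) (h' : j < n - 1) :
    rootRoot (⟨i, h⟩ : Fin (n - 1)) ⟨j, h'⟩ = epsR i j (j + 1) - epsR (i + 1) j (j + 1) := by
  simp [rootRoot, epsRoot_eq, lo, hi]

theorem eN_comm {i j : ℕ} (h : i + 1 < j) : eN q n i * eN q n j = eN q n j * eN q n i := by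
  unfold eN; split_ifs
  · exact e_comm q _ _ (by rw [rootRoot_mk]; simp only [epsR]; split_ifs <;> omega)
  all_goals simp

theorem fN_comm {i j : ℕ} (h : i + 1 < j) : fN q n i * fN q n j = fN q n j * fN q n i := by
  unfold fN; split_ifs
  · exact f_comm q _ _ (by rw [rootRoot_mk]; simp only [epsR]; split_ifs <;> omega)
  all_goals simp

theorem eN_serre {i j : ℕ} (h : i + 1 = j ∨ j + 1 = i) :
    eN q n i * eN q n i * eN q n j - ((q : ℂ) + (q : ℂ)⁻¹) • (eN q n i * eN q n j * eN q n i) +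
      eN q n j * eN q n i * eN q n i = 0 := by
  unfold eN; split_ifs
  · exact e_serre q _ _ (by rw [rootRoot_mk]; simp only [epsR]; split_ifs <;> omega)
  all_goals simp

theorem fN_serre {i j : ℕ} (h : i + 1 = j ∨ j + 1 = i) :
    fN q n i * fN q n i * fN q n j - ((q : ℂ) + (q : ℂ)⁻¹) • (fN q n i * fN q n j * fN q n i) +
      fN q n j * fN q n i * fN q n i = 0 := by
  unfold fN; split_ifs
  · exact f_serre q _ _ (by rw [rootRoot_mk]; simp only [epsR]; split_ifs <;> omega)
  all_goals simp

variable (q n)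

/-- The relations of `U_q(gl_n)` with the `e_j` in the role of the `x j`. -/
def posData : BorelData q n (Uq q n) where
  x := eN q n
  y := fN q n
  k := kN q n
  k' := kiN q n
  k_mul_k' := kN_mul_kiN
  k'_mul_k := kiN_mul_kN
  k_mul_x := kN_mul_eN
  x_mul_y_of_ne _ _ h := eN_mul_fN_of_ne h
  x_mul_y_self _ h := eN_mul_fN_self h
  x_comm _ _ h := eN_comm h
  serre_left _ := eN_serre (.inl rfl)
  serre_right _ := eN_serre (.inr rfl)

open MulOpposite in
/-- The relations of `U_q(gl_n)` with the `f_j` in the role of the `x j`. Passing to the opposite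
algebra turns them into those of the `e_j`. -/
def negData : BorelData q n (Uq q n)ᵐᵒᵖ where
  x j := op (fN q n j)
  y j := op (eN q n j)
  k i := op (kN q n i)
  k' i := op (kiN q n i)
  k_mul_k' i := by rw [← op_mul, kiN_mul_kN, op_one]
  k'_mul_k i := by rw [← op_mul, kN_mul_kiN, op_one]
  k_mul_x i j := by rw [← op_mul, fN_mul_kN, op_smul, op_mul]
  x_mul_y_of_ne i j h := by rw [← op_mul, ← op_mul, eN_mul_fN_of_ne h.symm]
  x_mul_y_self j h := by
    simp only [← op_mul, ← op_sub, ← op_smul]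
    rw [eN_mul_fN_self h, kiN_comm_kN, kiN_comm_kN]
  x_comm i j h := by rw [← op_mul, ← op_mul, fN_comm h]
  serre_left i := by
    have := fN_serre (q := q) (n := n) (i := i) (j := i + 1) (.inl rfl)
    simp only [← op_mul, ← op_sub, ← op_add, ← op_smul, ← mul_assoc]
    rw [← op_zero, ← this]; congr 1; abel
  serre_right i := by
    have := fN_serre (q := q) (n := n) (i := i + 1) (j := i) (.inr rfl)
    simp only [← op_mul, ← op_sub, ← op_add, ← op_smul, ← mul_assoc]
    rw [← op_zero, ← this]; congr 1; abel

/-- The root vector of the root `ε_i - ε_{i+d+1}`. -/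
def eR (d i : ℕ) : Uq q n := (posData q n).root d i

/-- The root vector of the root `ε_{i+d+1} - ε_i`. -/
def fR (d i : ℕ) : Uq q n := ((negData q n).root d i).unop

variable {q n}

theorem eRoot_eq (d i : ℕ) (h : i + d + 1 < n) : eRoot q d i h = eR q n d i := by
  induction d generalizing i with
  | zero => rw [eRoot, eR, BorelData.root_zero]; exact (eN_of_lt _).symm
  | succ d ih =>
    rw [eRoot, eR, BorelData.root_succ, ih]
    rw [show (posData q n).x i = Uq.e q ⟨i, by omega⟩ from eN_of_lt _]
    rfl

theorem fR_zero (i : ℕ) : fR q n 0 i = fN q n i := rfl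

theorem eR_zero (i : ℕ) : eR q n 0 i = eN q n i := rfl

theorem fR_succ (d i : ℕ) : fR q n (d + 1) i =
    fR q n d (i + 1) * fN q n i - (q : ℂ)⁻¹ • (fN q n i * fR q n d (i + 1)) := rfl

theorem eR_succ (d i : ℕ) : eR q n (d + 1) i =
    eN q n i * eR q n d (i + 1) - (q : ℂ)⁻¹ • (eR q n d (i + 1) * eN q n i) := rfl

theorem fRoot_eq (d i : ℕ) (h : i + d + 1 < n) : fRoot q d i h = fR q n d i := by
  induction d generalizing i with
  | zero => rw [fRoot, fR_zero]; exact (fN_of_lt _).symm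
  | succ d ih =>
    rw [fRoot, fR_succ, ih, fN_of_lt (by omega : i < n - 1)]

theorem eR_succ' (d i : ℕ) : eR q n (d + 1) i =
    eR q n d i * eN q n (i + d + 1) - (q : ℂ)⁻¹ • (eN q n (i + d + 1) * eR q n d i) :=
  (posData q n).root_succ' d i

theorem fR_succ' (d i : ℕ) : fR q n (d + 1) i =
    fN q n (i + d + 1) * fR q n d i - (q : ℂ)⁻¹ • (fR q n d i * fN q n (i + d + 1)) :=
  congrArg MulOpposite.unop ((negData q n).root_succ' d i)

theorem eN_mul_eR (d i : ℕ) :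
    eN q n i * eR q n (d + 1) i = (q : ℂ) • (eR q n (d + 1) i * eN q n i) :=
  (posData q n).x_mul_root d i

theorem fR_mul_fN (d i : ℕ) :
    fR q n (d + 1) i * fN q n i = (q : ℂ) • (fN q n i * fR q n (d + 1) i) :=
  congrArg MulOpposite.unop ((negData q n).x_mul_root d i)

theorem eR_mul_eN (d i : ℕ) : eR q n (d + 1) i * eN q n (i + d + 1) =
    (q : ℂ) • (eN q n (i + d + 1) * eR q n (d + 1) i) :=
  (posData q n).root_mul_x d i

theorem fN_mul_fR (d i : ℕ) : fN q n (i + d + 1) * fR q n (d + 1) i =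
    (q : ℂ) • (fR q n (d + 1) i * fN q n (i + d + 1)) :=
  congrArg MulOpposite.unop ((negData q n).root_mul_x d i)

theorem eN_commute_eR (hq : (q : ℂ) + (q : ℂ)⁻¹ ≠ 0) {d i j : ℕ}
    (h : j + 1 < i ∨ i + d + 1 < j ∨ (i < j ∧ j < i + d)) :
    Commute (eN q n j) (eR q n d i) := by
  by_cases h1 : i < j ∧ j < i + d
  · exact (posData q n).x_commute_root_of_interior hq h1.1 h1.2
  · exact (posData q n).x_commute_root (by omega)

theorem fN_commute_fR (hq : (q : ℂ) + (q : ℂ)⁻¹ ≠ 0) {d i j : ℕ}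
    (h : j + 1 < i ∨ i + d + 1 < j ∨ (i < j ∧ j < i + d)) :
    Commute (fN q n j) (fR q n d i) := by
  by_cases h1 : i < j ∧ j < i + d
  · exact ((negData q n).x_commute_root_of_interior hq h1.1 h1.2).unop
  · exact ((negData q n).x_commute_root (by omega)).unop

theorem fN_commute_eR (hq : (q : ℂ) - (q : ℂ)⁻¹ ≠ 0) {d i j : ℕ} (hj : j + 1 < n)
    (h : j < i ∨ i + d < j ∨ (i < j ∧ j < i + d)) :
    Commute (fN q n j) (eR q n d i) := by
  by_cases h1 : i < j ∧ j < i + d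
  · exact ((posData q n).root_commute_y_of_interior hq hj h1.1 h1.2).symm
  · exact ((posData q n).root_commute_y_of_lt (by omega)).symm

theorem eN_commute_fR (hq : (q : ℂ) - (q : ℂ)⁻¹ ≠ 0) {d i j : ℕ} (hj : j + 1 < n)
    (h : j < i ∨ i + d < j ∨ (i < j ∧ j < i + d)) :
    Commute (eN q n j) (fR q n d i) := by
  by_cases h1 : i < j ∧ j < i + d
  · exact ((negData q n).root_commute_y_of_interior hq hj h1.1 h1.2).symm.unop
  · exact ((negData q n).root_commute_y_of_lt (by omega)).symm.unop

theorem eR_mul_fN_left {d i : ℕ} (h : i + 1 < n) :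
    ((q : ℂ) - (q : ℂ)⁻¹) • (eR q n (d + 1) i * fN q n i - fN q n i * eR q n (d + 1) i) =
      -(((q : ℂ) - (q : ℂ)⁻¹) • (eR q n d (i + 1) * (kiN q n i * kN q n (i + 1)))) :=
  (posData q n).root_mul_y_left h

theorem eR_mul_fN_right {d i : ℕ} (h : i + d + 2 < n) :
    ((q : ℂ) - (q : ℂ)⁻¹) • (eR q n (d + 1) i * fN q n (i + d + 1) -
        fN q n (i + d + 1) * eR q n (d + 1) i) =
      ((q : ℂ) - (q : ℂ)⁻¹) • (kN q n (i + d + 1) * kiN q n (i + d + 2) * eR q n d i) :=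
  (posData q n).root_mul_y_right h

theorem eN_mul_fR_left {d i : ℕ} (h : i + 1 < n) :
    ((q : ℂ) - (q : ℂ)⁻¹) • (eN q n i * fR q n (d + 1) i - fR q n (d + 1) i * eN q n i) =
      -(((q : ℂ) - (q : ℂ)⁻¹) • (kN q n (i + 1) * kiN q n i * fR q n d (i + 1))) :=
  congrArg MulOpposite.unop ((negData q n).root_mul_y_left h)

theorem eN_mul_fR_right {d i : ℕ} (h : i + d + 2 < n) :
    ((q : ℂ) - (q : ℂ)⁻¹) • (eN q n (i + d + 1) * fR q n (d + 1) i -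
        fR q n (d + 1) i * eN q n (i + d + 1)) =
      ((q : ℂ) - (q : ℂ)⁻¹) • (fR q n d i * (kiN q n (i + d + 2) * kN q n (i + d + 1))) :=
  congrArg MulOpposite.unop ((negData q n).root_mul_y_right h)

theorem kN_mul_eR (a d i : ℕ) :
    kN q n a * eR q n d i = qpow q (epsR a i (i + d + 1)) • (eR q n d i * kN q n a) :=
  (posData q n).k_mul_root a d i

theorem fR_mul_kN (a d i : ℕ) :
    fR q n d i * kN q n a = qpow q (epsR a i (i + d + 1)) • (kN q n a * fR q n d i) :=
  congrArg MulOpposite.unop ((negData q n).k_mul_root a d i)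

end NatIndexed

/-! ### Commutation of the matrices of `ℛ` and `ℛ₂₁` with the generators -/

section LMatrices

variable (q : ℂˣ) (n : ℕ)

/-- The entries of `lMinus`, indexed by natural numbers. -/
def lmN (a b : ℕ) : Uq q n :=
  if a = b then kN q n a
  else if b < a then ((q : ℂ) - (q : ℂ)⁻¹) • (kN q n a * eR q n (a - b - 1) b) else 0

/-- The entries of `lPlus`, indexed by natural numbers. -/
def lpN (a b : ℕ) : Uq q n :=
  if a = b then kN q n a
  else if a < b then ((q : ℂ) - (q : ℂ)⁻¹) • (kN q n a * fR q n (b - a - 1) a) else 0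

variable {q n}

theorem lMinus_eq (i j : Fin n) : lMinus q i j = lmN q n i j := by
  unfold lMinus lmN
  by_cases h : i = j
  · rw [if_pos h, if_pos (by rw [h]), kN_val]
  · rw [if_neg h, if_neg (by simpa [Fin.ext_iff] using h)]
    split_ifs with h1 h2 h2
    · rw [kN_val, eRoot_eq]
    · exact absurd h1 h2
    · exact absurd h2 h1
    · rfl

theorem lPlus_eq (i j : Fin n) : lPlus q i j = lpN q n i j := by
  unfold lPlus lpN
  by_cases h : i = j
  · rw [if_pos h, if_pos (by rw [h]), kN_val]
  · rw [if_neg h, if_neg (by simpa [Fin.ext_iff] using h)]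
    split_ifs with h1 h2 h2
    · rw [kN_val, fRoot_eq]
    · exact absurd h1 h2
    · exact absurd h2 h1
    · rfl

theorem lmN_self (a : ℕ) : lmN q n a a = kN q n a := if_pos rfl

theorem lmN_add (b d : ℕ) : lmN q n (b + d + 1) b =
    ((q : ℂ) - (q : ℂ)⁻¹) • (kN q n (b + d + 1) * eR q n d b) := by
  rw [lmN, if_neg (by omega), if_pos (by omega), show b + d + 1 - b - 1 = d by omega]

theorem lmN_of_lt {a b : ℕ} (h : a < b) : lmN q n a b = 0 := by
  rw [lmN, if_neg (by omega), if_neg (by omega)]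

theorem lpN_self (a : ℕ) : lpN q n a a = kN q n a := if_pos rfl

theorem lpN_add (a d : ℕ) : lpN q n a (a + d + 1) =
    ((q : ℂ) - (q : ℂ)⁻¹) • (kN q n a * fR q n d a) := by
  rw [lpN, if_neg (by omega), if_pos (by omega), show a + d + 1 - a - 1 = d by omega]

theorem lpN_of_lt {a b : ℕ} (h : b < a) : lpN q n a b = 0 := by
  rw [lpN, if_neg (by omega), if_neg (by omega)]

theorem kN_mul_kiN_mul_kN (i j : ℕ) : kN q n i * kiN q n j * kN q n j = kN q n i := by
  rw [mul_assoc, kiN_mul_kN, mul_one]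

theorem kN_mul_kN_mul_kiN (i j : ℕ) : kN q n i * (kN q n j * kiN q n i) = kN q n j := by
  rw [← mul_assoc, kN_comm, mul_assoc, kN_mul_kiN, mul_one]

theorem kiN_mul_kN_mul_kN (i j : ℕ) : kiN q n i * kN q n j * kN q n i = kN q n j := by
  rw [mul_assoc, kN_comm, ← mul_assoc, kiN_mul_kN, one_mul]

theorem epsR_left {a i j : ℕ} (h : a = i) (h' : a ≠ j) : epsR a i j = 1 := by
  rw [epsR, if_pos h, if_neg h', sub_zero]
theorem epsR_right {a i j : ℕ} (h : a = j) (h' : a ≠ i) : epsR a i j = -1 := by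
  rw [epsR, if_neg h', if_pos h, zero_sub]
theorem epsR_of_ne {a i j : ℕ} (h : a ≠ i) (h' : a ≠ j) : epsR a i j = 0 := by simp [epsR, h, h']

/-- An entry of the relation `ℛ Δ(e_j) = Δ^op(e_j) ℛ` in the natural representation. -/
theorem lmN_mul_eN (hq : (q : ℂ) + (q : ℂ)⁻¹ ≠ 0) (a b j : ℕ) :
    qpow q (epsR b j (j + 1)) • (lmN q n a b * eN q n j) + (if b = j + 1 then lmN q n a j else 0) =
      eN q n j * lmN q n a b +
        (if a = j then kN q n j * kiN q n (j + 1) * lmN q n (j + 1) b else 0) := by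
  have hq0 : (q : ℂ) ≠ 0 := q.ne_zero
  rcases lt_trichotomy a b with h | rfl | h
  · rw [lmN_of_lt h]
    by_cases h1 : b = j + 1 <;> by_cases h2 : a = j
    · subst h1 h2; simp [lmN_self, kN_mul_kiN_mul_kN]
    · simp [h1, h2, lmN_of_lt (show a < j by omega)]
    · simp [h1, h2, lmN_of_lt (show j + 1 < b by omega)]
    · simp [h1, h2]
  · -- the root vectors are scaled so that the off-diagonal entries next to the diagonal are
    -- `(q - q⁻¹) k e_j`, which accounts for the difference of the two diagonal terms
    rw [lmN_self, eN_mul_kN]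
    by_cases h1 : a = j + 1
    · subst h1
      have := lmN_add (q := q) (n := n) j 0
      rw [add_zero, eR_zero] at this
      rw [if_pos rfl, if_neg (by omega), this, epsR_right rfl (by omega), qpow_neg_one, neg_neg,
        qpow_one]
      match_scalars; ring
    by_cases h2 : a = j
    · subst h2
      have := lmN_add (q := q) (n := n) a 0
      rw [add_zero, eR_zero] at this
      rw [if_neg (by omega), if_pos rfl, this, epsR_left rfl (by omega), qpow_neg_one,
        qpow_one, mul_smul_comm, ← mul_assoc, kN_mul_kiN_mul_kN]
      match_scalars; ring
    · rw [if_neg h1, if_neg h2, epsR_of_ne h2 h1, neg_zero]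
  · obtain ⟨d, rfl⟩ : ∃ d, a = b + d + 1 := ⟨a - b - 1, by omega⟩
    rw [lmN_add, mul_smul_comm, ← mul_assoc (eN q n j), eN_mul_kN, smul_mul_assoc, smul_mul_assoc,
      mul_assoc, mul_assoc]
    by_cases h1 : b = j + 1
    · subst h1
      rw [if_pos rfl, if_neg (by omega), epsR_right rfl (by omega),
        epsR_of_ne (by omega) (by omega), show j + 1 + d + 1 = j + (d + 1) + 1 by omega, lmN_add,
        eR_succ, qpow_neg_one, neg_zero, qpow_zero, mul_sub, mul_smul_comm]
      match_scalars <;> ring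
    by_cases h2 : b + d + 1 = j
    · subst h2
      have := lmN_add (q := q) (n := n) b (d + 1)
      rw [← add_assoc] at this
      rw [if_neg h1, if_pos rfl, this, epsR_left rfl (by omega),
        epsR_of_ne (by omega) (by omega), eR_succ', qpow_neg_one, qpow_zero, mul_smul_comm,
        ← mul_assoc (_ * _) (kN q n _), kN_mul_kiN_mul_kN, mul_sub, mul_smul_comm]
      match_scalars <;> ring
    rw [if_neg h1, if_neg h2, add_zero, add_zero]
    by_cases h3 : b = j
    · subst h3
      rw [epsR_left rfl (by omega)]
      cases d with
      | zero =>
        rw [epsR_right (by omega) (by omega), neg_neg, eR_zero, smul_comm]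
      | succ d =>
        rw [epsR_of_ne (by omega) (by omega), eN_mul_eR, neg_zero, qpow_zero, one_smul, qpow_one,
          mul_smul_comm, smul_comm]
    by_cases h4 : b + d = j
    · subst h4
      obtain ⟨d, rfl⟩ : ∃ d', d = d' + 1 := ⟨d - 1, by omega⟩
      rw [epsR_of_ne (by omega) (by omega), epsR_right (by omega) (by omega), neg_neg, qpow_zero,
        one_smul, qpow_one, ← add_assoc, eR_mul_eN, mul_smul_comm]
    · rw [epsR_of_ne (by omega) (by omega), epsR_of_ne (by omega) (by omega), neg_zero, qpow_zero,
        one_smul, one_smul, (eN_commute_eR hq (by omega)).eq]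

/-- An entry of the relation `ℛ Δ(f_j) = Δ^op(f_j) ℛ` in the natural representation. -/
theorem lmN_mul_fN (hq : (q : ℂ) - (q : ℂ)⁻¹ ≠ 0) (a b : ℕ) {j : ℕ} (hj : j + 1 < n) :
    lmN q n a b * fN q n j +
        (if b = j then lmN q n a (j + 1) * (kiN q n j * kN q n (j + 1)) else 0) =
      qpow q (-epsR a j (j + 1)) • (fN q n j * lmN q n a b) +
        (if a = j + 1 then lmN q n j b else 0) := by
  rcases lt_trichotomy a b with h | rfl | h
  · rw [lmN_of_lt h]
    by_cases h1 : b = j <;> by_cases h2 : a = j + 1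
    · omega
    · simp [h1, h2, lmN_of_lt (show a < j + 1 by omega)]
    · simp [h1, h2, lmN_of_lt (show j < b by omega)]
    · simp [h1, h2]
  · rw [lmN_self, kN_mul_fN]
    by_cases h1 : a = j
    · subst h1
      rw [if_pos rfl, if_neg (by omega), lmN_of_lt (by omega), zero_mul]
    by_cases h2 : a = j + 1
    · subst h2
      rw [if_neg (by omega), if_pos rfl, lmN_of_lt (by omega)]
    · rw [if_neg h1, if_neg h2]
  · obtain ⟨d, rfl⟩ : ∃ d, a = b + d + 1 := ⟨a - b - 1, by omega⟩
    rw [lmN_add, mul_smul_comm, ← mul_assoc (fN q n j), fN_mul_kN, smul_mul_assoc, smul_mul_assoc,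
      mul_assoc, mul_assoc, smul_comm (qpow q (-_)), smul_smul (qpow q (-_)),
      mul_comm (qpow q (-_)), qpow_mul_neg, one_smul]
    rw [← sub_eq_iff_eq_add', add_sub_right_comm, ← smul_sub, ← mul_sub, ← mul_smul_comm]
    by_cases h1 : b = j
    · subst h1
      cases d with
      | zero =>
        rw [add_zero, if_pos rfl, if_pos rfl, eR_zero, eN_mul_fN_self hj, mul_sub, lmN_self,
          lmN_self, kN_mul_kN_mul_kiN, sub_add_cancel]
      | succ d =>
        rw [if_pos rfl, if_neg (by omega), eR_mul_fN_left hj,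
          show b + (d + 1) + 1 = b + 1 + d + 1 by omega, lmN_add, mul_neg, mul_smul_comm,
          smul_mul_assoc, mul_assoc, neg_add_cancel]
    by_cases h2 : b + d = j
    · subst h2
      obtain ⟨d, rfl⟩ : ∃ d', d = d' + 1 := ⟨d - 1, by omega⟩
      rw [if_neg h1, if_pos rfl, add_zero, ← add_assoc b d 1, eR_mul_fN_right hj, lmN_add,
        mul_smul_comm, ← mul_assoc, kN_mul_kN_mul_kiN]
    · rw [if_neg h1, if_neg (by omega), (fN_commute_eR hq hj (by omega)).eq]
      simp

/-- An entry of the relation `ℛ₂₁ Δ^op(e_j) = Δ(e_j) ℛ₂₁` in the natural representation. -/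
theorem lpN_mul_eN (hq : (q : ℂ) - (q : ℂ)⁻¹ ≠ 0) (a b : ℕ) {j : ℕ} (hj : j + 1 < n) :
    lpN q n a b * eN q n j +
        (if b = j + 1 then lpN q n a j * (kN q n j * kiN q n (j + 1)) else 0) =
      qpow q (epsR a j (j + 1)) • (eN q n j * lpN q n a b) +
        (if a = j then lpN q n (j + 1) b else 0) := by
  rcases lt_trichotomy b a with h | rfl | h
  · rw [lpN_of_lt h]
    by_cases h1 : b = j + 1 <;> by_cases h2 : a = j
    · omega
    · simp [h1, h2, lpN_of_lt (show j < a by omega)]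
    · simp [h1, h2, lpN_of_lt (show b < j + 1 by omega)]
    · simp [h1, h2]
  · rw [lpN_self, kN_mul_eN]
    by_cases h1 : b = j
    · subst h1
      rw [if_pos rfl, if_neg (by omega), lpN_of_lt (by omega)]
    by_cases h2 : b = j + 1
    · subst h2
      rw [if_pos rfl, if_neg (by omega), lpN_of_lt (by omega), zero_mul]
    · rw [if_neg h1, if_neg h2]
  · obtain ⟨d, rfl⟩ : ∃ d, b = a + d + 1 := ⟨b - a - 1, by omega⟩
    rw [lpN_add, mul_smul_comm, ← mul_assoc (eN q n j), eN_mul_kN, smul_mul_assoc, smul_mul_assoc,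
      mul_assoc, mul_assoc, smul_comm (qpow q _), smul_smul (qpow q _), qpow_mul_neg, one_smul]
    rw [← sub_eq_iff_eq_add', add_comm, add_sub_assoc, ← smul_sub, ← mul_sub, ← mul_smul_comm,
      ← neg_sub (eN q n j * _), smul_neg, mul_neg, ← sub_eq_add_neg, sub_eq_iff_eq_add]
    by_cases h1 : a = j
    · subst h1
      cases d with
      | zero =>
        rw [add_zero, if_pos rfl, if_pos rfl, fR_zero, eN_mul_fN_self hj, mul_sub, lpN_self,
          lpN_self, kiN_comm_kN, kN_mul_kN_mul_kiN]
        abel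
      | succ d =>
        rw [if_pos rfl, if_neg (by omega), eN_mul_fR_left hj,
          show a + (d + 1) + 1 = a + 1 + d + 1 by omega, lpN_add, mul_neg, mul_smul_comm,
          ← mul_assoc, kN_mul_kN_mul_kiN, add_neg_cancel]
    by_cases h2 : a + d = j
    · subst h2
      obtain ⟨d, rfl⟩ : ∃ d', d = d' + 1 := ⟨d - 1, by omega⟩
      rw [if_neg h1, if_pos rfl, zero_add, ← add_assoc a d 1, eN_mul_fR_right hj, lpN_add,
        mul_smul_comm, smul_mul_assoc, ← kiN_comm_kN, mul_assoc]
    · rw [if_neg h1, if_neg (by omega), (eN_commute_fR hq hj (by omega)).eq]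
      simp

/-- An entry of the relation `ℛ₂₁ Δ^op(f_j) = Δ(f_j) ℛ₂₁` in the natural representation. -/
theorem lpN_mul_fN (hq : (q : ℂ) + (q : ℂ)⁻¹ ≠ 0) (a b j : ℕ) :
    qpow q (-epsR b j (j + 1)) • (lpN q n a b * fN q n j) +
        (if b = j then lpN q n a (j + 1) else 0) =
      fN q n j * lpN q n a b +
        (if a = j + 1 then kiN q n j * kN q n (j + 1) * lpN q n j b else 0) := by
  have hq0 : (q : ℂ) ≠ 0 := q.ne_zero
  rcases lt_trichotomy b a with h | rfl | h
  · rw [lpN_of_lt h]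
    by_cases h1 : a = j + 1 <;> by_cases h2 : b = j
    · subst h1 h2; simp [lpN_self, kiN_mul_kN_mul_kN]
    · simp [h1, h2, lpN_of_lt (show b < j by omega)]
    · simp [h1, h2, lpN_of_lt (show j + 1 < a by omega)]
    · simp [h1, h2]
  · rw [lpN_self, fN_mul_kN]
    by_cases h1 : b = j + 1
    · subst h1
      have := lpN_add (q := q) (n := n) j 0
      rw [add_zero, fR_zero] at this
      rw [if_pos rfl, if_neg (by omega), this, epsR_right rfl (by omega), qpow_neg_one, neg_neg,
        qpow_one, mul_smul_comm, ← mul_assoc, kiN_mul_kN_mul_kN]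
      match_scalars; ring
    by_cases h2 : b = j
    · subst h2
      have := lpN_add (q := q) (n := n) b 0
      rw [add_zero, fR_zero] at this
      rw [if_pos rfl, if_neg (by omega), this, epsR_left rfl (by omega), qpow_neg_one,
        qpow_one]
      match_scalars; ring
    · rw [if_neg h1, if_neg h2, epsR_of_ne h2 h1, neg_zero]
  · obtain ⟨d, rfl⟩ : ∃ d, b = a + d + 1 := ⟨b - a - 1, by omega⟩
    rw [lpN_add, mul_smul_comm, ← mul_assoc (fN q n j), fN_mul_kN, smul_mul_assoc, smul_mul_assoc,
      mul_assoc, mul_assoc]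
    by_cases h1 : a = j + 1
    · subst h1
      rw [if_pos rfl, if_neg (by omega), epsR_right rfl (by omega),
        epsR_of_ne (by omega) (by omega), show j + 1 + d + 1 = j + (d + 1) + 1 by omega, lpN_add,
        fR_succ, qpow_neg_one, neg_zero, qpow_zero, mul_smul_comm, ← mul_assoc (_ * _) (kN q n _),
        kiN_mul_kN_mul_kN, mul_sub, mul_smul_comm]
      match_scalars <;> ring
    by_cases h2 : a + d + 1 = j
    · subst h2
      have := lpN_add (q := q) (n := n) a (d + 1)
      rw [← add_assoc] at this
      rw [if_neg h1, if_pos rfl, this, epsR_left rfl (by omega),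
        epsR_of_ne (by omega) (by omega), fR_succ', qpow_neg_one, qpow_zero, 
        mul_sub, mul_smul_comm]
      match_scalars <;> ring
    rw [if_neg h1, if_neg h2, add_zero, add_zero]
    by_cases h3 : a = j
    · subst h3
      rw [epsR_left rfl (by omega)]
      cases d with
      | zero =>
        rw [epsR_right (by omega) (by omega), neg_neg, fR_zero, smul_comm]
      | succ d =>
        rw [epsR_of_ne (by omega) (by omega), fR_mul_fN, neg_zero, qpow_zero, one_smul, qpow_one,
          mul_smul_comm, smul_comm]
    by_cases h4 : a + d = j
    · subst h4
      obtain ⟨d, rfl⟩ : ∃ d', d = d' + 1 := ⟨d - 1, by omega⟩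
      rw [epsR_right (by omega) (by omega), epsR_of_ne (by omega) (by omega), neg_neg, qpow_zero,
        one_smul, qpow_one, ← add_assoc, fN_mul_fR, mul_smul_comm, smul_comm]
    · rw [epsR_of_ne (by omega) (by omega), epsR_of_ne (by omega) (by omega), neg_zero, qpow_zero,
        one_smul, one_smul, (fN_commute_fR hq (by omega)).eq]

theorem kN_mul_lmN (i a b : ℕ) : kN q n i * lmN q n a b =
    qpow q (epsR i b a) • (lmN q n a b * kN q n i) := by
  rcases lt_trichotomy a b with h | rfl | h
  · simp [lmN_of_lt h]
  · rw [lmN_self, kN_comm, epsR, sub_self, qpow_zero, one_smul]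
  · obtain ⟨d, rfl⟩ : ∃ d, a = b + d + 1 := ⟨a - b - 1, by omega⟩
    rw [lmN_add, mul_smul_comm, ← mul_assoc, kN_comm, mul_assoc, kN_mul_eR, mul_smul_comm,
      smul_comm, ← mul_assoc, smul_mul_assoc]

theorem lpN_mul_kN (i a b : ℕ) : lpN q n a b * kN q n i =
    qpow q (epsR i a b) • (kN q n i * lpN q n a b) := by
  rcases lt_trichotomy b a with h | rfl | h
  · simp [lpN_of_lt h]
  · rw [lpN_self, kN_comm, epsR, sub_self, qpow_zero, one_smul]
  · obtain ⟨d, rfl⟩ : ∃ d, b = a + d + 1 := ⟨b - a - 1, by omega⟩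
    rw [lpN_add, smul_mul_assoc, mul_assoc, fR_mul_kN, mul_smul_comm, ← mul_assoc, kN_comm,
      smul_comm, mul_smul_comm, mul_assoc]

end LMatrices

/-! ### The invariance of `𝒬` -/

/-- Induction over the generation of `U_q(gl_n)` by `q^{±h_{ε_i}}`, `e_j` and `f_j`. -/
theorem Uq.induction {q : ℂˣ} {n : ℕ} {p : Uq q n → Prop}
    (h0 : ∀ r : ℂ, p (algebraMap ℂ (Uq q n) r)) (hk : ∀ i, p (Uq.k q i))
    (hki : ∀ i, p (Uq.kinv q i)) (he : ∀ j, p (Uq.e q j)) (hf : ∀ j, p (Uq.f q j))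
    (hmul : ∀ x y, p x → p y → p (x * y)) (hadd : ∀ x y, p x → p y → p (x + y)) (x : Uq q n) :
    p x := by
  obtain ⟨a, rfl⟩ : ∃ a, Uq.mk q a = x := RingQuot.mkAlgHom_surjective ℂ (Rel q n) x
  induction a using FreeAlgebra.induction with
  | grade0 r => rw [AlgHom.commutes]; exact h0 r
  | grade1 g =>
    cases g with
    | k i => exact hk i
    | kinv i => exact hki i
    | e j => exact he j
    | f j => exact hf j
  | mul a b ha hb => rw [map_mul]; exact hmul _ _ ha hb
  | add a b ha hb => rw [map_add]; exact hadd _ _ ha hb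

section Action

variable {q : ℂˣ} {n : ℕ} {M : Type*} [AddCommGroup M] [Module ℂ M]

/-- Linear maps from `ℂ^n ⊗ M` are determined by their values on the vectors `w_i ⊗ y`. -/
theorem NatTensor.linearMap_ext {N : Type*} [AddCommGroup N] [Module ℂ N]
    {f g : NatTensor q n M →ₗ[ℂ] N} (h : ∀ i y, f (wTensor q n i y) = g (wTensor q n i y)) :
    f = g :=
  TensorProduct.ext (LinearMap.pi_ext' fun i => LinearMap.ext_ring (LinearMap.ext fun y => h i y))

variable (q M) in
/-- The bilinear map `(w, y) ↦ w ⊗ y` into `ℂ^n ⊗ M`. -/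
def tens : (Fin n → ℂ) →ₗ[ℂ] M →ₗ[ℂ] NatTensor q n M := TensorProduct.mk ℂ (Fin n → ℂ) M

theorem wTensor_eq (i : Fin n) (y : M) : wTensor q n i y = tens q M (Pi.single i 1) y := rfl

/-- The map `y ↦ w_i ⊗ y`, extended by `0` to all `i : ℕ`. -/
def wN (q : ℂˣ) (n : ℕ) (i : ℕ) : M →ₗ[ℂ] NatTensor q n M :=
  if h : i < n then tens q M (Pi.single ⟨i, h⟩ 1) else 0

theorem wN_of_le {i : ℕ} (h : n ≤ i) (y : M) : wN q n i y = 0 := by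
  rw [wN, dif_neg (by omega), LinearMap.zero_apply]

theorem wN_val (i : Fin n) (y : M) : wN q n i y = wTensor q n i y := by
  rw [wN, dif_pos i.2]; rfl

theorem wN_of_lt {i : ℕ} (h : i < n) (y : M) : wN q n i y = wTensor q n ⟨i, h⟩ y :=
  wN_val ⟨i, h⟩ y

theorem wN_smul (c : ℂ) (i : ℕ) (y : M) : wN q n i (c • y) = c • wN q n i y := map_smul _ _ _

variable [Module (Uq q n) M] [IsScalarTower ℂ (Uq q n) M]

theorem comul_mk (g : Gen n) : Uq.comul q n (Uq.mk q (gen g)) = comulGen q n g := by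
  rw [Uq.comul, Uq.lift_mk, FreeAlgebra.lift_ι_apply]

theorem natRep_mk (g : Gen n) : natRep q n (Uq.mk q (gen g)) = natGen q n g := by
  rw [natRep, Uq.lift_mk, FreeAlgebra.lift_ι_apply]

/-- The action of `a ⊗ b` on `ℂ^n ⊗ M`. -/
def tensorAct : Uq q n ⊗[ℂ] Uq q n →ₐ[ℂ] Module.End ℂ (NatTensor q n M) :=
  (Module.endTensorEndAlgHom (R := ℂ) (S := ℂ) (A := ℂ) (M := Fin n → ℂ) (N := M)).comp
    (Algebra.TensorProduct.map
      ((Matrix.toLinAlgEquiv' : Matrix (Fin n) (Fin n) ℂ ≃ₐ[ℂ] _).toAlgHom.comp (natRep q n))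
      (Algebra.lsmul ℂ ℂ M))

theorem tensorAct_apply (a b : Uq q n) (w : Fin n → ℂ) (y : M) :
    tensorAct (a ⊗ₜ b) (tens q M w y) = tens q M ((natRep q n a).mulVec w) (b • y) := rfl

theorem smul_eq_tensorAct (x : Uq q n) (u : NatTensor q n M) :
    x • u = tensorAct (Uq.comul q n x) u := rfl

theorem single_mulVec_single (i j a : Fin n) :
    (Matrix.single i j (1 : ℂ)).mulVec (Pi.single a 1) = if a = j then Pi.single i 1 else 0 := by
  rw [Matrix.mulVec_single_one]
  funext b
  split_ifs with h
  · subst h; simp [Matrix.single_apply, Pi.single_apply, eq_comm]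
  · simp [Ne.symm h]

theorem diagonal_mulVec_single_one (d : Fin n → ℂ) (a : Fin n) :
    (Matrix.diagonal d).mulVec (Pi.single a 1) = d a • Pi.single a 1 := by
  rw [Matrix.diagonal_mulVec_single, ← smul_eq_mul, Pi.single_smul]

theorem k_smul_wTensor (i a : Fin n) (y : M) : Uq.k q i • wTensor q n a y =
    (if a = i then (q : ℂ) else 1) • wTensor q n a (Uq.k q i • y) := by
  rw [smul_eq_tensorAct, Uq.k, comul_mk, comulGen, wTensor_eq, tensorAct_apply, Uq.k, natRep_mk,
    natGen, diagonal_mulVec_single_one, LinearMap.map_smul₂]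
  rfl

theorem kinv_smul_wTensor (i a : Fin n) (y : M) : Uq.kinv q i • wTensor q n a y =
    (if a = i then (q : ℂ)⁻¹ else 1) • wTensor q n a (Uq.kinv q i • y) := by
  rw [smul_eq_tensorAct, Uq.kinv, comul_mk, comulGen, wTensor_eq, tensorAct_apply, Uq.kinv,
    natRep_mk, natGen, diagonal_mulVec_single_one, LinearMap.map_smul₂]
  rfl

theorem natRep_kRoot (j : Fin (n - 1)) : natRep q n (Uq.kRoot q j) =
    Matrix.diagonal fun a => qpow q (epsRoot a j) := by
  have h : lo j ≠ hi j := by simp [lo, hi]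
  rw [Uq.kRoot, map_mul, Uq.k, Uq.kinv, natRep_mk, natRep_mk, natGen, natGen,
    Matrix.diagonal_mul_diagonal]
  congr 1; funext a
  by_cases h1 : a = lo j
  · subst h1; simp [epsRoot, h, qpow_one]
  · by_cases h2 : a = hi j
    · subst h2; simp [epsRoot, h.symm, qpow_neg_one]
    · simp [epsRoot, h1, h2, qpow_zero]

theorem e_smul_wTensor (j : Fin (n - 1)) (a : Fin n) (y : M) : Uq.e q j • wTensor q n a y =
    (if a = hi j then wTensor q n (lo j) y else 0) +
      qpow q (epsRoot a j) • wTensor q n a (Uq.e q j • y) := by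
  rw [smul_eq_tensorAct, Uq.e, comul_mk, comulGen, map_add, wTensor_eq, LinearMap.add_apply,
    tensorAct_apply, tensorAct_apply, Uq.e, natRep_mk, natGen, natRep_kRoot,
    diagonal_mulVec_single_one, one_smul, LinearMap.map_smul₂, single_mulVec_single]
  split_ifs
  · rfl
  · rw [map_zero, LinearMap.zero_apply]; rfl

theorem f_smul_wTensor (j : Fin (n - 1)) (a : Fin n) (y : M) : Uq.f q j • wTensor q n a y =
    wTensor q n a (Uq.f q j • y) +
      (if a = lo j then wTensor q n (hi j) (Uq.kRootInv q j • y) else 0) := by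
  rw [smul_eq_tensorAct, Uq.f, comul_mk, comulGen, map_add, wTensor_eq, LinearMap.add_apply,
    tensorAct_apply, tensorAct_apply, Uq.f, natRep_mk, natGen, map_one,
    Matrix.one_mulVec, single_mulVec_single]
  split_ifs
  · rfl
  · rw [map_zero, LinearMap.zero_apply]; rfl

theorem kN_smul_wN (i a : ℕ) (y : M) : kN q n i • wN q n a y =
    (if a = i then (q : ℂ) else 1) • wN q n a (kN q n i • y) := by
  by_cases ha : a < n
  · by_cases hi : i < n
    · rw [kN_of_lt hi, wN_of_lt ha, k_smul_wTensor, wN_of_lt ha]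
      simp [Fin.ext_iff]
    · rw [kN, dif_neg hi, if_neg (by omega), one_smul, one_smul, one_smul]
  · rw [wN_of_le (by omega), wN_of_le (by omega), smul_zero, smul_zero]

theorem kiN_smul_wN (i a : ℕ) (y : M) : kiN q n i • wN q n a y =
    (if a = i then (q : ℂ)⁻¹ else 1) • wN q n a (kiN q n i • y) := by
  by_cases ha : a < n
  · by_cases hi : i < n
    · rw [kiN_of_lt hi, wN_of_lt ha, kinv_smul_wTensor, wN_of_lt ha]
      simp [Fin.ext_iff]
    · rw [kiN, dif_neg hi, if_neg (by omega), one_smul, one_smul, one_smul]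
  · rw [wN_of_le (by omega), wN_of_le (by omega), smul_zero, smul_zero]

theorem eN_smul_wN {j a : ℕ} (ha : a < n) (y : M) : eN q n j • wN q n a y =
    (if a = j + 1 then wN q n j y else 0) +
      qpow q (epsR a j (j + 1)) • wN q n a (eN q n j • y) := by
  by_cases hj : j < n - 1
  · rw [eN_of_lt hj, wN_of_lt ha, e_smul_wTensor, wN_of_lt ha, wN_of_lt (by omega), epsRoot_mk]
    simp [Fin.ext_iff, hi, lo]
  · rw [eN_of_le (by omega), if_neg (by omega)]; simp

theorem fN_smul_wN (j a : ℕ) (y : M) : fN q n j • wN q n a y = wN q n a (fN q n j • y) +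
      (if a = j then wN q n (j + 1) (kiN q n j • kN q n (j + 1) • y) else 0) := by
  by_cases hj : j < n - 1
  · by_cases ha : a < n
    · rw [fN_of_lt hj, wN_of_lt ha, f_smul_wTensor, wN_of_lt ha, wN_of_lt (by omega),
        kiN_of_lt (by omega), kN_of_lt (by omega), smul_smul]
      simp [Fin.ext_iff, hi, lo, Uq.kRootInv]
    · rw [wN_of_le (by omega), wN_of_le (by omega), if_neg (by omega), smul_zero, add_zero]
  · rw [fN_of_le (by omega), wN_of_le (show n ≤ j + 1 by omega)]; simp

/-- The action of the element `∑ e_{ij} ⊗ X_{ij}` on `ℂ^n ⊗ M`. -/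
def matAct (M : Type*) [AddCommGroup M] [Module ℂ M] [Module (Uq q n) M]
    [IsScalarTower ℂ (Uq q n) M] (X : Matrix (Fin n) (Fin n) (Uq q n)) :
    Module.End ℂ (NatTensor q n M) :=
  ∑ i : Fin n, ∑ j : Fin n,
    (TensorProduct.map (Matrix.toLin' (Matrix.single i j (1 : ℂ)))
      (Algebra.lsmul ℂ ℂ M (X i j)) :
      (Fin n → ℂ) ⊗[ℂ] M →ₗ[ℂ] (Fin n → ℂ) ⊗[ℂ] M)

theorem matAct_wTensor (X : Matrix (Fin n) (Fin n) (Uq q n)) (b : Fin n) (y : M) :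
    matAct M X (wTensor q n b y) = ∑ a : Fin n, wTensor q n a (X a b • y) := by
  have h : ∀ i j : Fin n, tens q M ((Matrix.single i j (1 : ℂ)).mulVec (Pi.single b 1))
      (X i j • y) = if b = j then wTensor q n i (X i j • y) else 0 := by
    intro i j
    rw [single_mulVec_single]
    split_ifs
    · rfl
    · rw [map_zero, LinearMap.zero_apply]
  have h' : matAct M X (wTensor q n b y) = ∑ i : Fin n, ∑ j : Fin n,
      tens q M ((Matrix.single i j (1 : ℂ)).mulVec (Pi.single b 1)) (X i j • y) := by
    have key := fun (F : Fin n → Module.End ℂ ((Fin n → ℂ) ⊗[ℂ] M)) v =>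
      LinearMap.sum_apply Finset.univ F v
    exact (key _ _).trans (Finset.sum_congr rfl fun i _ => key _ _)
  rw [h']
  simp only [h, Finset.sum_ite_eq, Finset.mem_univ, if_true]

theorem matAct_mul (X Y : Matrix (Fin n) (Fin n) (Uq q n)) :
    matAct M (X * Y) = matAct M X * matAct M Y := by
  suffices h : (matAct M (X * Y) : NatTensor q n M →ₗ[ℂ] NatTensor q n M) =
    matAct M X ∘ₗ matAct M Y from h
  refine NatTensor.linearMap_ext fun b y => ?_
  rw [LinearMap.comp_apply]
  rw [matAct_wTensor, matAct_wTensor, map_sum]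
  simp only [matAct_wTensor]
  rw [Finset.sum_comm]
  refine Finset.sum_congr rfl fun a _ => ?_
  rw [Matrix.mul_apply, Finset.sum_smul]
  simp only [← wN_val, map_sum, mul_smul]

theorem qOperator_eq : qOperator q n M = matAct M (lPlus q) * matAct M (lMinus q) := by
  rw [← matAct_mul]; rfl

/-- A matrix of the form `∑ e_{ii} ⊗ d_i x + e_{ab} ⊗ z`, such as the matrices of the elements
`(π ⊗ id)(Δ(e_j))` and `(π ⊗ id)(Δ(f_j))`. -/
def coMat (d : ℕ → ℂ) (x : Uq q n) (a b : ℕ) (z : Uq q n) : Matrix (Fin n) (Fin n) (Uq q n) :=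
  fun i l => (if i = l then d i • x else 0) + if (i : ℕ) = a ∧ (l : ℕ) = b then z else 0

theorem mul_coMat {X : ℕ → ℕ → Uq q n} {d : ℕ → ℂ} {x z : Uq q n} {a b : ℕ} (ha : a < n)
    (i l : Fin n) : ((Matrix.of fun i l : Fin n => X i l) * coMat d x a b z) i l =
      d l • (X i l * x) + if (l : ℕ) = b then X i a * z else 0 := by
  simp only [Matrix.mul_apply, coMat, Matrix.of_apply, mul_add, Finset.sum_add_distrib]
  congr 1
  · simp
  · rw [Finset.sum_eq_single ⟨a, ha⟩]
    · simp
    · intro c _ hc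
      rw [if_neg (fun h => hc (Fin.ext h.1)), mul_zero]
    · simp

theorem coMat_mul {X : ℕ → ℕ → Uq q n} {d : ℕ → ℂ} {x z : Uq q n} {a b : ℕ} (hb : b < n)
    (i l : Fin n) : (coMat d x a b z * (Matrix.of fun i l : Fin n => X i l)) i l =
      d i • (x * X i l) + if (i : ℕ) = a then z * X b l else 0 := by
  simp only [Matrix.mul_apply, coMat, Matrix.of_apply, add_mul, Finset.sum_add_distrib]
  congr 1
  · simp
  · rw [Finset.sum_eq_single ⟨b, hb⟩]
    · simp
    · intro c _ hc
      rw [if_neg (fun h => hc (Fin.ext h.2)), zero_mul]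
    · simp

theorem lMinus_eq_of : lMinus q = Matrix.of fun i l : Fin n => lmN q n i l :=
  Matrix.ext lMinus_eq

theorem lPlus_eq_of : lPlus q = Matrix.of fun i l : Fin n => lpN q n i l :=
  Matrix.ext lPlus_eq

theorem matAct_coMat_wTensor {d : ℕ → ℂ} {x z : Uq q n} {a b : ℕ} (ha : a < n) (i : Fin n)
    (y : M) : matAct M (coMat d x a b z) (wTensor q n i y) =
      d i • wN q n i (x • y) + if (i : ℕ) = b then wN q n a (z • y) else 0 := by
  rw [matAct_wTensor]
  simp only [coMat, add_smul, ← wN_val, map_add, Finset.sum_add_distrib]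
  congr 1
  · simp only [ite_smul, zero_smul, apply_ite (wN q n _), map_zero, smul_assoc, wN_smul]
    rw [Finset.sum_eq_single i]
    · simp
    · intro c _ hc; rw [if_neg hc]
    · simp
  · rw [Finset.sum_eq_single ⟨a, ha⟩]
    · split_ifs <;> simp_all
    · intro c _ hc
      rw [if_neg (fun h => hc (Fin.ext h.1)), zero_smul, map_zero]
    · simp

theorem eN_smul_eq_matAct {j : ℕ} (hj : j + 1 < n) (u : NatTensor q n M) : eN q n j • u =
    matAct M (coMat (fun a => qpow q (epsR a j (j + 1))) (eN q n j) j (j + 1) 1) u := by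
  have : (Module.toModuleEnd ℂ (S := Uq q n) (NatTensor q n M) (eN q n j) :
      Module.End ℂ (NatTensor q n M)) =
      matAct M (coMat (fun a => qpow q (epsR a j (j + 1))) (eN q n j) j (j + 1) 1) := by
    refine NatTensor.linearMap_ext fun i y => ?_
    rw [matAct_coMat_wTensor (by omega), ← wN_val, one_smul, add_comm]
    exact eN_smul_wN i.2 y
  exact LinearMap.congr_fun this u

theorem fN_smul_eq_matAct {j : ℕ} (hj : j + 1 < n) (u : NatTensor q n M) : fN q n j • u =
    matAct M (coMat (fun _ => 1) (fN q n j) (j + 1) j (kiN q n j * kN q n (j + 1))) u := by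
  have : (Module.toModuleEnd ℂ (S := Uq q n) (NatTensor q n M) (fN q n j) :
      Module.End ℂ (NatTensor q n M)) =
      matAct M (coMat (fun _ => 1) (fN q n j) (j + 1) j (kiN q n j * kN q n (j + 1))) := by
    refine NatTensor.linearMap_ext fun i y => ?_
    rw [matAct_coMat_wTensor (by omega), ← wN_val, one_smul, mul_smul]
    exact fN_smul_wN j i y
  exact LinearMap.congr_fun this u

/-- The operator `𝒬` commutes with `e_j`: moving it past `ℛ` turns `Δ` into `Δ^op`, and moving it
past `ℛ₂₁` turns `Δ^op` back into `Δ`. -/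
theorem qOperator_eN_smul (hq : (q : ℂ) + (q : ℂ)⁻¹ ≠ 0) (hq' : (q : ℂ) - (q : ℂ)⁻¹ ≠ 0)
    {j : ℕ} (hj : j + 1 < n) (u : NatTensor q n M) :
    qOperator q n M (eN q n j • u) = eN q n j • qOperator q n M u := by
  have h1 : lMinus q * coMat (fun a => qpow q (epsR a j (j + 1))) (eN q n j) j (j + 1) 1 =
      coMat (fun _ => 1) (eN q n j) j (j + 1) (kN q n j * kiN q n (j + 1)) * lMinus q := by
    ext a b
    rw [lMinus_eq_of, mul_coMat (by omega), coMat_mul (by omega), mul_one, one_smul]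
    exact lmN_mul_eN hq a b j
  have h2 : lPlus q * coMat (fun _ => 1) (eN q n j) j (j + 1) (kN q n j * kiN q n (j + 1)) =
      coMat (fun a => qpow q (epsR a j (j + 1))) (eN q n j) j (j + 1) 1 * lPlus q := by
    ext a b
    rw [lPlus_eq_of, mul_coMat (by omega), coMat_mul (by omega), one_mul, one_smul]
    exact lpN_mul_eN hq' a b hj
  rw [eN_smul_eq_matAct hj, eN_smul_eq_matAct hj, qOperator_eq, ← Module.End.mul_apply,
    ← Module.End.mul_apply, ← matAct_mul, ← matAct_mul, ← matAct_mul, Matrix.mul_assoc, h1,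
    ← Matrix.mul_assoc, h2, Matrix.mul_assoc]

theorem qOperator_fN_smul (hq : (q : ℂ) + (q : ℂ)⁻¹ ≠ 0) (hq' : (q : ℂ) - (q : ℂ)⁻¹ ≠ 0)
    {j : ℕ} (hj : j + 1 < n) (u : NatTensor q n M) :
    qOperator q n M (fN q n j • u) = fN q n j • qOperator q n M u := by
  have h1 : lMinus q * coMat (fun _ => 1) (fN q n j) (j + 1) j (kiN q n j * kN q n (j + 1)) =
      coMat (fun a => qpow q (-epsR a j (j + 1))) (fN q n j) (j + 1) j 1 * lMinus q := by
    ext a b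
    rw [lMinus_eq_of, mul_coMat (by omega), coMat_mul (by omega), one_mul, one_smul]
    exact lmN_mul_fN hq' a b hj
  have h2 : lPlus q * coMat (fun a => qpow q (-epsR a j (j + 1))) (fN q n j) (j + 1) j 1 =
      coMat (fun _ => 1) (fN q n j) (j + 1) j (kiN q n j * kN q n (j + 1)) * lPlus q := by
    ext a b
    rw [lPlus_eq_of, mul_coMat (by omega), coMat_mul (by omega), mul_one, one_smul]
    exact lpN_mul_fN hq a b j
  rw [fN_smul_eq_matAct hj, fN_smul_eq_matAct hj, qOperator_eq, ← Module.End.mul_apply,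
    ← Module.End.mul_apply, ← matAct_mul, ← matAct_mul, ← matAct_mul, Matrix.mul_assoc, h1,
    ← Matrix.mul_assoc, h2, Matrix.mul_assoc]

theorem qOperator_kN_smul (i : ℕ) (u : NatTensor q n M) :
    qOperator q n M (kN q n i • u) = kN q n i • qOperator q n M u := by
  have h : ∀ (a : ℕ) (y : M), kN q n i • wN q n a y =
      qpow q (if a = i then 1 else 0) • wN q n a (kN q n i • y) := by
    intro a y; rw [kN_smul_wN]; split_ifs <;> simp [qpow]
  have h1 : (matAct M (lMinus q) : NatTensor q n M →ₗ[ℂ] NatTensor q n M) ∘ₗ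
      (Module.toModuleEnd ℂ (S := Uq q n) (NatTensor q n M) (kN q n i)) =
      (Module.toModuleEnd ℂ (S := Uq q n) (NatTensor q n M) (kN q n i)) ∘ₗ
        matAct M (lMinus q) := by
    refine NatTensor.linearMap_ext fun b y => ?_
    change matAct M (lMinus q) (kN q n i • wTensor q n b y) =
      kN q n i • matAct M (lMinus q) (wTensor q n b y)
    rw [← wN_val, h, map_smul, wN_val, wN_val, matAct_wTensor, matAct_wTensor, Finset.smul_sum,
      Finset.smul_sum]
    refine Finset.sum_congr rfl fun a _ => ?_
    rw [← wN_val, ← wN_val, h, ← mul_smul, ← mul_smul, lMinus_eq, kN_mul_lmN, smul_assoc,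
      wN_smul, smul_smul, ← qpow_add]
    congr 2
    simp only [epsR]; split_ifs <;> omega
  have h2 : (matAct M (lPlus q) : NatTensor q n M →ₗ[ℂ] NatTensor q n M) ∘ₗ
      (Module.toModuleEnd ℂ (S := Uq q n) (NatTensor q n M) (kN q n i)) =
      (Module.toModuleEnd ℂ (S := Uq q n) (NatTensor q n M) (kN q n i)) ∘ₗ
        matAct M (lPlus q) := by
    refine NatTensor.linearMap_ext fun b y => ?_
    change matAct M (lPlus q) (kN q n i • wTensor q n b y) =
      kN q n i • matAct M (lPlus q) (wTensor q n b y)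
    rw [← wN_val, h, map_smul, wN_val, wN_val, matAct_wTensor, matAct_wTensor, Finset.smul_sum,
      Finset.smul_sum]
    refine Finset.sum_congr rfl fun a _ => ?_
    rw [← wN_val, ← wN_val, h, ← mul_smul, ← mul_smul, lPlus_eq, lpN_mul_kN, smul_assoc,
      wN_smul, smul_smul, ← qpow_add]
    congr 2
    simp only [epsR]; split_ifs <;> omega
  rw [qOperator_eq, Module.End.mul_apply, Module.End.mul_apply]
  exact (congrArg _ (LinearMap.congr_fun h1 u)).trans (LinearMap.congr_fun h2 _)

/-- The operator `𝒬` is an endomorphism of the `U_q(gl_n)`-module `ℂ^n ⊗ M`. -/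
theorem qOperator_smul (hq : (q : ℂ) + (q : ℂ)⁻¹ ≠ 0) (hq' : (q : ℂ) - (q : ℂ)⁻¹ ≠ 0)
    (x : Uq q n) (u : NatTensor q n M) :
    qOperator q n M (x • u) = x • qOperator q n M u := by
  induction x using Uq.induction generalizing u with
  | h0 r => rw [algebraMap_smul, algebraMap_smul, map_smul]
  | hk i => rw [← kN_val, qOperator_kN_smul]
  | hki i =>
    have h := qOperator_kN_smul (i : ℕ) (kiN q n i • u)
    rw [← mul_smul, kN_mul_kiN, one_smul] at h
    rw [← kiN_val, h, ← mul_smul, kiN_mul_kN, one_smul]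
  | he j => rw [← eN_val, qOperator_eN_smul hq hq' (by omega)]
  | hf j => rw [← fN_val, qOperator_fN_smul hq hq' (by omega)]
  | hmul x y hx hy => rw [mul_smul, hx, hy, mul_smul]
  | hadd x y hx hy => rw [add_smul, map_add, hx, hy, add_smul]

end Action

/-! ### Weight vectors and the standard filtration -/

section Flag

variable {q : ℂˣ} {n : ℕ} {M : Type*} [AddCommGroup M] [Module ℂ M]
  [Module (Uq q n) M] [IsScalarTower ℂ (Uq q n) M]

theorem smul_smul_comm' (x : Uq q n) (c : ℂ) (y : M) : x • c • y = c • x • y := by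
  rw [← algebraMap_smul (Uq q n) c y, ← mul_smul, ← Algebra.commutes, mul_smul, algebraMap_smul]

variable (q n) in
/-- The vector `y` has weight `ζ`, given by the eigenvalues `ζ i` of `q^{h_{ε_i}}`. -/
def IsWt (ζ : ℕ → ℂˣ) (y : M) : Prop := ∀ i < n, kN q n i • y = (ζ i : ℂ) • y

variable (q n) in
/-- The vector `v` has weight `ζ` and is annihilated by all `e_j`. -/
def IsHW (ζ : ℕ → ℂˣ) (v : M) : Prop := (∀ j, eN q n j • v = 0) ∧ IsWt q n ζ v

theorem IsWt.kiN {ζ : ℕ → ℂˣ} {y : M} (h : IsWt q n ζ y) {i : ℕ} (hi : i < n) :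
    kiN q n i • y = (ζ i : ℂ)⁻¹ • y := by
  have h1 : QuantumGL.kiN q n i • kN q n i • y = y := by rw [← mul_smul, kiN_mul_kN, one_smul]
  rw [h i hi, smul_smul_comm'] at h1
  nth_rw 2 [← h1]
  rw [smul_smul, inv_mul_cancel₀ (ζ i).ne_zero, one_smul]

theorem IsWt.kiN_kN {ζ : ℕ → ℂˣ} {y : M} (h : IsWt q n ζ y) {i j : ℕ} (hi : i < n) (hj : j < n) :
    QuantumGL.kiN q n i • kN q n j • y = ((ζ j : ℂ) / ζ i) • y := by
  rw [h j hj, smul_smul_comm', h.kiN hi, smul_smul, div_eq_mul_inv]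

variable (q) in
/-- The weight `ζ - ε_r + ε_s`. -/
def shiftWt (ζ : ℕ → ℂˣ) (r s i : ℕ) : ℂˣ := ζ i * q ^ (-epsR i r s)

theorem IsWt.smul_of_commute {ζ : ℕ → ℂˣ} {y : M} (h : IsWt q n ζ y) {x : Uq q n} {r s : ℕ}
    (hx : ∀ a, x * kN q n a = qpow q (epsR a r s) • (kN q n a * x)) :
    IsWt q n (shiftWt q ζ r s) (x • y) := by
  intro i hi
  have h1 : kN q n i * x = qpow q (-epsR i r s) • (x * kN q n i) := by
    rw [hx, smul_smul, mul_comm, qpow_mul_neg, one_smul]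
  rw [← mul_smul, h1, smul_assoc, mul_smul, h i hi, smul_smul_comm', smul_smul, mul_comm]
  rfl

theorem IsWt.fN {ζ : ℕ → ℂˣ} {y : M} (h : IsWt q n ζ y) (j : ℕ) :
    IsWt q n (shiftWt q ζ j (j + 1)) (fN q n j • y) :=
  h.smul_of_commute fun a => fN_mul_kN a j

theorem IsWt.fR {ζ : ℕ → ℂˣ} {y : M} (h : IsWt q n ζ y) (d i : ℕ) :
    IsWt q n (shiftWt q ζ i (i + d + 1)) (fR q n d i • y) :=
  h.smul_of_commute fun a => fR_mul_kN a d i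

theorem matAct_lPlus_wN {b : ℕ} (hb : b < n) (y : M) :
    matAct M (lPlus q) (wN q n b y) = ∑ a ∈ Finset.range n, wN q n a (lpN q n a b • y) := by
  rw [wN_of_lt hb, matAct_wTensor,
    ← Fin.sum_univ_eq_sum_range (fun a => wN q n a (lpN q n a b • y))]
  exact Finset.sum_congr rfl fun a _ => by rw [lPlus_eq, wN_val]

theorem matAct_lMinus_wN {b : ℕ} (hb : b < n) (y : M) :
    matAct M (lMinus q) (wN q n b y) = ∑ a ∈ Finset.range n, wN q n a (lmN q n a b • y) := by
  rw [wN_of_lt hb, matAct_wTensor,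
    ← Fin.sum_univ_eq_sum_range (fun a => wN q n a (lmN q n a b • y))]
  exact Finset.sum_congr rfl fun a _ => by rw [lMinus_eq, wN_val]

theorem fN_smul_wN_of_ne {j a : ℕ} (h : a ≠ j) (y : M) :
    fN q n j • wN q n a y = wN q n a (fN q n j • y) := by
  rw [fN_smul_wN, if_neg h, add_zero]

theorem fR_smul_wN_of_lt {d i a : ℕ} (h : a < i) (y : M) :
    fR q n d i • wN q n a y = wN q n a (fR q n d i • y) := by
  induction d generalizing i y with
  | zero => exact fN_smul_wN_of_ne (by omega) y
  | succ d ih =>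
    rw [fR_succ, sub_smul, sub_smul, smul_assoc, smul_assoc, mul_smul, mul_smul, mul_smul,
      mul_smul, fN_smul_wN_of_ne (by omega), ih (by omega), ih (by omega),
      fN_smul_wN_of_ne (by omega), map_sub, wN_smul]

/-- If `w_i ⊗ y` lies in a submodule for all `i < r`, then `w_i ⊗ F y` is proportional to
`w_r ⊗ y` modulo that submodule, where `F` is the root vector of `ε_r - ε_i`. -/
theorem wN_fR_smul_mem {N : Submodule (Uq q n) (NatTensor q n M)} {ζ : ℕ → ℂˣ} {y : M}
    (hy : IsWt q n ζ y) {d i : ℕ} (hr : i + d + 1 < n)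
    (hN : ∀ a < i + d + 1, wN q n a y ∈ N) :
    wN q n i (fR q n d i • y) +
      ((ζ (i + d + 1) : ℂ) / ζ i * (q : ℂ)⁻¹ ^ (2 * d)) • wN q n (i + d + 1) y ∈ N := by
  have hq : (q : ℂ) ≠ 0 := q.ne_zero
  induction d generalizing i with
  | zero =>
    have h1 := N.smul_mem (fN q n i) (hN i (by omega))
    rw [fN_smul_wN, if_pos rfl, hy.kiN_kN (by omega) (by omega), wN_smul] at h1
    simpa [fR_zero] using h1
  | succ d ih =>
    have e : i + (d + 1) + 1 = i + 1 + d + 1 := by omega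
    rw [e] at hr hN ⊢
    have h1 := N.smul_mem (fR q n (d + 1) i) (hN i (by omega))
    have h2 := N.smul_mem (fR q n d (i + 1)) (hN (i + 1) (by omega))
    have h3 := ih hr hN
    have hF := (hy.fR d (i + 1)).kiN_kN (i := i) (j := i + 1) (by omega) (by omega)
    have hF' : ((shiftWt q ζ (i + 1) (i + 1 + d + 1) (i + 1) : ℂˣ) : ℂ) /
        (shiftWt q ζ (i + 1) (i + 1 + d + 1) i : ℂˣ) = (ζ (i + 1) : ℂ) / ζ i * (q : ℂ)⁻¹ := by
      rw [shiftWt, shiftWt, epsR_left rfl (by omega), epsR_of_ne (by omega) (by omega)]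
      simp [div_eq_mul_inv, mul_right_comm]
    rw [hF'] at hF
    have h4 : fR q n (d + 1) i • wN q n i y = wN q n i (fR q n (d + 1) i • y) +
        ((ζ (i + 1) : ℂ) / ζ i) • fR q n d (i + 1) • wN q n (i + 1) y -
        ((ζ (i + 1) : ℂ) / ζ i * (q : ℂ)⁻¹ ^ 2) • wN q n (i + 1) (fR q n d (i + 1) • y) := by
      rw [fR_succ, sub_smul, sub_smul, smul_assoc, smul_assoc, mul_smul, mul_smul, mul_smul,
        mul_smul, fR_smul_wN_of_lt (by omega), fN_smul_wN, fN_smul_wN, if_pos rfl, if_pos rfl, hF,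
        hy.kiN_kN (by omega) (by omega), smul_add, fR_smul_wN_of_lt (by omega), wN_smul, wN_smul,
        smul_smul_comm', map_sub, wN_smul]
      generalize fR q n d (i + 1) • wN q n (i + 1) y = A
      match_scalars <;> ring
    have hm : ∀ (c : ℂ) {u : NatTensor q n M}, u ∈ N → c • u ∈ N :=
      fun c _ hu => N.smul_of_tower_mem c hu
    have h5 := N.add_mem (N.sub_mem h1 (hm ((ζ (i + 1) : ℂ) / ζ i) h2))
      (hm ((ζ (i + 1) : ℂ) / ζ i * (q : ℂ)⁻¹ ^ 2) h3)
    rw [h4] at h5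
    convert h5 using 1
    have := (ζ (i + 1)).ne_zero
    generalize fR q n d (i + 1) • wN q n (i + 1) y = A
    match_scalars
    all_goals first
      | ring1
      | (simp only [inv_pow]; field_simp; ring1)

/-- If `w_a ⊗ y` lies in the submodule `N` for all `a < r`, then `(π ⊗ id)(ℛ₂₁)` acts on `w_r ⊗ y`
modulo `N` by a scalar. -/
theorem matAct_lPlus_wN_sub_mem {N : Submodule (Uq q n) (NatTensor q n M)} {ζ : ℕ → ℂˣ} {y : M}
    (hy : IsWt q n ζ y) {r : ℕ} (hr : r < n) (hN : ∀ a < r, wN q n a y ∈ N) :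
    matAct M (lPlus q) (wN q n r y) - ((ζ r : ℂ) * (q : ℂ)⁻¹ ^ (2 * r)) • wN q n r y ∈ N := by
  have hq : (q : ℂ) ≠ 0 := q.ne_zero
  set s := (q : ℂ) - (q : ℂ)⁻¹ with hs
  have h1 : matAct M (lPlus q) (wN q n r y) = (ζ r : ℂ) • wN q n r y +
      ∑ a ∈ Finset.range r, (s * (ζ a * (q : ℂ)⁻¹)) • wN q n a (fR q n (r - a - 1) a • y) := by
    rw [matAct_lPlus_wN hr, ← Finset.sum_range_add_sum_Ico _ (show r + 1 ≤ n by omega),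
      Finset.sum_range_succ, lpN_self, hy r hr, wN_smul,
      Finset.sum_eq_zero (s := Finset.Ico (r + 1) n), add_zero, add_comm]
    · congr 1
      refine Finset.sum_congr rfl fun a ha => ?_
      have ha := Finset.mem_range.1 ha
      obtain ⟨d, rfl⟩ : ∃ d, r = a + d + 1 := ⟨r - a - 1, by omega⟩
      rw [lpN_add, show a + d + 1 - a - 1 = d by omega, smul_assoc, mul_smul,
        hy.fR d a a (by omega), wN_smul, wN_smul, smul_smul, shiftWt,
        epsR_left rfl (by omega)]
      simp [hs]
    · intro a ha
      rw [lpN_of_lt (by have := Finset.mem_Ico.1 ha; omega), zero_smul, map_zero]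
  have h2 : ∀ a ∈ Finset.range r, (s * (ζ a * (q : ℂ)⁻¹)) •
      (wN q n a (fR q n (r - a - 1) a • y) +
        ((ζ r : ℂ) / ζ a * (q : ℂ)⁻¹ ^ (2 * (r - a - 1))) • wN q n r y) ∈ N := by
    intro a ha
    have ha := Finset.mem_range.1 ha
    obtain ⟨d, rfl⟩ : ∃ d, r = a + d + 1 := ⟨r - a - 1, by omega⟩
    rw [show a + d + 1 - a - 1 = d by omega]
    exact N.smul_of_tower_mem _ (wN_fR_smul_mem hy hr hN)
  -- the contributions of the root vectors form a telescoping sum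
  have h3 : ∑ a ∈ Finset.range r, (s * (ζ a * (q : ℂ)⁻¹)) *
      ((ζ r : ℂ) / ζ a * (q : ℂ)⁻¹ ^ (2 * (r - a - 1))) =
      ζ r - (ζ r : ℂ) * (q : ℂ)⁻¹ ^ (2 * r) := by
    have : ∀ a ∈ Finset.range r, (s * (ζ a * (q : ℂ)⁻¹)) *
        ((ζ r : ℂ) / ζ a * (q : ℂ)⁻¹ ^ (2 * (r - a - 1))) =
        (ζ r * (q : ℂ)⁻¹ ^ (2 * r)) * (q : ℂ) ^ (2 * (a + 1)) -
          (ζ r * (q : ℂ)⁻¹ ^ (2 * r)) * (q : ℂ) ^ (2 * a) := by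
      intro a ha
      have ha := Finset.mem_range.1 ha
      obtain ⟨d, rfl⟩ : ∃ d, r = a + d + 1 := ⟨r - a - 1, by omega⟩
      rw [show a + d + 1 - a - 1 = d by omega, hs]
      have := (ζ a).ne_zero
      simp only [inv_pow]
      field_simp
      ring
    rw [Finset.sum_congr rfl this,
      Finset.sum_range_sub (fun a => (ζ r * (q : ℂ)⁻¹ ^ (2 * r)) * (q : ℂ) ^ (2 * a))]
    simp only [inv_pow]
    field_simp
    ring
  have h4 := N.sum_mem h2
  simp only [smul_add, smul_smul, Finset.sum_add_distrib, ← Finset.sum_smul] at h4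
  rw [h3] at h4
  convert h4 using 1
  rw [h1]
  match_scalars <;> ring

variable (q n) in
/-- The submodule generated by the vectors `w_i ⊗ v`, `i < m`: a step of the standard filtration of
`ℂ^n ⊗ M`. -/
def flag (v : M) (m : ℕ) : Submodule (Uq q n) (NatTensor q n M) :=
  Submodule.span (Uq q n) {u | ∃ i < m, u = wN q n i v}

theorem wN_mem_flag {v : M} {i m : ℕ} (h : i < m) : wN q n i v ∈ flag q n v m :=
  Submodule.subset_span ⟨i, h, rfl⟩

theorem flag_le {v : M} {m : ℕ} {N : Submodule (Uq q n) (NatTensor q n M)}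
    (h : ∀ i < m, wN q n i v ∈ N) : flag q n v m ≤ N :=
  Submodule.span_le.2 (by rintro _ ⟨i, hi, rfl⟩; exact h i hi)

theorem flag_mono {v : M} {m m' : ℕ} (h : m ≤ m') : flag q n v m ≤ flag q n v m' :=
  flag_le fun _ hi => wN_mem_flag (by omega)

theorem flag_zero (v : M) : flag q n v 0 = ⊥ := by
  rw [eq_bot_iff]; exact flag_le fun i hi => absurd hi (by omega)

variable (q) in
/-- `x̂_i = q^{2 (μ, ε_i) - 2 i}` (indices start at `0`), where `ζ i = q^{(μ, ε_i)}`. -/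
def xN (ζ : ℕ → ℂˣ) (i : ℕ) : ℂ := (ζ i : ℂ) ^ 2 * (q : ℂ)⁻¹ ^ (2 * i)

theorem eR_smul_eq_zero {y : M} {d i : ℕ} (h : ∀ j, i ≤ j → j ≤ i + d → eN q n j • y = 0) :
    eR q n d i • y = 0 := by
  induction d generalizing i with
  | zero => exact h i le_rfl le_rfl
  | succ d ih =>
    rw [eR_succ, sub_smul, smul_assoc, mul_smul, mul_smul, h i le_rfl (by omega),
      ih fun j hj hj' => h j (by omega) (by omega)]
    simp

/-- On `w_b ⊗ y` with `y` annihilated by `e_b, e_{b+1}, ...`, only the Cartan part of `ℛ` acts. -/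
theorem matAct_lMinus_wN_of_eN {y : M} {b : ℕ} (hb : b < n) (h : ∀ j, b ≤ j → eN q n j • y = 0) :
    matAct M (lMinus q) (wN q n b y) = wN q n b (kN q n b • y) := by
  rw [matAct_lMinus_wN hb, Finset.sum_eq_single b, lmN_self]
  · intro a _ ha
    rcases lt_or_gt_of_ne ha with h1 | h1
    · rw [lmN_of_lt h1, zero_smul, map_zero]
    · obtain ⟨d, rfl⟩ : ∃ d, a = b + d + 1 := ⟨a - b - 1, by omega⟩
      rw [lmN_add, smul_assoc, mul_smul, eR_smul_eq_zero fun j hj _ => h j hj]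
      simp
  · intro h; exact absurd (Finset.mem_range.2 hb) h

/-- On `w_r ⊗ v` the operator `𝒬` is `x̂_r` modulo the preceding step of the filtration. -/
theorem qOperator_wN_sub_mem {ζ : ℕ → ℂˣ} {v : M} (hv : IsHW q n ζ v) {r : ℕ} (hr : r < n) :
    qOperator q n M (wN q n r v) - xN q ζ r • wN q n r v ∈ flag q n v r := by
  have h := matAct_lPlus_wN_sub_mem hv.2 hr (N := flag q n v r) fun a ha => wN_mem_flag ha
  have h1 := (flag q n v r).smul_of_tower_mem (ζ r : ℂ) h
  rw [qOperator_eq, Module.End.mul_apply, matAct_lMinus_wN_of_eN hr fun j _ => hv.1 j, hv.2 r hr,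
    wN_smul, map_smul]
  convert h1 using 1
  rw [smul_sub, smul_smul, xN]
  congr 2; ring

end Flag

/-! ### Dynamical root vectors and singular vectors of `ℂ^n ⊗ M` -/

section Dynamical

variable {q : ℂˣ} {n : ℕ} {M : Type*} [AddCommGroup M] [Module ℂ M]
  [Module (Uq q n) M] [IsScalarTower ℂ (Uq q n) M]

variable (q n) in
/-- The dynamical root vector of the root `ε_{i+d} - ε_i`. For `d = 1` the recursion also gives
`f_i`, since the first quantum number is `[0]_q` and the second one is `[-1]_q`. -/
def dynN (ζ : ℕ → ℂˣ) : (d i : ℕ) → Uq q n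
  | 0, _ => 1
  | d + 1, i =>
      qNumber q (ζ (i + 1) / ζ (i + d + 1) * q ^ d) • (fN q n i * dynN ζ d (i + 1)) -
        qNumber q (ζ (i + 1) / ζ (i + d + 1) * q ^ d / q) • (dynN ζ d (i + 1) * fN q n i)

theorem qNumber_one : qNumber q 1 = 0 := by simp [qNumber]

theorem qNumber_inv (hq : (q : ℂ) - (q : ℂ)⁻¹ ≠ 0) : qNumber q (1 / q) = -1 := by
  rw [qNumber, div_eq_iff hq]; simp

variable (q) in
/-- The quantum number `[(μ, ε_i - ε_{i+d+1}) + d]_q`. -/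
def aN (ζ : ℕ → ℂˣ) (d i : ℕ) : ℂ := qNumber q (ζ i / ζ (i + d + 1) * q ^ d)

theorem dynN_zero (ζ : ℕ → ℂˣ) (i : ℕ) : dynN q n ζ 0 i = 1 := rfl

theorem dynN_succ (ζ : ℕ → ℂˣ) (d i : ℕ) : dynN q n ζ (d + 1) i =
    qNumber q (ζ (i + 1) / ζ (i + d + 1) * q ^ d) • (fN q n i * dynN q n ζ d (i + 1)) -
      qNumber q (ζ (i + 1) / ζ (i + d + 1) * q ^ d / q) • (dynN q n ζ d (i + 1) * fN q n i) := rfl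

theorem dynN_one (hq : (q : ℂ) - (q : ℂ)⁻¹ ≠ 0) (ζ : ℕ → ℂˣ) (i : ℕ) :
    dynN q n ζ 1 i = fN q n i := by
  rw [dynN_succ, add_zero, div_self', pow_zero, mul_one, qNumber_one, qNumber_inv hq, dynN_zero]
  simp

theorem dynN_succ_smul (ζ : ℕ → ℂˣ) (d i : ℕ) (y : M) : dynN q n ζ (d + 1) i • y =
    qNumber q (ζ (i + 1) / ζ (i + d + 1) * q ^ d) • fN q n i • dynN q n ζ d (i + 1) • y -
      qNumber q (ζ (i + 1) / ζ (i + d + 1) * q ^ d / q) • dynN q n ζ d (i + 1) • fN q n i • y := by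
  rw [dynN_succ, sub_smul, smul_assoc, smul_assoc, mul_smul, mul_smul]

theorem dynN_congr {ζ ζ' : ℕ → ℂˣ} {d i : ℕ} (h : ∀ a, i < a → a ≤ i + d → ζ a = ζ' a) :
    dynN q n ζ d i = dynN q n ζ' d i := by
  induction d generalizing i with
  | zero => rfl
  | succ d ih =>
    rw [dynN_succ, dynN_succ, ih fun a ha ha' => h a (by omega) (by omega),
      h (i + 1) (by omega) (by omega), h (i + d + 1) (by omega) (by omega)]

theorem commute_dynN {x : Uq q n} {ζ : ℕ → ℂˣ} {d i : ℕ}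
    (h : ∀ j, i ≤ j → j < i + d → Commute x (fN q n j)) : Commute x (dynN q n ζ d i) := by
  induction d generalizing i with
  | zero => exact Commute.one_right x
  | succ d ih =>
    have h1 := ih (i := i + 1) fun j hj hj' => h j (by omega) (by omega)
    have h2 := h i le_rfl (by omega)
    exact ((h2.mul_right h1).smul_right _).sub_right ((h1.mul_right h2).smul_right _)

theorem fN_commute {i j : ℕ} (h : i + 1 < j ∨ j + 1 < i) : Commute (fN q n i) (fN q n j) := by
  rcases h with h | h
  · exact fN_comm h
  · exact (fN_comm h).symm

theorem commute_smul_smul {x x' : Uq q n} (h : Commute x x') (y : M) :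
    x • x' • y = x' • x • y := by rw [← mul_smul, h.eq, mul_smul]

theorem dynN_mul_kN (ζ : ℕ → ℂˣ) (d i a : ℕ) :
    dynN q n ζ d i * kN q n a = qpow q (epsR a i (i + d)) • (kN q n a * dynN q n ζ d i) := by
  induction d generalizing i with
  | zero => simp [dynN_zero, epsR, qpow_zero]
  | succ d ih =>
    have e : epsR a i (i + (d + 1)) = epsR a i (i + 1) + epsR a (i + 1) (i + 1 + d) := by
      rw [show i + (d + 1) = i + 1 + d by omega]; simp only [epsR]; ring
    have h1 : fN q n i * dynN q n ζ d (i + 1) * kN q n a = qpow q (epsR a i (i + (d + 1))) •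
        (kN q n a * (fN q n i * dynN q n ζ d (i + 1))) := by
      rw [mul_assoc, ih, mul_smul_comm, ← mul_assoc, fN_mul_kN, smul_mul_assoc, smul_smul,
        mul_assoc, e, qpow_add, mul_comm (qpow q _)]
    have h2 : dynN q n ζ d (i + 1) * fN q n i * kN q n a = qpow q (epsR a i (i + (d + 1))) •
        (kN q n a * (dynN q n ζ d (i + 1) * fN q n i)) := by
      rw [mul_assoc, fN_mul_kN, mul_smul_comm, ← mul_assoc, ih, smul_mul_assoc, smul_smul,
        mul_assoc, e, qpow_add]
    rw [dynN_succ, sub_mul, smul_mul_assoc, smul_mul_assoc, h1, h2, mul_sub, mul_smul_comm,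
      mul_smul_comm, smul_sub, smul_comm (qNumber q _), smul_comm (qNumber q _)]

theorem IsWt.dynN {ζ : ℕ → ℂˣ} {y : M} (h : IsWt q n ζ y) (z : ℕ → ℂˣ) (d i : ℕ) :
    IsWt q n (shiftWt q ζ i (i + d)) (dynN q n z d i • y) :=
  h.smul_of_commute fun a => dynN_mul_kN z d i a

theorem eN_fN_smul (hq : (q : ℂ) - (q : ℂ)⁻¹ ≠ 0) {ζ : ℕ → ℂˣ} {y : M} (h : IsWt q n ζ y) {j : ℕ}
    (hj : j + 1 < n) : eN q n j • fN q n j • y =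
      fN q n j • eN q n j • y + qNumber q (ζ j / ζ (j + 1)) • y := by
  have h1 := congrArg (fun x : Uq q n => x • y) (eN_mul_fN_self (q := q) hj)
  simp only [smul_assoc] at h1
  rw [sub_smul (_ * _ : Uq q n), sub_smul (_ * _ : Uq q n), mul_smul (eN q n j) (fN q n j) y,
    mul_smul, mul_smul, mul_smul] at h1
  rw [h.kiN hj, h.kiN_kN (by omega) hj, smul_smul_comm', h j (by omega),
    smul_smul (ζ (j + 1) : ℂ)⁻¹] at h1
  rw [← sub_eq_iff_eq_add']
  apply smul_right_injective M hq
  change ((q : ℂ) - (q : ℂ)⁻¹) • _ = ((q : ℂ) - (q : ℂ)⁻¹) • _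
  rw [h1, smul_smul, qNumber, mul_div_cancel₀ _ hq, ← sub_smul]
  have := (ζ j).ne_zero
  have := (ζ (j + 1)).ne_zero
  congr 1
  push_cast
  field_simp

/-- The identity `[β] [ξ + 1] - [β - 1] [ξ] = [β + ξ]` of quantum numbers, with `b = q^β` and
`x = q^ξ`. -/
theorem qNumber_identity (hq : (q : ℂ) - (q : ℂ)⁻¹ ≠ 0) (b x : ℂˣ) :
    qNumber q b * qNumber q (x * q) - qNumber q (b / q) * qNumber q x = qNumber q (b * x) := by
  have h1 : (q : ℂ) ^ 2 - 1 ≠ 0 := by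
    intro h; apply hq; field_simp [q.ne_zero]; rw [h, mul_zero]
  have := q.ne_zero; have := b.ne_zero; have := x.ne_zero
  simp only [qNumber]
  push_cast
  field_simp
  ring

theorem shiftWt_of_ne {ζ : ℕ → ℂˣ} {r s i : ℕ} (h : i ≠ r) (h' : i ≠ s) :
    shiftWt q ζ r s i = ζ i := by
  rw [shiftWt, epsR_of_ne h h', neg_zero, zpow_zero, mul_one]

theorem shiftWt_left {ζ : ℕ → ℂˣ} {r s : ℕ} (h : r ≠ s) : shiftWt q ζ r s r = ζ r / q := by
  rw [shiftWt, epsR_left rfl h, zpow_neg_one, div_eq_mul_inv]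

theorem shiftWt_right {ζ : ℕ → ℂˣ} {r s : ℕ} (h : s ≠ r) : shiftWt q ζ r s s = ζ s * q := by
  rw [shiftWt, epsR_right rfl h, neg_neg, zpow_one]

/-- The action of the `e_j` on `f̌ y`, where `f̌` is the dynamical root vector of
`ε_{r+d+1} - ε_r`, and `y` is annihilated by `e_r, ..., e_{r+d}`. -/
theorem eN_dynN_smul (hq : (q : ℂ) - (q : ℂ)⁻¹ ≠ 0) {ζ : ℕ → ℂˣ} {y : M} (hy : IsWt q n ζ y)
    {d r : ℕ} (hn : r + d + 1 < n) (he : ∀ j, r ≤ j → j ≤ r + d → eN q n j • y = 0) :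
    (∀ j, r < j → j ≤ r + d → eN q n j • dynN q n ζ (d + 1) r • y = 0) ∧
      eN q n r • dynN q n ζ (d + 1) r • y = aN q ζ d r • dynN q n ζ d (r + 1) • y := by
  induction d generalizing r ζ y with
  | zero =>
    refine ⟨fun j hj hj' => by omega, ?_⟩
    rw [dynN_one hq, eN_fN_smul hq hy (by omega), he r le_rfl le_rfl, smul_zero, zero_add,
      dynN_zero, one_smul, aN, pow_zero, mul_one]
  | succ d ih =>
    have hf := hy.fN r
    have hef : ∀ j, r < j → eN q n j • fN q n r • y = fN q n r • eN q n j • y := fun j hj => by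
      rw [← mul_smul, eN_mul_fN_of_ne (by omega), mul_smul]
    obtain ⟨h1, h2⟩ := ih hy (r := r + 1) (by omega) fun j hj hj' => he j (by omega) (by omega)
    obtain ⟨h3, h4⟩ := ih hf (r := r + 1) (by omega) fun j hj hj' => by
      rw [hef j (by omega), he j (by omega) (by omega), smul_zero]
    have hD : dynN q n (shiftWt q ζ r (r + 1)) (d + 1) (r + 1) = dynN q n ζ (d + 1) (r + 1) :=
      dynN_congr fun a ha _ => shiftWt_of_ne (by omega) (by omega)
    have hD' : dynN q n (shiftWt q ζ r (r + 1)) d (r + 1 + 1) = dynN q n ζ d (r + 1 + 1) :=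
      dynN_congr fun a ha _ => shiftWt_of_ne (by omega) (by omega)
    rw [hD] at h3 h4
    rw [hD'] at h4
    constructor
    · intro j hj hj'
      -- for `j = r + 1`, the two terms of the recursion cancel by the choice of the coefficients
      rw [dynN_succ_smul, smul_sub, smul_smul_comm', smul_smul_comm']
      rw [← mul_smul (eN q n j) (fN q n r), eN_mul_fN_of_ne (by omega), mul_smul]
      rcases eq_or_ne j (r + 1) with rfl | hne
      · have hc : Commute (fN q n r) (dynN q n ζ d (r + 1 + 1)) :=
          commute_dynN fun j hj _ => fN_commute (by omega)
        rw [h2, h4, smul_smul_comm', commute_smul_smul hc]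
        generalize dynN q n ζ d (r + 1 + 1) • fN q n r • y = E
        rw [smul_smul, smul_smul, ← sub_smul]
        convert zero_smul ℂ _ using 2
        rw [aN, aN, shiftWt_right (by omega), shiftWt_of_ne (by omega) (by omega), sub_eq_zero,
          mul_comm, show r + 1 + d + 1 = r + (d + 1) + 1 by omega]
        congr 2 <;> rw [pow_succ]
        · rw [mul_div_assoc, mul_div_cancel_right]
        · rw [mul_div_right_comm, mul_assoc, mul_comm (q : ℂˣ)]
      · rw [h1 j (by omega) (by omega), h3 j (by omega) (by omega)]
        simp
    · have hc : Commute (eN q n r) (dynN q n ζ (d + 1) (r + 1)) :=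
        commute_dynN fun j hj _ => eN_mul_fN_of_ne (by omega)
      rw [dynN_succ_smul, smul_sub, smul_smul_comm', smul_smul_comm',
        eN_fN_smul hq (hy.dynN ζ (d + 1) (r + 1)) (by omega), commute_smul_smul hc,
        commute_smul_smul hc,
        he r le_rfl (by omega), eN_fN_smul hq hy (by omega), he r le_rfl (by omega),
        smul_zero, smul_zero, zero_add, zero_add, smul_smul_comm']
      generalize dynN q n ζ (d + 1) (r + 1) • y = E
      rw [smul_smul, smul_smul, ← sub_smul, shiftWt_of_ne (by omega) (by omega),
        shiftWt_left (by omega)]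
      congr 1
      rw [aN, show ζ r / (ζ (r + 1) / q) = ζ r / ζ (r + 1) * q by
        rw [div_div_eq_mul_div, div_mul_eq_mul_div], qNumber_identity hq]
      congr 1
      rw [mul_right_comm, mul_comm (_ / _), div_mul_div_cancel]

/-- For a highest weight vector `v` and the dynamical root vector `f̌` of the root
`ε_{r+d+1} - ε_r`, the vector `f̌ v` is annihilated by all `e_j`, `j ≠ r`. -/
theorem IsHW.eN_dynN_smul (hq : (q : ℂ) - (q : ℂ)⁻¹ ≠ 0) {ζ : ℕ → ℂˣ} {v : M}
    (hv : IsHW q n ζ v) {d r j : ℕ} (hn : r + d + 1 < n) (hj : j ≠ r) :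
    eN q n j • dynN q n ζ (d + 1) r • v = 0 := by
  by_cases h : r < j ∧ j ≤ r + d
  · exact (QuantumGL.eN_dynN_smul hq hv.2 hn fun j _ _ => hv.1 j).1 j h.1 h.2
  · have hc : Commute (eN q n j) (dynN q n ζ (d + 1) r) :=
      commute_dynN fun i hi hi' => eN_mul_fN_of_ne (by omega)
    rw [commute_smul_smul hc, hv.1, smul_zero]

theorem dynN_smul_wN_of_lt {ζ : ℕ → ℂˣ} {d i a : ℕ} (h : a < i) (y : M) :
    dynN q n ζ d i • wN q n a y = wN q n a (dynN q n ζ d i • y) := by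
  induction d generalizing i y with
  | zero => rw [dynN_zero, one_smul, one_smul]
  | succ d ih =>
    rw [dynN_succ_smul, dynN_succ_smul, fN_smul_wN_of_ne (by omega), ih (by omega),
      ih (by omega), fN_smul_wN_of_ne (by omega), map_sub, wN_smul, wN_smul]

variable (q n) in
/-- The partial sum over `i ≥ r` of the vector `û_{r+d}`, divided by the coefficient of its first
term. -/
def uN (ζ : ℕ → ℂˣ) (y : M) : (d r : ℕ) → NatTensor q n M
  | 0, r => wN q n r y
  | d + 1, r => wN q n r (dynN q n ζ (d + 1) r • y) - ((q : ℂ) * aN q ζ d r) • uN ζ y d (r + 1)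

theorem uN_zero (ζ : ℕ → ℂˣ) (y : M) (r : ℕ) : uN q n ζ y 0 r = wN q n r y := rfl

theorem uN_succ (ζ : ℕ → ℂˣ) (y : M) (d r : ℕ) : uN q n ζ y (d + 1) r =
    wN q n r (dynN q n ζ (d + 1) r • y) - ((q : ℂ) * aN q ζ d r) • uN q n ζ y d (r + 1) := rfl

/-- The dynamical root vector `f̌` of the root `ε_{r+d+1} - ε_r`, applied to `w_r ⊗ y`, produces a
partial sum of `û_{r+d+1}` besides `w_r ⊗ f̌ y`. -/
theorem dynN_smul_wN (hq : (q : ℂ) - (q : ℂ)⁻¹ ≠ 0) {ζ : ℕ → ℂˣ} {y : M} (hy : IsWt q n ζ y)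
    {d r : ℕ} (hn : r + d + 1 < n) : dynN q n ζ (d + 1) r • wN q n r y =
      wN q n r (dynN q n ζ (d + 1) r • y) +
        ((ζ (r + d + 1) : ℂ) / ζ r * (q : ℂ)⁻¹ ^ d) • uN q n ζ y d (r + 1) := by
  induction d generalizing r with
  | zero =>
    rw [dynN_one hq, fN_smul_wN, if_pos rfl, hy.kiN_kN (by omega) (by omega), wN_smul, uN_zero,
      add_zero, pow_zero, mul_one]
  | succ d ih =>
    have ih := ih (r := r + 1) (by omega)
    have hk := (hy.dynN ζ (d + 1) (r + 1)).kiN_kN (i := r) (j := r + 1) (by omega) (by omega)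
    rw [shiftWt_left (by omega), shiftWt_of_ne (by omega) (by omega)] at hk
    rw [dynN_succ_smul ζ (d + 1) r, dynN_succ_smul ζ (d + 1) r, dynN_smul_wN_of_lt (by omega),
      fN_smul_wN, if_pos rfl, hk,
      fN_smul_wN, if_pos rfl, smul_add, smul_add (dynN q n ζ (d + 1) (r + 1)),
      dynN_smul_wN_of_lt (by omega),
      hy.kiN_kN (by omega) (by omega), wN_smul, wN_smul, smul_smul_comm', ih, uN_succ, map_sub,
      wN_smul, wN_smul, aN, show r + 1 + d + 1 = r + (d + 1) + 1 by omega]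
    have h1 : (q : ℂ) ^ 2 - 1 ≠ 0 := by
      intro h; apply hq; field_simp [q.ne_zero]; rw [h, mul_zero]
    have := q.ne_zero
    have := (ζ r).ne_zero
    have := (ζ (r + 1)).ne_zero
    have := (ζ (r + (d + 1) + 1)).ne_zero
    generalize wN q n (r + 1) (dynN q n ζ (d + 1) (r + 1) • y) = A
    generalize wN q n r (fN q n r • dynN q n ζ (d + 1) (r + 1) • y) = B
    generalize wN q n r (dynN q n ζ (d + 1) (r + 1) • fN q n r • y) = C
    generalize uN q n ζ y d (r + 1 + 1) = E
    match_scalars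
    all_goals first
      | ring1
      | (simp only [qNumber]; push_cast; simp only [inv_pow]; field_simp; ring1)

end Dynamical

/-! ### The operator `𝒬` on the vectors `û` -/

section Action

variable {q : ℂˣ} {n : ℕ} {M : Type*} [AddCommGroup M] [Module ℂ M]
  [Module (Uq q n) M] [IsScalarTower ℂ (Uq q n) M]

/-- For a dynamical root vector `f̌ v`, the operator `(π ⊗ id)(ℛ)` on `w_r ⊗ f̌ v` is expressed by
its value on the next dynamical root vector. -/
theorem matAct_lMinus_wN_dynN_step (hq : (q : ℂ) - (q : ℂ)⁻¹ ≠ 0) {ζ : ℕ → ℂˣ} {v : M}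
    (hv : IsHW q n ζ v) {d r : ℕ} (hn : r + d + 1 < n) :
    matAct M (lMinus q) (wN q n r (dynN q n ζ (d + 1) r • v)) =
      wN q n r (kN q n r • dynN q n ζ (d + 1) r • v) +
        aN q ζ d r • ((q : ℂ) • wN q n (r + 1) (kN q n (r + 1) • dynN q n ζ d (r + 1) • v) -
          (q : ℂ)⁻¹ • matAct M (lMinus q) (wN q n (r + 1) (dynN q n ζ d (r + 1) • v))) := by
  obtain ⟨-, he⟩ := eN_dynN_smul hq hv.2 hn fun j _ _ => hv.1 j
  have h0 : ∀ j, j ≠ r → eN q n j • dynN q n ζ (d + 1) r • v = 0 := fun j hj =>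
    hv.eN_dynN_smul hq hn hj
  set y := dynN q n ζ (d + 1) r • v with hy
  set y' := dynN q n ζ d (r + 1) • v with hy'
  have key : ∀ a ∈ Finset.range n, wN q n a (lmN q n a r • y) =
      ((if a = r then wN q n r (kN q n r • y) else 0) +
        (if a = r + 1 then ((q : ℂ) * aN q ζ d r) • wN q n (r + 1) (kN q n (r + 1) • y') else 0)) -
        ((q : ℂ)⁻¹ * aN q ζ d r) • wN q n a (lmN q n a (r + 1) • y') := by
    intro a _
    rcases lt_trichotomy a r with h | rfl | h
    · rw [lmN_of_lt h, lmN_of_lt (by omega), if_neg (by omega), if_neg (by omega)]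
      simp
    · rw [lmN_self, lmN_of_lt (by omega), if_pos rfl, if_neg (by omega)]
      simp
    · obtain ⟨t, rfl⟩ : ∃ t, a = r + t + 1 := ⟨a - r - 1, by omega⟩
      rw [if_neg (by omega), lmN_add, smul_assoc, mul_smul]
      rcases t with _ | t
      · rw [add_zero, if_pos rfl, lmN_self, eR_zero, he, smul_smul_comm', wN_smul, wN_smul]
        match_scalars
        ring
      · have e : r + (t + 1) + 1 = r + 1 + t + 1 := by omega
        rw [if_neg (by omega), e, lmN_add, smul_assoc, mul_smul, eR_succ,
          sub_smul (_ * _ : Uq q n), smul_assoc (q : ℂ)⁻¹ (_ * _ : Uq q n), mul_smul (eN q n r),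
          mul_smul (eR q n t (r + 1)), eR_smul_eq_zero (y := y) fun j hj _ => h0 j (by omega), he,
          smul_smul_comm' (eR q n t (r + 1)), smul_zero, zero_sub, smul_neg, smul_smul_comm',
          smul_smul_comm', smul_neg, map_neg, wN_smul, wN_smul, wN_smul,
          mul_smul (kN q n _), wN_smul]
        match_scalars
        ring
  rw [matAct_lMinus_wN (by omega), matAct_lMinus_wN (by omega), Finset.sum_congr rfl key,
    Finset.sum_sub_distrib, Finset.sum_add_distrib, Finset.sum_ite_eq', Finset.sum_ite_eq',
    if_pos (Finset.mem_range.2 (by omega)), if_pos (Finset.mem_range.2 (by omega)),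
    ← Finset.smul_sum, smul_sub, smul_smul (aN q ζ d r), smul_smul (aN q ζ d r), add_sub_assoc,
    mul_comm (q : ℂ), mul_comm (q : ℂ)⁻¹]

/-- The recursion `matAct_lMinus_wN_dynN_step` in closed form: the terms other than the Cartan one
add up to the value of `(π ⊗ id)(ℛ)` on a partial sum of `û_{r+d+1}`. -/
theorem matAct_lMinus_wN_dynN (hq : (q : ℂ) - (q : ℂ)⁻¹ ≠ 0) {ζ : ℕ → ℂˣ} {v : M}
    (hv : IsHW q n ζ v) {d r : ℕ} (hn : r + d + 1 < n) :
    matAct M (lMinus q) (wN q n r (dynN q n ζ (d + 1) r • v)) =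
      wN q n r (kN q n r • dynN q n ζ (d + 1) r • v) +
        (((q : ℂ) - (q : ℂ)⁻¹) * aN q ζ d r) • matAct M (lMinus q) (uN q n ζ v d (r + 1)) := by
  induction d generalizing r with
  | zero =>
    rw [matAct_lMinus_wN_dynN_step hq hv hn, uN_zero, dynN_zero, one_smul,
      matAct_lMinus_wN_of_eN (by omega) fun j _ => hv.1 j]
    generalize wN q n r (kN q n r • dynN q n ζ (0 + 1) r • v) = A
    generalize wN q n (r + 1) (kN q n (r + 1) • v) = B
    match_scalars <;> ring
  | succ d ih =>
    have h := ih (r := r + 1) (by omega)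
    rw [matAct_lMinus_wN_dynN_step hq hv hn, uN_succ, map_sub, LinearMap.map_smul, h]
    generalize matAct M (lMinus q) (uN q n ζ v d (r + 1 + 1)) = C
    generalize wN q n r (kN q n r • dynN q n ζ (d + 1 + 1) r • v) = A
    generalize wN q n (r + 1) (kN q n (r + 1) • dynN q n ζ (d + 1) (r + 1) • v) = B
    match_scalars <;> ring

/-- The recursion behind the formula for `û_m`: modulo the span of `w_i ⊗ v`, `i < r`, the operator
`𝒬 - x̂_r` maps a partial sum of `û_m` to a non-zero multiple of the next one. -/
theorem qOperator_uN_sub_mem (hq₀ : (q : ℂ) + (q : ℂ)⁻¹ ≠ 0) (hq : (q : ℂ) - (q : ℂ)⁻¹ ≠ 0)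
    {ζ : ℕ → ℂˣ} {v : M} (hv : IsHW q n ζ v) {d r : ℕ} (hn : r + d + 1 < n) :
    qOperator q n M (uN q n ζ v d (r + 1)) - xN q ζ r • uN q n ζ v d (r + 1) -
      (xN q ζ r * ((ζ (r + d + 1) : ℂ) / ζ r * (q : ℂ)⁻¹ ^ d) *
        (((q : ℂ) - (q : ℂ)⁻¹) * (q : ℂ)⁻¹)) • uN q n ζ v (d + 1) r ∈ flag q n v r := by
  have hB := dynN_smul_wN hq hv.2 hn
  have hL := congrArg (matAct M (lPlus q)) (matAct_lMinus_wN_dynN hq hv hn)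
  have hw := hv.2.dynN ζ (d + 1) r
  have hP := matAct_lPlus_wN_sub_mem hw (r := r) (by omega) (N := flag q n v r) fun a ha => by
    rw [← dynN_smul_wN_of_lt ha]
    exact (flag q n v r).smul_mem _ (wN_mem_flag ha)
  have hQ := (flag q n v r).smul_mem (dynN q n ζ (d + 1) r)
    (qOperator_wN_sub_mem hv (r := r) (by omega))
  rw [hw r (by omega), shiftWt_left (by omega), wN_smul, map_add, LinearMap.map_smul,
    LinearMap.map_smul, ← Module.End.mul_apply, ← Module.End.mul_apply, ← qOperator_eq] at hL
  rw [shiftWt_left (by omega)] at hP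
  rw [smul_sub, ← qOperator_smul hq₀ hq, smul_smul_comm', hB, map_add, LinearMap.map_smul, hL] at hQ
  rw [uN_succ]
  have hm := (flag q n v r).smul_of_tower_mem ((ζ (r + d + 1) : ℂ) / ζ r * (q : ℂ)⁻¹ ^ d)
    ((flag q n v r).sub_mem hQ ((flag q n v r).smul_of_tower_mem ((ζ r / q : ℂˣ) : ℂ) hP))
  convert hm using 1
  have h1 : (q : ℂ) ^ 2 - 1 ≠ 0 := by
    intro h; apply hq; field_simp [q.ne_zero]; rw [h, mul_zero]
  have := q.ne_zero
  have := (ζ r).ne_zero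
  have := (ζ (r + d + 1)).ne_zero
  generalize wN q n r (dynN q n ζ (d + 1) r • v) = A
  match_scalars
  all_goals
    try simp only [aN, qNumber, xN]
    push_cast
    try simp only [inv_pow]
    field_simp
    ring1

/-- On a quotient of consecutive steps of the filtration, `𝒬` acts by the scalar `x̂_r`. -/
theorem qOperator_sub_mem_flag (hq₀ : (q : ℂ) + (q : ℂ)⁻¹ ≠ 0) (hq : (q : ℂ) - (q : ℂ)⁻¹ ≠ 0)
    {ζ : ℕ → ℂˣ} {v : M} (hv : IsHW q n ζ v) {r : ℕ} (hr : r < n) {u : NatTensor q n M}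
    (hu : u ∈ flag q n v (r + 1)) :
    qOperator q n M u - xN q ζ r • u ∈ flag q n v r := by
  induction hu using Submodule.span_induction with
  | mem u hu =>
    obtain ⟨i, hi, rfl⟩ := hu
    rcases (Nat.lt_succ_iff.1 hi).eq_or_lt with rfl | hi
    · exact qOperator_wN_sub_mem hv hr
    · have h1 := flag_mono (by omega : i ≤ r) (qOperator_wN_sub_mem hv (hi.trans hr))
      have h2 := (flag q n v r).smul_of_tower_mem (xN q ζ i - xN q ζ r) (wN_mem_flag hi)
      convert (flag q n v r).add_mem h1 h2 using 1
      module
  | zero => simp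
  | add u u' _ _ h h' =>
    convert (flag q n v r).add_mem h h' using 1
    rw [map_add]
    module
  | smul x u _ h =>
    convert (flag q n v r).smul_mem x h using 1
    rw [qOperator_smul hq₀ hq, smul_sub, smul_smul_comm']

open Polynomial

/-- Polynomials in `𝒬` are endomorphisms of the `U_q(gl_n)`-module `ℂ^n ⊗ M`. -/
theorem aeval_qOperator_smul (hq₀ : (q : ℂ) + (q : ℂ)⁻¹ ≠ 0) (hq : (q : ℂ) - (q : ℂ)⁻¹ ≠ 0)
    (p : ℂ[X]) (x : Uq q n) (u : NatTensor q n M) :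
    aeval (qOperator q n M) p (x • u) = x • aeval (qOperator q n M) p u := by
  induction p using Polynomial.induction_on' generalizing u with
  | add p p' h h' => rw [map_add, LinearMap.add_apply, LinearMap.add_apply, h, h', smul_add]
  | monomial k a =>
    have hk : ∀ (k : ℕ) u, (qOperator q n M ^ k) (x • u) = x • (qOperator q n M ^ k) u := by
      intro k
      induction k with
      | zero => intro u; rfl
      | succ k ih =>
        intro u
        rw [pow_succ, Module.End.mul_apply, Module.End.mul_apply, qOperator_smul hq₀ hq, ih]
    rw [aeval_monomial, Module.End.mul_apply, Module.End.mul_apply, hk,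
      Module.algebraMap_end_apply, Module.algebraMap_end_apply, smul_smul_comm']

theorem aeval_X_sub_C_mul (Q : Module.End ℂ (NatTensor q n M)) (p : ℂ[X]) (x : ℂ)
    (u : NatTensor q n M) :
    aeval Q (p * (X - C x)) u = aeval Q p (Q u - x • u) := by
  rw [map_mul, Module.End.mul_apply]
  simp

theorem aeval_mul_X_sub_C (Q : Module.End ℂ (NatTensor q n M)) (p : ℂ[X]) (x : ℂ)
    (u : NatTensor q n M) :
    aeval Q ((X - C x) * p) u = Q (aeval Q p u) - x • aeval Q p u := by
  rw [map_mul, Module.End.mul_apply]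
  simp

theorem qOperator_mem_flag (hq₀ : (q : ℂ) + (q : ℂ)⁻¹ ≠ 0) (hq : (q : ℂ) - (q : ℂ)⁻¹ ≠ 0)
    {ζ : ℕ → ℂˣ} {v : M} (hv : IsHW q n ζ v) {m : ℕ} (hm : m ≤ n) {u : NatTensor q n M}
    (hu : u ∈ flag q n v m) : qOperator q n M u ∈ flag q n v m := by
  rcases m with _ | m
  · rw [flag_zero, Submodule.mem_bot] at hu
    rw [hu, map_zero]
    exact Submodule.zero_mem _
  · have h := flag_mono m.le_succ (qOperator_sub_mem_flag hq₀ hq hv hm hu)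
    simpa using Submodule.add_mem _ h (Submodule.smul_of_tower_mem _ (xN q ζ m) hu)

/-- A polynomial in `𝒬` acts on a step of the filtration by its value at `x̂_m`. -/
theorem aeval_qOperator_sub_mem (hq₀ : (q : ℂ) + (q : ℂ)⁻¹ ≠ 0) (hq : (q : ℂ) - (q : ℂ)⁻¹ ≠ 0)
    {ζ : ℕ → ℂˣ} {v : M} (hv : IsHW q n ζ v) {m : ℕ} (hm : m < n) (p : ℂ[X])
    {u : NatTensor q n M} (hu : u ∈ flag q n v (m + 1)) :
    aeval (qOperator q n M) p u - p.eval (xN q ζ m) • u ∈ flag q n v m := by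
  induction p using Polynomial.induction_on' generalizing u with
  | add p p' h h' =>
    convert (flag q n v m).add_mem (h hu) (h' hu) using 1
    rw [map_add, LinearMap.add_apply, eval_add]
    module
  | monomial k a =>
    have hk : ∀ k : ℕ, (qOperator q n M ^ k) u - xN q ζ m ^ k • u ∈ flag q n v m := by
      intro k
      induction k with
      | zero => simp
      | succ k ih =>
        have h1 := qOperator_mem_flag hq₀ hq hv hm.le ih
        have h2 := (flag q n v m).smul_of_tower_mem (xN q ζ m ^ k)
          (qOperator_sub_mem_flag hq₀ hq hv hm hu)
        convert (flag q n v m).add_mem h1 h2 using 1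
        rw [pow_succ', Module.End.mul_apply, map_sub, LinearMap.map_smul]
        module
    have := (flag q n v m).smul_of_tower_mem a (hk k)
    convert this using 1
    rw [aeval_monomial, Module.End.mul_apply, Module.algebraMap_end_apply, eval_monomial]
    module

/-- Up to a non-zero factor, `û_m` is the product of the operators `𝒬 - x̂_l`, `l < m`, applied to
`w_m ⊗ v`. -/
theorem exists_aeval_prod_eq_uN (hq₀ : (q : ℂ) + (q : ℂ)⁻¹ ≠ 0) (hq : (q : ℂ) - (q : ℂ)⁻¹ ≠ 0)
    {ζ : ℕ → ℂˣ} {v : M} (hv : IsHW q n ζ v) {m : ℕ} (hm : m < n) :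
    ∃ κ : ℂ, κ ≠ 0 ∧ aeval (qOperator q n M) (∏ l ∈ Finset.range m, (X - C (xN q ζ l)))
      (wN q n m v) = κ • uN q n ζ v m 0 := by
  -- the factors are applied one by one, in the order of decreasing `l`
  have key : ∀ d r, r + d = m → ∃ κ : ℂ, κ ≠ 0 ∧
      aeval (qOperator q n M) (∏ l ∈ Finset.Ico r m, (X - C (xN q ζ l))) (wN q n m v) -
        κ • uN q n ζ v d r ∈ flag q n v r := by
    intro d
    induction d with
    | zero =>
      rintro r rfl
      refine ⟨1, one_ne_zero, ?_⟩
      rw [add_zero, Finset.Ico_self, Finset.prod_empty, map_one, uN_zero, one_smul]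
      simp
    | succ d ih =>
      intro r hr
      obtain ⟨κ, hκ, h⟩ := ih (r + 1) (by omega)
      have h1 := qOperator_sub_mem_flag hq₀ hq hv (by omega) h
      have h2 := (flag q n v r).smul_of_tower_mem κ
        (qOperator_uN_sub_mem hq₀ hq hv (d := d) (r := r) (by omega))
      refine ⟨κ * (xN q ζ r * ((ζ (r + d + 1) : ℂ) / ζ r * (q : ℂ)⁻¹ ^ d) *
        (((q : ℂ) - (q : ℂ)⁻¹) * (q : ℂ)⁻¹)), ?_, ?_⟩
      · simp [hκ, hq, xN]
      · rw [Finset.prod_eq_prod_Ico_succ_bot (by omega), aeval_mul_X_sub_C]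
        convert (flag q n v r).add_mem h1 h2 using 1
        rw [map_sub, LinearMap.map_smul]
        module
  obtain ⟨κ, hκ, h⟩ := key m 0 (by omega)
  refine ⟨κ, hκ, ?_⟩
  rwa [flag_zero, Submodule.mem_bot, sub_eq_zero, ← Finset.range_eq_Ico] at h

/-- A partial sum of `û_m` is a multiple of `w_m ⊗ v` modulo the span of `w_i ⊗ v`, `i < m`, and the
factor is non-zero if `x̂_m` differs from the preceding `x̂_l`. -/
theorem exists_uN_sub_mem (hq : (q : ℂ) - (q : ℂ)⁻¹ ≠ 0) {ζ : ℕ → ℂˣ} {v : M}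
    (hv : IsWt q n ζ v) {d r : ℕ} (hn : r + d < n)
    (hx : ∀ l, r ≤ l → l < r + d → xN q ζ l ≠ xN q ζ (r + d)) :
    ∃ κ : ℂ, κ ≠ 0 ∧ uN q n ζ v d r - κ • wN q n (r + d) v ∈ flag q n v (r + d) := by
  induction d generalizing r with
  | zero => exact ⟨1, one_ne_zero, by simp [uN_zero]⟩
  | succ d ih =>
    have e : r + (d + 1) = r + 1 + d := by omega
    rw [e] at hn hx ⊢
    obtain ⟨κ, hκ, h⟩ := ih hn fun l hl hl' => hx l (by omega) hl'
    have h1 := (flag q n v (r + 1 + d)).smul_mem (dynN q n ζ (d + 1) r)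
      (wN_mem_flag (show r < r + 1 + d by omega))
    rw [dynN_smul_wN hq hv (by omega)] at h1
    set c := ((ζ (r + d + 1) : ℂ) / ζ r * (q : ℂ)⁻¹ ^ d) + (q : ℂ) * aN q ζ d r with hc
    -- up to a power of `q` and units, `c` is the difference of `x̂_{r+d+1}` and `x̂_r`
    have hc0 : c ≠ 0 := by
      intro h0
      apply hx r le_rfl (by omega)
      have h1 : (q : ℂ) ^ 2 - 1 ≠ 0 := by
        intro h; apply hq; field_simp [q.ne_zero]; rw [h, mul_zero]
      have := q.ne_zero
      have := (ζ r).ne_zero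
      have := (ζ (r + d + 1)).ne_zero
      rw [hc, aN, qNumber] at h0
      push_cast at h0
      simp only [inv_pow] at h0
      field_simp at h0
      rw [xN, xN, show r + 1 + d = r + d + 1 by omega]
      simp only [inv_pow]
      field_simp
      linear_combination (q : ℂ) ^ (2 * r) * h0
    refine ⟨-c * κ, mul_ne_zero (neg_ne_zero.2 hc0) hκ, ?_⟩
    have h2 := (flag q n v (r + 1 + d)).smul_of_tower_mem (-c) h
    convert (flag q n v (r + 1 + d)).add_mem h1 h2 using 1
    rw [uN_succ]
    module

/-- If `f̌ v = 0` for the dynamical root vector of `ε_m - ε_l`, then `f̌ (w_l ⊗ v)` is a multiple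
of a partial sum of `û_m`, in which `w_m ⊗ v` occurs with a non-zero coefficient. Hence the
filtration does not jump at `m`. -/
theorem wN_mem_flag_of_dynN_smul_eq_zero (hq : (q : ℂ) - (q : ℂ)⁻¹ ≠ 0) {ζ : ℕ → ℂˣ} {v : M}
    (hv : IsWt q n ζ v) {d l : ℕ} (hn : l + d + 1 < n)
    (hx : ∀ r, l < r → r < l + d + 1 → xN q ζ r ≠ xN q ζ (l + d + 1))
    (h0 : dynN q n ζ (d + 1) l • v = 0) : wN q n (l + d + 1) v ∈ flag q n v (l + d + 1) := by
  have e : l + d + 1 = l + 1 + d := by omega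
  obtain ⟨κ, hκ, h⟩ := exists_uN_sub_mem hq hv (d := d) (r := l + 1) (by omega)
    fun r hr hr' => by rw [← e]; exact hx r (by omega) (by omega)
  have h1 := dynN_smul_wN hq hv hn
  rw [h0, map_zero, zero_add] at h1
  have h2 : uN q n ζ v d (l + 1) ∈ flag q n v (l + 1 + d) := by
    have h3 := (flag q n v (l + 1 + d)).smul_mem (dynN q n ζ (d + 1) l)
      (wN_mem_flag (show l < l + 1 + d by omega))
    rw [h1] at h3
    have h4 := (flag q n v (l + 1 + d)).smul_of_tower_mem
      ((ζ (l + d + 1) : ℂ) / ζ l * (q : ℂ)⁻¹ ^ d)⁻¹ h3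
    rwa [smul_smul, inv_mul_cancel₀ (by simp), one_smul] at h4
  have h5 := (flag q n v (l + 1 + d)).smul_of_tower_mem κ⁻¹ (Submodule.sub_mem _ h2 h)
  rw [e]
  simpa [smul_smul, hκ] using h5

theorem mem_of_smul_mem {N : Submodule (Uq q n) (NatTensor q n M)} {a : ℂ} (ha : a ≠ 0)
    {u : NatTensor q n M} (h : a • u ∈ N) : u ∈ N := by
  simpa [smul_smul, ha] using N.smul_of_tower_mem a⁻¹ h

/-- If a submodule of `ℂ^n ⊗ M` contains all `w_a ⊗ y`, then it contains all `w_a ⊗ x y` for `x` in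
`U_q(gl_n)`. -/
theorem wN_smul_mem {N : Submodule (Uq q n) (NatTensor q n M)} (x : Uq q n) {y : M}
    (hy : ∀ a < n, wN q n a y ∈ N) : ∀ a < n, wN q n a (x • y) ∈ N := by
  have hk : ∀ (i : ℕ) {y : M}, (∀ a < n, wN q n a y ∈ N) →
      ∀ a < n, wN q n a (kN q n i • y) ∈ N := fun i y hy a ha => by
    have h := N.smul_mem (kN q n i) (hy a ha)
    rw [kN_smul_wN] at h
    exact mem_of_smul_mem (by split_ifs <;> simp) h
  have hki : ∀ (i : ℕ) {y : M}, (∀ a < n, wN q n a y ∈ N) →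
      ∀ a < n, wN q n a (kiN q n i • y) ∈ N := fun i y hy a ha => by
    have h := N.smul_mem (kiN q n i) (hy a ha)
    rw [kiN_smul_wN] at h
    exact mem_of_smul_mem (by split_ifs <;> simp) h
  induction x using Uq.induction generalizing y with
  | h0 r =>
    intro a ha
    rw [algebraMap_smul, wN_smul]
    exact N.smul_of_tower_mem r (hy a ha)
  | hk i => rw [← kN_val]; exact hk i hy
  | hki i => rw [← kiN_val]; exact hki i hy
  | he j =>
    intro a ha
    have h := N.smul_mem (eN q n j) (hy a ha)
    rw [eN_smul_wN ha] at h
    rw [← eN_val]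
    refine mem_of_smul_mem (a := qpow q (epsR a j (j + 1))) (Units.ne_zero _) ?_
    refine (N.add_mem_iff_right ?_).1 h
    split_ifs with h1
    · exact hy j (by omega)
    · exact N.zero_mem
  | hf j =>
    intro a ha
    have h := N.smul_mem (fN q n j) (hy a ha)
    rw [fN_smul_wN] at h
    rw [← fN_val]
    refine (N.add_mem_iff_left ?_).1 h
    split_ifs with h1
    · exact hki j (hk (j + 1) hy) (j + 1) (by omega)
    · exact N.zero_mem
  | hmul x x' h h' => rw [mul_smul]; exact h (h' hy)
  | hadd x x' h h' =>
    intro a ha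
    rw [add_smul, map_add]
    exact N.add_mem (h hy a ha) (h' hy a ha)

/-- The filtration exhausts the module if `v` generates `M`. -/
theorem flag_eq_top {v : M} (hv : Submodule.span (Uq q n) {v} = ⊤) : flag q n v n = ⊤ := by
  have h1 : ∀ y : M, ∀ a < n, wN q n a y ∈ flag q n v n := fun y => by
    obtain ⟨x, rfl⟩ := Submodule.mem_span_singleton.1 (hv ▸ Submodule.mem_top : y ∈ _)
    exact wN_smul_mem x fun a ha => wN_mem_flag ha
  have h2 : (flag q n v n).mkQ.restrictScalars ℂ = 0 :=
    NatTensor.linearMap_ext fun i y => by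
      have := h1 y i i.2
      rw [wN_of_lt i.2] at this
      simpa using this
  rw [eq_top_iff]
  intro u _
  simpa using LinearMap.congr_fun h2 u

section Heads

/-! ### Eigenvectors of `𝒬` at the jumps of the filtration -/

variable {ζ : ℕ → ℂˣ} {v : M} {S : Finset ℕ}

variable (q) in
/-- The product of `X - x̂_l` over the elements `l < m` of the set `S`. -/
def headPoly (ζ : ℕ → ℂˣ) (S : Finset ℕ) (m : ℕ) : ℂ[X] :=
  ∏ l ∈ S with l < m, (X - C (xN q ζ l))

theorem eval_headPoly (m : ℕ) (x : ℂ) :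
    (headPoly q ζ S m).eval x = ∏ l ∈ S with l < m, (x - xN q ζ l) := by
  simp [headPoly, eval_prod]

/-- If the filtration can jump only at the elements of `S`, then `𝒬` satisfies the corresponding
polynomial equation. -/
theorem aeval_headPoly_eq_zero (hq₀ : (q : ℂ) + (q : ℂ)⁻¹ ≠ 0) (hq : (q : ℂ) - (q : ℂ)⁻¹ ≠ 0)
    (hv : IsHW q n ζ v) {m : ℕ} (hm : m ≤ n)
    (hS : ∀ l < m, l ∉ S → wN q n l v ∈ flag q n v l) {u : NatTensor q n M}
    (hu : u ∈ flag q n v m) : aeval (qOperator q n M) (headPoly q ζ S m) u = 0 := by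
  induction m generalizing u with
  | zero =>
    rw [flag_zero, Submodule.mem_bot] at hu
    rw [hu, map_zero]
  | succ m ih =>
    have ih := fun u hu => ih (by omega) (fun l hl => hS l (by omega)) (u := u) hu
    by_cases h : m ∈ S
    · have e : S.filter (· < m + 1) = insert m (S.filter (· < m)) := by
        ext l; simp only [Finset.mem_filter, Finset.mem_insert]
        constructor
        · rintro ⟨h1, h2⟩; by_cases h3 : l = m <;> [exact .inl h3; exact .inr ⟨h1, by omega⟩]
        · rintro (rfl | ⟨h1, h2⟩) <;> [exact ⟨h, by omega⟩; exact ⟨h1, by omega⟩]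
      rw [headPoly, e, Finset.prod_insert (by simp), mul_comm, aeval_X_sub_C_mul]
      exact ih _ (qOperator_sub_mem_flag hq₀ hq hv hm hu)
    · have e : S.filter (· < m + 1) = S.filter (· < m) := by
        refine Finset.filter_congr fun l hl => ?_
        have : l ≠ m := fun h' => h (h' ▸ hl)
        omega
      have h2 : flag q n v (m + 1) ≤ flag q n v m := flag_le fun i hi => by
        rcases (Nat.lt_succ_iff.1 hi).eq_or_lt with rfl | hi
        · exact hS i (by omega) h
        · exact wN_mem_flag hi
      rw [headPoly, e]
      exact ih _ (h2 hu)

variable (q n) in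
/-- The product of the operators `𝒬 - x̂_l`, `l ∈ S`, `l < m`, applied to `w_m ⊗ v`. -/
def headVec (ζ : ℕ → ℂˣ) (v : M) (S : Finset ℕ) (m : ℕ) : NatTensor q n M :=
  aeval (qOperator q n M) (headPoly q ζ S m) (wN q n m v)

/-- If the filtration can jump only at the elements of `S`, then `headVec` is an eigenvector of
`𝒬` or zero. -/
theorem qOperator_headVec (hq₀ : (q : ℂ) + (q : ℂ)⁻¹ ≠ 0) (hq : (q : ℂ) - (q : ℂ)⁻¹ ≠ 0)
    (hv : IsHW q n ζ v) {m : ℕ} (hm : m < n)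
    (hS : ∀ l < m, l ∉ S → wN q n l v ∈ flag q n v l) :
    qOperator q n M (headVec q n ζ v S m) = xN q ζ m • headVec q n ζ v S m := by
  rw [← sub_eq_zero, headVec, ← aeval_mul_X_sub_C, mul_comm, aeval_X_sub_C_mul]
  exact aeval_headPoly_eq_zero hq₀ hq hv hm.le hS (qOperator_wN_sub_mem hv hm)

/-- The operator `e_j` maps `w_m ⊗ v` into the preceding step of the filtration, which `headPoly`
annihilates. -/
theorem eN_smul_headVec (hq₀ : (q : ℂ) + (q : ℂ)⁻¹ ≠ 0) (hq : (q : ℂ) - (q : ℂ)⁻¹ ≠ 0)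
    (hv : IsHW q n ζ v) {m : ℕ} (hm : m < n)
    (hS : ∀ l < m, l ∉ S → wN q n l v ∈ flag q n v l) (j : ℕ) :
    eN q n j • headVec q n ζ v S m = 0 := by
  rw [headVec, ← aeval_qOperator_smul hq₀ hq, eN_smul_wN hm, hv.1, map_zero, smul_zero, add_zero]
  split_ifs with h
  · exact aeval_headPoly_eq_zero hq₀ hq hv hm.le hS (wN_mem_flag (by omega))
  · rw [map_zero]

theorem kN_smul_headVec (hq₀ : (q : ℂ) + (q : ℂ)⁻¹ ≠ 0) (hq : (q : ℂ) - (q : ℂ)⁻¹ ≠ 0)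
    (hv : IsHW q n ζ v) {m i : ℕ} (hi : i < n) :
    kN q n i • headVec q n ζ v S m =
      ((if m = i then (q : ℂ) else 1) * ζ i) • headVec q n ζ v S m := by
  rw [headVec, ← aeval_qOperator_smul hq₀ hq, kN_smul_wN, hv.2 i hi, wN_smul, smul_smul,
    LinearMap.map_smul]

/-- The vector `headVec` is a renormalization of `û_m`. -/
theorem exists_smul_headVec_eq_uN (hq₀ : (q : ℂ) + (q : ℂ)⁻¹ ≠ 0) (hq : (q : ℂ) - (q : ℂ)⁻¹ ≠ 0)
    (hv : IsHW q n ζ v) {m : ℕ} (hm : m < n)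
    (hS : ∀ l < m, l ∉ S → wN q n l v ∈ flag q n v l) :
    ∃ κ : ℂ, κ ≠ 0 ∧ (∏ l ∈ Finset.range m with l ∉ S, (xN q ζ m - xN q ζ l)) •
      headVec q n ζ v S m = κ • uN q n ζ v m 0 := by
  obtain ⟨κ, hκ, h⟩ := exists_aeval_prod_eq_uN hq₀ hq hv hm
  refine ⟨κ, hκ, ?_⟩
  have e : (Finset.range m).filter (· ∈ S) = S.filter (· < m) := by
    ext l; simp [and_comm]
  have hp : ∀ T : Finset ℕ, aeval (qOperator q n M) (∏ l ∈ T, (X - C (xN q ζ l)))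
      (headVec q n ζ v S m) = (∏ l ∈ T, (xN q ζ m - xN q ζ l)) • headVec q n ζ v S m := by
    intro T
    induction T using Finset.induction_on with
    | empty => simp
    | insert l T hl ih =>
      rw [Finset.prod_insert hl, Finset.prod_insert hl, aeval_mul_X_sub_C, ih, LinearMap.map_smul,
        qOperator_headVec hq₀ hq hv hm hS]
      module
  rw [← h, ← Finset.prod_filter_mul_prod_filter_not (Finset.range m) (· ∈ S), e, mul_comm, map_mul,
    Module.End.mul_apply]
  exact (hp _).symm

/-- If the numbers `x̂_l`, `l ∈ S`, are distinct, then the vectors `headVec` generate. -/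
theorem flag_le_span_headVec (hq₀ : (q : ℂ) + (q : ℂ)⁻¹ ≠ 0) (hq : (q : ℂ) - (q : ℂ)⁻¹ ≠ 0)
    (hv : IsHW q n ζ v) {m : ℕ} (hm : m ≤ n)
    (hS : ∀ l < m, l ∉ S → wN q n l v ∈ flag q n v l) (hx : Set.InjOn (xN q ζ) S) :
    flag q n v m ≤ Submodule.span (Uq q n) {u | ∃ l ∈ S, l < m ∧ u = headVec q n ζ v S l} := by
  induction m with
  | zero => rw [flag_zero]; exact bot_le
  | succ m ih =>
    have ih : flag q n v m ≤ Submodule.span (Uq q n)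
        {u | ∃ l ∈ S, l < m + 1 ∧ u = headVec q n ζ v S l} :=
      (ih (by omega) fun l hl => hS l (by omega)).trans (Submodule.span_mono (by
        rintro _ ⟨l, hl, hl', rfl⟩; exact ⟨l, hl, by omega, rfl⟩))
    refine flag_le fun i hi => ?_
    rcases (Nat.lt_succ_iff.1 hi).eq_or_lt with rfl | hi
    · by_cases h : i ∈ S
      · have h1 := ih (aeval_qOperator_sub_mem hq₀ hq hv hm (headPoly q ζ S i)
          (wN_mem_flag (v := v) i.lt_succ_self))
        have h3 : headVec q n ζ v S i ∈ Submodule.span (Uq q n)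
            {u | ∃ l ∈ S, l < i + 1 ∧ u = headVec q n ζ v S l} :=
          Submodule.subset_span ⟨i, h, i.lt_succ_self, rfl⟩
        have h2 := (Submodule.sub_mem_iff_right _ h3).1 h1
        refine mem_of_smul_mem ?_ h2
        rw [eval_headPoly]
        refine Finset.prod_ne_zero_iff.2 fun l hl h0 => ?_
        obtain ⟨hl, hl'⟩ := Finset.mem_filter.1 hl
        exact hl'.ne (hx hl h (sub_eq_zero.1 h0).symm)
      · exact ih (hS i (by omega) h)
    · exact ih (wN_mem_flag hi)

end Heads

end Action

/-! ### Linear functionals annihilating the image of the `f_j` -/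

section Functional

variable {q : ℂˣ} {n : ℕ} {M : Type*} [AddCommGroup M] [Module ℂ M]
  [Module (Uq q n) M] [IsScalarTower ℂ (Uq q n) M]

variable (q n) in
/-- The smallest subspace that contains `S` and is stable under all `f_j`. -/
inductive LowerClosure (S : Set M) : M → Prop
  | base {y : M} (h : y ∈ S) : LowerClosure S y
  | zero : LowerClosure S 0
  | add {y y' : M} (h : LowerClosure S y) (h' : LowerClosure S y') : LowerClosure S (y + y')
  | smul (a : ℂ) {y : M} (h : LowerClosure S y) : LowerClosure S (a • y)
  | lower {j : ℕ} (hj : j + 1 < n) {y : M} (h : LowerClosure S y) :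
      LowerClosure S (fN q n j • y)

theorem kiN_mul_fN (i j : ℕ) :
    kiN q n i * fN q n j = qpow q (epsR i j (j + 1)) • (fN q n j * kiN q n i) := by
  refine inv_commute (s := qpow q (-epsR i j (j + 1))) ?_ (kN_mul_kiN i) (kiN_mul_kN i) ?_
  · rw [mul_comm, qpow_mul_neg]
  · rw [fN_mul_kN, smul_smul, mul_comm, qpow_mul_neg, one_smul]

/-- The closure under the `f_j` of a set stable under the other generators is stable under the whole
algebra. -/
theorem LowerClosure.uq_smul (hq : (q : ℂ) - (q : ℂ)⁻¹ ≠ 0) {S : Set M}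
    (hk : ∀ i < n, ∀ y ∈ S, LowerClosure q n S (kN q n i • y))
    (hki : ∀ i < n, ∀ y ∈ S, LowerClosure q n S (kiN q n i • y))
    (he : ∀ j, j + 1 < n → ∀ y ∈ S, LowerClosure q n S (eN q n j • y)) (x : Uq q n) {y : M}
    (hy : LowerClosure q n S y) : LowerClosure q n S (x • y) := by
  have hk' : ∀ i < n, ∀ {y}, LowerClosure q n S y → LowerClosure q n S (kN q n i • y) := by
    intro i hi y hy
    induction hy with
    | base h => exact hk i hi _ h
    | zero => rw [smul_zero]; exact .zero
    | add _ _ h h' => rw [smul_add]; exact h.add h'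
    | smul a _ h => rw [smul_smul_comm']; exact h.smul a
    | @lower j hj y _ h =>
      have e : kN q n i * fN q n j = qpow q (-epsR i j (j + 1)) • (fN q n j * kN q n i) := by
        rw [fN_mul_kN, smul_smul, mul_comm, qpow_mul_neg, one_smul]
      rw [← mul_smul, e, smul_assoc, mul_smul]
      exact (h.lower hj).smul _
  have hki' : ∀ i < n, ∀ {y}, LowerClosure q n S y → LowerClosure q n S (kiN q n i • y) := by
    intro i hi y hy
    induction hy with
    | base h => exact hki i hi _ h
    | zero => rw [smul_zero]; exact .zero
    | add _ _ h h' => rw [smul_add]; exact h.add h'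
    | smul a _ h => rw [smul_smul_comm']; exact h.smul a
    | @lower j hj y _ h =>
      rw [← mul_smul, kiN_mul_fN, smul_assoc, mul_smul]
      exact (h.lower hj).smul _
  have he' : ∀ j, j + 1 < n → ∀ {y}, LowerClosure q n S y →
      LowerClosure q n S (eN q n j • y) := by
    intro i hi y hy
    induction hy with
    | base h => exact he i hi _ h
    | zero => rw [smul_zero]; exact .zero
    | add _ _ h h' => rw [smul_add]; exact h.add h'
    | smul a _ h => rw [smul_smul_comm']; exact h.smul a
    | @lower j hj y hy h =>
      by_cases hij : i = j
      · subst hij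
        have e : eN q n i * fN q n i = fN q n i * eN q n i +
            ((q : ℂ) - (q : ℂ)⁻¹)⁻¹ •
              (kN q n i * kiN q n (i + 1) - kiN q n i * kN q n (i + 1)) := by
          rw [← eN_mul_fN_self hj, smul_smul, inv_mul_cancel₀ hq, one_smul]; abel
        rw [← mul_smul, e, add_smul, mul_smul, smul_assoc, sub_smul, mul_smul, mul_smul,
          sub_eq_add_neg (kN q n i • _), ← neg_one_smul ℂ (kiN q n i • _)]
        exact (h.lower hj).add (((hk' i (by omega) (hki' _ hi hy)).add
          ((hki' i (by omega) (hk' _ hi hy)).smul _)).smul _)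
      · rw [← mul_smul, eN_mul_fN_of_ne hij, mul_smul]
        exact h.lower hj
  induction x using Uq.induction generalizing y with
  | h0 r => rw [algebraMap_smul]; exact hy.smul r
  | hk i => rw [← kN_val]; exact hk' i i.2 hy
  | hki i => rw [← kiN_val]; exact hki' i i.2 hy
  | he j => rw [← eN_val]; exact he' j (by omega) hy
  | hf j => rw [← fN_val]; exact hy.lower (by omega)
  | hmul x x' h h' => rw [mul_smul]; exact h (h' hy)
  | hadd x x' h h' => rw [add_smul]; exact (h hy).add (h' hy)

/-- The submodule generated by a highest weight vector is spanned by products of the `f_j` applied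
to it. -/
theorem LowerClosure.of_isHW (hq : (q : ℂ) - (q : ℂ)⁻¹ ≠ 0) {ζ : ℕ → ℂˣ} {v : M}
    (hv : IsHW q n ζ v) (x : Uq q n) : LowerClosure q n {v} (x • v) := by
  refine LowerClosure.uq_smul hq ?_ ?_ ?_ x (.base rfl)
  · rintro i hi _ rfl; rw [hv.2 i hi]; exact (LowerClosure.base (Set.mem_singleton _)).smul _
  · rintro i hi _ rfl; rw [hv.2.kiN hi]; exact (LowerClosure.base (Set.mem_singleton _)).smul _
  · rintro j - _ rfl; rw [hv.1]; exact .zero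

/-- A step of the filtration of `ℂ^n ⊗ M` is spanned by products of the `f_j` applied to its
generators `w_s ⊗ v`. -/
theorem LowerClosure.of_mem_flag (hq : (q : ℂ) - (q : ℂ)⁻¹ ≠ 0) {ζ : ℕ → ℂˣ} {v : M}
    (hv : IsHW q n ζ v) {m : ℕ} (hm : m ≤ n) {u : NatTensor q n M} (hu : u ∈ flag q n v m) :
    LowerClosure q n {u | ∃ s < m, u = wN q n s v} u := by
  induction hu using Submodule.span_induction with
  | mem u hu => exact .base hu
  | zero => exact .zero
  | add u u' _ _ h h' => exact h.add h'
  | smul x u _ h =>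
    have hb : ∀ s < m, LowerClosure q n {u | ∃ s < m, u = wN q n s v} (wN q n s v) :=
      fun s hs => .base ⟨s, hs, rfl⟩
    refine LowerClosure.uq_smul hq ?_ ?_ ?_ x h
    · rintro i hi _ ⟨s, hs, rfl⟩
      rw [kN_smul_wN, hv.2 i hi, wN_smul]
      exact ((hb s hs).smul _).smul _
    · rintro i hi _ ⟨s, hs, rfl⟩
      rw [kiN_smul_wN, hv.2.kiN hi, wN_smul]
      exact ((hb s hs).smul _).smul _
    · rintro j - _ ⟨s, hs, rfl⟩
      rw [eN_smul_wN (by omega), hv.1, map_zero, smul_zero, add_zero]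
      split_ifs with h
      · exact hb j (by omega)
      · exact .zero

/-- A functional that annihilates `w_s ⊗ v`, `s < m`, and the images of all `f_j` annihilates the
submodule generated by these vectors. -/
theorem eq_zero_of_mem_flag (hq : (q : ℂ) - (q : ℂ)⁻¹ ≠ 0) {ζ : ℕ → ℂˣ} {v : M}
    (hv : IsHW q n ζ v) {m : ℕ} (hm : m ≤ n) (φ : NatTensor q n M →ₗ[ℂ] ℂ)
    (hf : ∀ j, j + 1 < n → ∀ u, φ (fN q n j • u) = 0) (h0 : ∀ s < m, φ (wN q n s v) = 0)
    {u : NatTensor q n M} (hu : u ∈ flag q n v m) : φ u = 0 := by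
  replace hu := LowerClosure.of_mem_flag hq hv hm hu
  induction hu with
  | base h => obtain ⟨s, hs, rfl⟩ := h; exact h0 s hs
  | zero => exact map_zero φ
  | add _ _ h h' => rw [map_add, h, h', add_zero]
  | smul a _ h => rw [LinearMap.map_smul, h, smul_zero]
  | lower hj _ _ => exact hf _ hj _

variable (q n) in
/-- A linear map from `M` to column vectors that sends `v` to the `m`-th basis vector and transforms
`f_j` into the matrix unit `E_{j,j+1}`. -/
structure ColumnMap (v : M) (m : ℕ) where
  /-- The underlying linear map. -/
  map : M →ₗ[ℂ] (ℕ → ℂ)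
  map_vec : ∀ s, map v s = if s = m then 1 else 0
  map_lower : ∀ j, j + 1 < n → ∀ y s, map (fN q n j • y) s = if s = j then map y (s + 1) else 0

/-- A column map respects weights: its `s`-th coordinate is supported on the weight
`ζ - ε_s + ε_m`. -/
theorem ColumnMap.map_kN (hq : (q : ℂ) - (q : ℂ)⁻¹ ≠ 0) {ζ : ℕ → ℂˣ} {v : M}
    (hv : IsHW q n ζ v) (hgen : Submodule.span (Uq q n) {v} = ⊤) {m : ℕ} (Ψ : ColumnMap q n v m)
    {i : ℕ} (hi : i < n) (y : M) (s : ℕ) :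
    Ψ.map (kN q n i • y) s = (shiftWt q ζ s m i : ℂ) * Ψ.map y s := by
  obtain ⟨x, rfl⟩ := Submodule.mem_span_singleton.1 (hgen ▸ Submodule.mem_top : y ∈ _)
  have hy := LowerClosure.of_isHW hq hv x
  generalize x • v = y at hy
  induction hy generalizing s with
  | base h =>
    obtain rfl := h
    rw [hv.2 i hi, LinearMap.map_smul, Pi.smul_apply, Ψ.map_vec]
    split_ifs with hs
    · subst hs; simp [shiftWt, epsR]
    · simp
  | zero => simp
  | add _ _ h h' => rw [smul_add, map_add, map_add, Pi.add_apply, Pi.add_apply, h, h', mul_add]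
  | smul a _ h =>
    rw [smul_smul_comm', LinearMap.map_smul, LinearMap.map_smul, Pi.smul_apply, Pi.smul_apply, h,
      smul_eq_mul, smul_eq_mul, mul_left_comm]
  | @lower j hj y _ h =>
    have e : kN q n i * fN q n j = qpow q (-epsR i j (j + 1)) • (fN q n j * kN q n i) := by
      rw [fN_mul_kN, smul_smul, mul_comm, qpow_mul_neg, one_smul]
    rw [← mul_smul, e, smul_assoc, mul_smul, LinearMap.map_smul, Pi.smul_apply, Ψ.map_lower j hj,
      Ψ.map_lower j hj, h]
    split_ifs with hs
    · subst hs
      rw [smul_eq_mul, ← mul_assoc]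
      congr 1
      rw [shiftWt, shiftWt, qpow, ← Units.val_mul, mul_left_comm, ← zpow_add]
      congr 3
      simp only [epsR]; ring
    · simp

/-- A functional on `ℂ^n ⊗ M` is given by `n` functionals on `M`. -/
theorem exists_functional_of_components (ψ : ℕ → M →ₗ[ℂ] ℂ) :
    ∃ φ : NatTensor q n M →ₗ[ℂ] ℂ, ∀ s < n, ∀ y, φ (wN q n s y) = ψ s y := by
  refine ⟨TensorProduct.lift (∑ s : Fin n, (LinearMap.proj s).smulRight (ψ s)), fun s hs y => ?_⟩
  rw [wN_of_lt hs, wTensor]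
  refine (TensorProduct.lift.tmul _ _).trans ?_
  rw [LinearMap.sum_apply, LinearMap.sum_apply, Finset.sum_eq_single ⟨s, hs⟩]
  · simp
  · intro b _ hb
    simp [hb]
  · intro h; exact absurd (Finset.mem_univ _) h

/-- A column map on `M` gives a functional on `ℂ^n ⊗ M` that is an eigenvector of the transpose of
`𝒬` with eigenvalue `x̂_m`. -/
theorem ColumnMap.exists_functional (hq₀ : (q : ℂ) + (q : ℂ)⁻¹ ≠ 0)
    (hq : (q : ℂ) - (q : ℂ)⁻¹ ≠ 0) {ζ : ℕ → ℂˣ} {v : M}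
    (hv : IsHW q n ζ v) (hgen : Submodule.span (Uq q n) {v} = ⊤) {m : ℕ} (hm : m < n)
    (Ψ : ColumnMap q n v m) :
    ∃ φ : NatTensor q n M →ₗ[ℂ] ℂ, φ (wN q n m v) = 1 ∧ (∀ u ∈ flag q n v m, φ u = 0) ∧
      ∀ u, φ (qOperator q n M u) = xN q ζ m * φ u := by
  set c : ℕ → ℂ := fun a => -((shiftWt q ζ (a + 1) m (a + 1) : ℂ) / shiftWt q ζ (a + 1) m a) with hc
  have hc0 : ∀ a, c a ≠ 0 := fun a => by simp [hc]
  -- the coordinates are rescaled so that the functional annihilates the images of all `f_j`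
  set γ : ℕ → ℂ := fun s => (∏ a ∈ Finset.range m, c a) / ∏ a ∈ Finset.range s, c a with hγ
  have hγ' : ∀ s, γ s = γ (s + 1) * c s := fun s => by
    rw [hγ]
    simp only [Finset.prod_range_succ]
    field_simp [hc0 s]
  have hγm : γ m = 1 := div_self (Finset.prod_ne_zero_iff.2 fun a _ => hc0 a)
  obtain ⟨φ, hφ⟩ := exists_functional_of_components (q := q) (n := n)
    (fun s => γ s • (LinearMap.proj s).comp Ψ.map)
  replace hφ : ∀ s < n, ∀ y, φ (wN q n s y) = γ s * Ψ.map y s := fun s hs y => by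
    rw [hφ s hs]; rfl
  have hki : ∀ {i : ℕ} (_ : i < n) (y : M) (s : ℕ),
      Ψ.map (kiN q n i • y) s = (shiftWt q ζ s m i : ℂ)⁻¹ * Ψ.map y s := fun {i} hi y s => by
    have h := Ψ.map_kN hq hv hgen hi (kiN q n i • y) s
    rw [← mul_smul, kN_mul_kiN, one_smul] at h
    rw [h, ← mul_assoc, inv_mul_cancel₀ (Units.ne_zero _), one_mul]
  have hf : ∀ j, j + 1 < n → ∀ u, φ (fN q n j • u) = 0 := by
    intro j hj u
    have : φ.comp ((Algebra.lsmul ℂ ℂ (NatTensor q n M)) (fN q n j)) = 0 := by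
      refine NatTensor.linearMap_ext fun i y => ?_
      rw [← wN_val]
      change φ (fN q n j • wN q n i y) = 0
      rw [fN_smul_wN, map_add, hφ i i.2, Ψ.map_lower j hj]
      split_ifs with h
      · rw [hφ _ hj, hki (by omega), Ψ.map_kN hq hv hgen hj, h, hγ' j, hc]
        field_simp
        ring
      · simp
    exact LinearMap.congr_fun this u
  have hk : ∀ u, φ (kN q n m • u) = ζ m * q * φ u := by
    intro u
    have : φ.comp ((Algebra.lsmul ℂ ℂ (NatTensor q n M)) (kN q n m)) = ((ζ m : ℂ) * q) • φ := by
      refine NatTensor.linearMap_ext fun i y => ?_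
      rw [← wN_val]
      change φ (kN q n m • wN q n i y) = ((ζ m : ℂ) * q) • φ (wN q n i y)
      rw [kN_smul_wN, LinearMap.map_smul, hφ i i.2, hφ i i.2, Ψ.map_kN hq hv hgen hm, shiftWt]
      rcases eq_or_ne (i : ℕ) m with h | h
      · rw [if_pos h, h]
        simp [epsR]
        ring
      · rw [if_neg h, epsR_right rfl h.symm]
        simp
        ring
    exact LinearMap.congr_fun this u
  have hw : ∀ s < n, φ (wN q n s v) = if s = m then 1 else 0 := fun s hs => by
    rw [hφ s hs, Ψ.map_vec]
    split_ifs with h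
    · rw [h, hγm, mul_one]
    · rw [mul_zero]
  have hflag : ∀ u ∈ flag q n v m, φ u = 0 := fun u hu =>
    eq_zero_of_mem_flag hq hv hm.le φ hf (fun s hs => by
      rw [hw s (by omega), if_neg (by omega)]) hu
  refine ⟨φ, by rw [hw m hm, if_pos rfl], hflag, fun u => ?_⟩
  have h := eq_zero_of_mem_flag hq hv le_rfl (φ.comp (qOperator q n M) - xN q ζ m • φ)
    (fun j hj u => by simp [qOperator_smul hq₀ hq, hf j hj]) (fun s hs => ?_)
    (u := u) (by rw [flag_eq_top hgen]; trivial)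
  · rw [LinearMap.sub_apply, sub_eq_zero] at h
    exact h
  · rw [LinearMap.sub_apply, sub_eq_zero, LinearMap.comp_apply, LinearMap.smul_apply, hw s hs]
    rcases eq_or_ne s m with rfl | h
    · have := hflag _ (qOperator_wN_sub_mem hv hs)
      rw [map_sub, LinearMap.map_smul, sub_eq_zero] at this
      rw [this, hw s hs]
    · -- both sides vanish since `w_s ⊗ v` and the functional have different weights
      have h1 := hk (qOperator q n M (wN q n s v))
      rw [← qOperator_smul hq₀ hq, kN_smul_wN, if_neg h, one_smul, hv.2 m hm, wN_smul,
        LinearMap.map_smul, LinearMap.map_smul, smul_eq_mul] at h1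
      have h2 : (ζ m : ℂ) * ((q : ℂ) - 1) * φ (qOperator q n M (wN q n s v)) = 0 := by
        linear_combination -h1
      have h3 : (q : ℂ) - 1 ≠ 0 := fun h0 => hq (by rw [sub_eq_zero.1 h0]; simp)
      rw [if_neg h, smul_zero]
      simpa [h3] using h2

end Functional

/-! ### The Verma module realized on words in the `f_j` -/

section WordModel

theorem commute_sub_of_bracket {R : Type*} [Ring R] {a b e h h' : R} (ha : e * a = a * e + h)
    (hb : e * b = b * e + h') (hc : h * b = b * h) (hc' : h' * a = a * h') :
    Commute e (a * b - b * a) := by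
  have h1 : e * (a * b) = a * b * e + a * h' + h * b := by
    rw [← mul_assoc, ha, add_mul, mul_assoc, hb]; noncomm_ring
  have h2 : e * (b * a) = b * a * e + b * h + h' * a := by
    rw [← mul_assoc, hb, add_mul, mul_assoc, ha]; noncomm_ring
  rw [commute_iff_eq, mul_sub, h1, h2, hc, hc']
  noncomm_ring

/-- An element whose commutators with `a` and `b` are Cartan elements commutes with the Serre
polynomial of `a` and `b`. -/
theorem commute_serre_of_bracket {R : Type*} [Ring R] [Algebra ℂ R] {s c d : ℂ} (hs : s ≠ 0)
    {a b e K K' L L' : R} (ha : e * a = a * e + c • (K - K')) (hb : e * b = b * e + d • (L - L'))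
    (hKa : K * a = (s⁻¹ * s⁻¹) • (a * K)) (hKa' : K' * a = (s * s) • (a * K'))
    (hKb : K * b = s • (b * K)) (hKb' : K' * b = s⁻¹ • (b * K'))
    (hLa : L * a = s • (a * L)) (hLa' : L' * a = s⁻¹ • (a * L')) :
    Commute e (a * a * b - (s + s⁻¹) • (a * b * a) + b * a * a) := by
  have e1 : e * (a * a * b) = a * a * b * e + (c * (s + s⁻¹)) • (a * b * K - a * b * K') +
      d • (a * a * L - a * a * L') := by
    have : e * (a * a * b) = a * a * b * e + a * a * (d • (L - L')) + a * (c • (K - K')) * b +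
        c • (K - K') * a * b := by
      calc e * (a * a * b) = e * a * a * b := by simp only [mul_assoc]
        _ = a * (e * a) * b + c • (K - K') * a * b := by
          rw [ha, add_mul, add_mul]; simp only [mul_assoc, ha]
        _ = a * a * (e * b) + a * (c • (K - K')) * b + c • (K - K') * a * b := by
          rw [ha]; noncomm_ring
        _ = _ := by rw [hb]; noncomm_ring
    rw [this]
    simp only [smul_mul_assoc, mul_smul_comm, mul_sub, sub_mul, mul_assoc]
    simp only [← mul_assoc K, ← mul_assoc K', hKa, hKa', smul_mul_assoc, mul_assoc, hKb, hKb',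
      mul_smul_comm, smul_smul]
    match_scalars <;> field_simp
    ring
  have e2 : e * (a * b * a) = a * b * a * e + c • (a * b * K - a * b * K') +
      c • (s⁻¹ • (b * a * K) - s • (b * a * K')) + d • (s • (a * a * L) - s⁻¹ • (a * a * L')) := by
    have : e * (a * b * a) = a * b * a * e + a * b * (c • (K - K')) + a * (d • (L - L')) * a +
        c • (K - K') * b * a := by
      calc e * (a * b * a) = e * a * b * a := by simp only [mul_assoc]
        _ = a * (e * b) * a + c • (K - K') * b * a := by rw [ha]; noncomm_ring
        _ = a * b * (e * a) + a * (d • (L - L')) * a + c • (K - K') * b * a := by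
          rw [hb]; noncomm_ring
        _ = _ := by rw [ha]; noncomm_ring
    rw [this]
    simp only [smul_mul_assoc, mul_smul_comm, mul_sub, sub_mul, mul_assoc]
    simp only [← mul_assoc K, ← mul_assoc K', hKb, hKb', smul_mul_assoc, mul_assoc, hKa, hKa',
      hLa, hLa', mul_smul_comm, smul_smul]
    match_scalars <;> field_simp
  have e3 : e * (b * a * a) = b * a * a * e + (c * (1 + s⁻¹ * s⁻¹)) • (b * a * K) -
      (c * (1 + s * s)) • (b * a * K') +
      d • ((s * s) • (a * a * L) - (s⁻¹ * s⁻¹) • (a * a * L')) := by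
    have : e * (b * a * a) = b * a * a * e + b * a * (c • (K - K')) + b * (c • (K - K')) * a +
        d • (L - L') * a * a := by
      calc e * (b * a * a) = e * b * a * a := by simp only [mul_assoc]
        _ = b * (e * a) * a + d • (L - L') * a * a := by rw [hb]; noncomm_ring
        _ = b * a * (e * a) + b * (c • (K - K')) * a + d • (L - L') * a * a := by
          rw [ha, mul_add, add_mul]; simp only [mul_assoc, ha]
        _ = _ := by rw [ha, mul_add]; simp only [mul_assoc]
    rw [this]
    simp only [smul_mul_assoc, mul_smul_comm, mul_sub, sub_mul, mul_assoc]
    simp only [← mul_assoc L, ← mul_assoc L', hLa, hLa', smul_mul_assoc, mul_assoc, hKa, hKa',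
      mul_smul_comm, smul_smul]
    match_scalars <;> field_simp
    ring
  rw [commute_iff_eq, mul_add, mul_sub, mul_smul_comm, e1, e2, e3, add_mul, sub_mul,
    smul_mul_assoc]
  match_scalars <;> field_simp <;> ring

variable (q : ℂˣ) {n : ℕ} (z : Fin n → ℂˣ)

/-- The vector space with basis the words in the indices of the simple roots. The word `j₁ ... j_l`
stands for `f_{j₁} ... f_{j_l} v_μ`. -/
abbrev Words (n : ℕ) : Type := List (Fin (n - 1)) →₀ ℂ

theorem Words.ext {f g : Module.End ℂ (Words n)}
    (h : ∀ w, f (Finsupp.single w 1) = g (Finsupp.single w 1)) : f = g :=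
  Finsupp.lhom_ext' fun w => LinearMap.ext_ring (h w)

/-- The operator with prescribed values on words. -/
def wordOp (g : List (Fin (n - 1)) → Words n) : Module.End ℂ (Words n) :=
  Finsupp.linearCombination ℂ g

theorem wordOp_single (g : List (Fin (n - 1)) → Words n) (w : List (Fin (n - 1))) :
    wordOp g (Finsupp.single w 1) = g w := by simp [wordOp]

/-- The operator that multiplies words by scalars. -/
def wordDiag (c : List (Fin (n - 1)) → ℂ) : Module.End ℂ (Words n) :=
  wordOp fun w => c w • Finsupp.single w 1

theorem wordDiag_single (c : List (Fin (n - 1)) → ℂ) (w : List (Fin (n - 1))) :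
    wordDiag c (Finsupp.single w 1) = c w • Finsupp.single w 1 := wordOp_single _ _

theorem wordDiag_mul (c c' : List (Fin (n - 1)) → ℂ) :
    wordDiag c * wordDiag c' = wordDiag fun w => c w * c' w :=
  Words.ext fun w => by
    rw [Module.End.mul_apply, wordDiag_single, map_smul, wordDiag_single, wordDiag_single,
      smul_smul, mul_comm]

theorem wordDiag_eq_one {c : List (Fin (n - 1)) → ℂ} (h : ∀ w, c w = 1) : wordDiag c = 1 :=
  Words.ext fun w => by rw [wordDiag_single, h, one_smul, Module.End.one_apply]

/-- The operator `f_j`: it prepends the letter `j`. -/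
def wordF (j : Fin (n - 1)) : Module.End ℂ (Words n) := wordOp fun w => Finsupp.single (j :: w) 1

theorem wordF_single (j : Fin (n - 1)) (w : List (Fin (n - 1))) :
    wordF j (Finsupp.single w 1) = Finsupp.single (j :: w) 1 := wordOp_single _ _

theorem wordDiag_mul_wordF {c : List (Fin (n - 1)) → ℂ} {a : ℂ} {j : Fin (n - 1)}
    (h : ∀ w, c (j :: w) = a * c w) : wordDiag c * wordF j = a • (wordF j * wordDiag c) :=
  Words.ext fun w => by
    rw [Module.End.mul_apply, wordF_single, wordDiag_single, LinearMap.smul_apply,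
      Module.End.mul_apply, wordDiag_single, map_smul, wordF_single, h, mul_smul]

/-- An operator that commutes with all `f_j` and annihilates the empty word is zero. -/
theorem eq_zero_of_commute_wordF {T : Module.End ℂ (Words n)} (h : ∀ k, Commute T (wordF k))
    (h0 : T (Finsupp.single [] 1) = 0) : T = 0 :=
  Words.ext fun w => by
    induction w with
    | nil => exact h0
    | cons k w ih =>
      rw [← wordF_single, ← Module.End.mul_apply, (h k).eq, Module.End.mul_apply, ih]
      simp

/-- The weight of a word applied to a vector of weight `z`. -/
def wordWt : List (Fin (n - 1)) → Fin n → ℂˣ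
  | [] => z
  | j :: w => fun i => wordWt w i * q ^ (-epsRoot i j)

/-- The operator `q^{h_{ε_i}}` on words. -/
def wordK (i : Fin n) : Module.End ℂ (Words n) := wordDiag fun w => (wordWt q z w i : ℂ)

/-- The operator `q^{-h_{ε_i}}` on words. -/
def wordKinv (i : Fin n) : Module.End ℂ (Words n) := wordDiag fun w => (wordWt q z w i : ℂ)⁻¹

/-- The operator `q^{h_{α_j}}` on words. -/
def wordKRoot (j : Fin (n - 1)) : Module.End ℂ (Words n) := wordK q z (lo j) * wordKinv q z (hi j)

/-- The operator `q^{-h_{α_j}}` on words. -/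
def wordKRootInv (j : Fin (n - 1)) : Module.End ℂ (Words n) :=
  wordKinv q z (lo j) * wordK q z (hi j)

/-- The value of `e_j` on words, computed by moving it to the right by means of the commutators
`[e_j, f_i]`. -/
def wordRaise (j : Fin (n - 1)) : List (Fin (n - 1)) → Words n
  | [] => 0
  | i :: w => wordF i (wordRaise j w) +
      if i = j then ((q : ℂ) - (q : ℂ)⁻¹)⁻¹ •
        (wordKRoot q z j - wordKRootInv q z j) (Finsupp.single w 1) else 0

/-- The operator `e_j` on words. -/
def wordE (j : Fin (n - 1)) : Module.End ℂ (Words n) := wordOp (wordRaise q z j)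

theorem wordE_nil (j : Fin (n - 1)) : wordE q z j (Finsupp.single [] 1) = 0 := wordOp_single _ _

theorem wordE_mul_wordF (i j : Fin (n - 1)) : wordE q z i * wordF j = wordF j * wordE q z i +
    (if j = i then ((q : ℂ) - (q : ℂ)⁻¹)⁻¹ else 0) • (wordKRoot q z i - wordKRootInv q z i) :=
  Words.ext fun w => by
    rw [Module.End.mul_apply, wordF_single, wordE, wordOp_single, wordRaise, LinearMap.add_apply,
      Module.End.mul_apply, wordOp_single]
    split_ifs
    · rfl
    · rw [zero_smul, LinearMap.zero_apply]

theorem wordK_mul_wordKinv (i : Fin n) : wordK q z i * wordKinv q z i = 1 := by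
  rw [wordK, wordKinv, wordDiag_mul]
  exact wordDiag_eq_one fun w => mul_inv_cancel₀ (Units.ne_zero _)

theorem wordKinv_mul_wordK (i : Fin n) : wordKinv q z i * wordK q z i = 1 := by
  rw [wordK, wordKinv, wordDiag_mul]
  exact wordDiag_eq_one fun w => inv_mul_cancel₀ (Units.ne_zero _)

theorem wordDiag_comm (c c' : List (Fin (n - 1)) → ℂ) : Commute (wordDiag c) (wordDiag c') := by
  rw [commute_iff_eq, wordDiag_mul, wordDiag_mul]
  simp only [mul_comm]

theorem wordK_comm (i j : Fin n) : Commute (wordK q z i) (wordK q z j) := wordDiag_comm _ _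

theorem wordK_mul_wordF (i : Fin n) (j : Fin (n - 1)) :
    wordK q z i * wordF j = qpow q (-epsRoot i j) • (wordF j * wordK q z i) :=
  wordDiag_mul_wordF fun w => by rw [wordWt, Units.val_mul, mul_comm]; rfl

theorem wordKinv_mul_wordF (i : Fin n) (j : Fin (n - 1)) :
    wordKinv q z i * wordF j = qpow q (epsRoot i j) • (wordF j * wordKinv q z i) :=
  inv_commute (A := Module.End ℂ (Words n)) (by rw [mul_comm]; exact qpow_mul_neg q (epsRoot i j))
    (wordK_mul_wordKinv q z i) (wordKinv_mul_wordK q z i) (wordK_mul_wordF q z i j)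

theorem wordK_commute_root (i : Fin n) (j : Fin (n - 1)) :
    Commute (wordK q z i) (wordKRoot q z j - wordKRootInv q z j) :=
  Commute.sub_right (R := Module.End ℂ (Words n))
    ((wordDiag_comm _ _).mul_right (wordDiag_comm _ _))
    ((wordDiag_comm _ _).mul_right (wordDiag_comm _ _))

theorem wordK_mul_wordE (i : Fin n) (j : Fin (n - 1)) :
    wordK q z i * wordE q z j = qpow q (epsRoot i j) • (wordE q z j * wordK q z i) :=
  Words.ext fun w => by
    induction w with
    | nil =>
      rw [Module.End.mul_apply, wordE_nil, map_zero, LinearMap.smul_apply, Module.End.mul_apply,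
        wordK, wordDiag_single, map_smul, wordE_nil, smul_zero, smul_zero]
    | cons k w ih =>
      have h1 : wordK q z i * wordE q z j * wordF k =
          qpow q (-epsRoot i k) • (wordF k * (wordK q z i * wordE q z j)) +
            (if k = j then ((q : ℂ) - (q : ℂ)⁻¹)⁻¹ else 0) •
              ((wordKRoot q z j - wordKRootInv q z j) * wordK q z i) := by
        rw [mul_assoc, wordE_mul_wordF, mul_add, ← mul_assoc, wordK_mul_wordF, smul_mul_assoc,
          mul_smul_comm, (wordK_commute_root q z i j).eq, mul_assoc]
      have h2 : qpow q (epsRoot i j) • (wordE q z j * wordK q z i * wordF k) =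
          qpow q (-epsRoot i k) •
            (wordF k * (qpow q (epsRoot i j) • (wordE q z j * wordK q z i))) +
            (if k = j then ((q : ℂ) - (q : ℂ)⁻¹)⁻¹ else 0) •
              ((wordKRoot q z j - wordKRootInv q z j) * wordK q z i) := by
        rw [mul_assoc, wordK_mul_wordF, mul_smul_comm, ← mul_assoc, wordE_mul_wordF, add_mul,
          smul_mul_assoc, mul_smul_comm, smul_add, smul_add, mul_assoc]
        split_ifs with h
        · subst h
          rw [smul_smul, smul_smul, smul_smul, smul_smul, ← mul_assoc, qpow_mul_neg, one_mul,
            mul_comm (qpow q (-epsRoot i k)), qpow_mul_neg, mul_assoc]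
        · simp only [zero_smul, smul_zero, add_zero]
          rw [smul_comm]
      rw [← wordF_single, ← Module.End.mul_apply, h1, ← Module.End.mul_apply, smul_mul_assoc, h2,
        LinearMap.add_apply, LinearMap.add_apply, LinearMap.smul_apply _ (wordF k * _),
        LinearMap.smul_apply _ (wordF k * _), Module.End.mul_apply (wordF k),
        Module.End.mul_apply (wordF k), ih]

theorem wordKinv_mul_wordE (i : Fin n) (j : Fin (n - 1)) :
    wordKinv q z i * wordE q z j = qpow q (-epsRoot i j) • (wordE q z j * wordKinv q z i) :=
  inv_commute (A := Module.End ℂ (Words n)) (qpow_mul_neg q _) (wordK_mul_wordKinv q z i)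
    (wordKinv_mul_wordK q z i) (wordK_mul_wordE q z i j)

theorem mul_commute_smul {R : Type*} [Ring R] [Algebra ℂ R] {a b x : R} {s t : ℂ}
    (ha : a * x = s • (x * a)) (hb : b * x = t • (x * b)) :
    a * b * x = (s * t) • (x * (a * b)) := by
  rw [mul_assoc, hb, mul_smul_comm, ← mul_assoc, ha, smul_mul_assoc, smul_smul, mul_assoc,
    mul_comm s]

theorem wordKRoot_mul_wordF (i j : Fin (n - 1)) :
    wordKRoot q z i * wordF j = qpow q (-rootRoot i j) • (wordF j * wordKRoot q z i) := by
  rw [wordKRoot, mul_commute_smul (R := Module.End ℂ (Words n))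
    (wordK_mul_wordF q z _ j) (wordKinv_mul_wordF q z _ j),
    ← qpow_add, rootRoot]
  congr 2; ring

theorem wordKRootInv_mul_wordF (i j : Fin (n - 1)) :
    wordKRootInv q z i * wordF j = qpow q (rootRoot i j) • (wordF j * wordKRootInv q z i) := by
  rw [wordKRootInv, mul_commute_smul (R := Module.End ℂ (Words n))
    (wordKinv_mul_wordF q z _ j) (wordK_mul_wordF q z _ j),
    ← qpow_add, rootRoot]
  congr 2

theorem wordKRoot_mul_wordE (i j : Fin (n - 1)) :
    wordKRoot q z i * wordE q z j = qpow q (rootRoot i j) • (wordE q z j * wordKRoot q z i) := by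
  rw [wordKRoot, mul_commute_smul (R := Module.End ℂ (Words n))
    (wordK_mul_wordE q z _ j) (wordKinv_mul_wordE q z _ j),
    ← qpow_add, rootRoot]
  congr 2

theorem wordKRootInv_mul_wordE (i j : Fin (n - 1)) :
    wordKRootInv q z i * wordE q z j =
      qpow q (-rootRoot i j) • (wordE q z j * wordKRootInv q z i) := by
  rw [wordKRootInv, mul_commute_smul (R := Module.End ℂ (Words n))
    (wordKinv_mul_wordE q z _ j) (wordK_mul_wordE q z _ j),
    ← qpow_add, rootRoot]
  congr 2; ring

theorem wordKRoot_commute_wordF {i j : Fin (n - 1)} (h : rootRoot i j = 0) (c : ℂ) :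
    Commute (c • (wordKRoot q z i - wordKRootInv q z i)) (wordF j) := by
  have h1 : Commute (wordKRoot q z i) (wordF j) := by
    rw [commute_iff_eq, wordKRoot_mul_wordF, h, neg_zero, qpow_zero, one_smul]
  have h2 : Commute (wordKRootInv q z i) (wordF j) := by
    rw [commute_iff_eq, wordKRootInv_mul_wordF, h, qpow_zero, one_smul]
  exact Commute.smul_left (Commute.sub_left (R := Module.End ℂ (Words n)) h1 h2) c

theorem wordKRoot_commute_wordE {i j : Fin (n - 1)} (h : rootRoot i j = 0) (c : ℂ) :
    Commute (c • (wordKRoot q z i - wordKRootInv q z i)) (wordE q z j) := by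
  have h1 : Commute (wordKRoot q z i) (wordE q z j) := by
    rw [commute_iff_eq, wordKRoot_mul_wordE, h, qpow_zero, one_smul]
  have h2 : Commute (wordKRootInv q z i) (wordE q z j) := by
    rw [commute_iff_eq, wordKRootInv_mul_wordE, h, neg_zero, qpow_zero, one_smul]
  exact Commute.smul_left (Commute.sub_left (R := Module.End ℂ (Words n)) h1 h2) c

theorem bracket_swap {R : Type*} [Ring R] [Algebra ℂ R] {a b K K' : R} {c : ℂ}
    (h : a * b = b * a + c • (K - K')) : b * a = a * b + c • (K' - K) := by
  rw [h]; module

theorem smul_sub_rev {R : Type*} [Ring R] [Algebra ℂ R] (c : ℂ) (K K' : R) :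
    c • (K - K') = (-c) • (K' - K) := by module

theorem wordF_mul_wordE (i j : Fin (n - 1)) : wordF i * wordE q z j = wordE q z j * wordF i +
    (if i = j then ((q : ℂ) - (q : ℂ)⁻¹)⁻¹ else 0) • (wordKRootInv q z j - wordKRoot q z j) :=
  bracket_swap (R := Module.End ℂ (Words n)) (wordE_mul_wordF q z j i)

theorem wordE_commute_comm {i j : Fin (n - 1)} (h : rootRoot i j = 0) (k : Fin (n - 1)) :
    Commute (wordE q z k) (wordF i * wordF j - wordF j * wordF i) := by
  refine commute_sub_of_bracket (R := Module.End ℂ (Words n)) (wordE_mul_wordF q z k i)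
    (wordE_mul_wordF q z k j) ?_ ?_
  · split_ifs with hk
    · exact hk ▸ (wordKRoot_commute_wordF q z h _).eq
    · rw [zero_smul, zero_mul, mul_zero]
  · split_ifs with hk
    · exact hk ▸ (wordKRoot_commute_wordF q z ((rootRoot_comm j i).trans h) _).eq
    · rw [zero_smul, zero_mul, mul_zero]

theorem wordF_commute_comm {i j : Fin (n - 1)} (h : rootRoot i j = 0) (k : Fin (n - 1)) :
    Commute (wordF k) (wordE q z i * wordE q z j - wordE q z j * wordE q z i) := by
  have hneg : ∀ i : Fin (n - 1), ∀ c : ℂ, c • (wordKRootInv q z i - wordKRoot q z i) =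
      (-c) • (wordKRoot q z i - wordKRootInv q z i) := fun i c =>
    smul_sub_rev (R := Module.End ℂ (Words n)) c _ _
  refine commute_sub_of_bracket (R := Module.End ℂ (Words n)) (wordF_mul_wordE q z k i)
    (wordF_mul_wordE q z k j) ?_ ?_
  · rw [hneg]; exact (wordKRoot_commute_wordE q z h _).eq
  · rw [hneg]; exact (wordKRoot_commute_wordE q z ((rootRoot_comm j i).trans h) _).eq

theorem qpow_neg_two : qpow q (-2) = (q : ℂ)⁻¹ * (q : ℂ)⁻¹ := by
  rw [show (-2 : ℤ) = -1 + -1 by norm_num, qpow_add, qpow_neg_one]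

/-- The polynomial `a² b - (q + q⁻¹) a b a + b a²` of the quantum Serre relations. -/
def serrePoly {R : Type*} [Ring R] [Algebra ℂ R] (a b : R) : R :=
  a * a * b - ((q : ℂ) + (q : ℂ)⁻¹) • (a * b * a) + b * a * a

theorem mul_mul_smul {R : Type*} [Ring R] [Algebra ℂ R] {D a b : R} {x y : ℂ}
    (ha : D * a = x • (a * D)) (hb : D * b = y • (b * D)) :
    D * (a * b) = (x * y) • (a * b * D) := by
  rw [← mul_assoc, ha, smul_mul_assoc, mul_assoc, hb, mul_smul_comm, smul_smul, mul_assoc]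

theorem mul_comm_sub {R : Type*} [Ring R] [Algebra ℂ R] {D a b : R} {x y : ℂ}
    (ha : D * a = x • (a * D)) (hb : D * b = y • (b * D)) :
    D * (a * b - b * a) = (x * y) • ((a * b - b * a) * D) := by
  rw [mul_sub, mul_mul_smul ha hb, mul_mul_smul hb ha, sub_mul, mul_comm y, smul_sub]

theorem mul_serrePoly {R : Type*} [Ring R] [Algebra ℂ R] {D a b : R} {x y : ℂ}
    (ha : D * a = x • (a * D)) (hb : D * b = y • (b * D)) :
    D * serrePoly q a b = (x * x * y) • (serrePoly q a b * D) := by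
  rw [serrePoly, mul_add, mul_sub, mul_smul_comm, mul_mul_smul (mul_mul_smul ha ha) hb,
    mul_mul_smul (mul_mul_smul ha hb) ha, mul_mul_smul (mul_mul_smul hb ha) ha, add_mul, sub_mul,
    smul_mul_assoc]
  match_scalars <;> ring

theorem smul_bracket {R : Type*} [Ring R] [Algebra ℂ R] {a b K : R} {c : ℂ} (hc : c ≠ 0)
    (h : a * b = b * a + c⁻¹ • K) : c • (a * b - b * a) = K := by
  rw [h, add_sub_cancel_left, smul_smul, mul_inv_cancel₀ hc, one_smul]

theorem wordE_commute_serre {i j : Fin (n - 1)} (h : rootRoot i j = -1) (k : Fin (n - 1)) :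
    Commute (wordE q z k) (serrePoly q (wordF i) (wordF j)) := by
  have h' : rootRoot j i = -1 := (rootRoot_comm j i).trans h
  have e : ∀ l, wordE q z k * wordF l = wordF l * wordE q z k +
    (if l = k then ((q : ℂ) - (q : ℂ)⁻¹)⁻¹ else 0) • (wordKRoot q z l - wordKRootInv q z l) := by
    intro l
    rw [wordE_mul_wordF]
    split_ifs with hl
    · rw [hl]
    · rw [zero_smul, zero_smul]
  refine commute_serre_of_bracket (R := Module.End ℂ (Words n)) q.ne_zero (e i) (e j) ?_ ?_ ?_ ?_
    ?_ ?_
  · rw [wordKRoot_mul_wordF, rootRoot_self, qpow_neg_two]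
  · rw [wordKRootInv_mul_wordF, rootRoot_self, qpow_two]
  · rw [wordKRoot_mul_wordF, h, neg_neg, qpow_one]
  · rw [wordKRootInv_mul_wordF, h, qpow_neg_one]
  · rw [wordKRoot_mul_wordF, h', neg_neg, qpow_one]
  · rw [wordKRootInv_mul_wordF, h', qpow_neg_one]

theorem wordF_commute_serre {i j : Fin (n - 1)} (h : rootRoot i j = -1) (k : Fin (n - 1)) :
    Commute (wordF k) (serrePoly q (wordE q z i) (wordE q z j)) := by
  have h' : rootRoot j i = -1 := (rootRoot_comm j i).trans h
  refine commute_serre_of_bracket (R := Module.End ℂ (Words n)) q.ne_zero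
    (wordF_mul_wordE q z k i) (wordF_mul_wordE q z k j) ?_ ?_ ?_ ?_ ?_ ?_
  · rw [wordKRootInv_mul_wordE, rootRoot_self, qpow_neg_two]
  · rw [wordKRoot_mul_wordE, rootRoot_self, qpow_two]
  · rw [wordKRootInv_mul_wordE, h, neg_neg, qpow_one]
  · rw [wordKRoot_mul_wordE, h, qpow_neg_one]
  · rw [wordKRootInv_mul_wordE, h', neg_neg, qpow_one]
  · rw [wordKRoot_mul_wordE, h', qpow_neg_one]

/-- On words, the relations between the `e_j` hold exactly: the commutator of `e_i` and `e_j`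
commutes with all `f_k` and annihilates the empty word. -/
theorem wordE_comm {i j : Fin (n - 1)} (h : rootRoot i j = 0) :
    wordE q z i * wordE q z j - wordE q z j * wordE q z i = 0 := by
  refine eq_zero_of_commute_wordF (fun k => (wordF_commute_comm q z h k).symm) ?_
  rw [LinearMap.sub_apply, Module.End.mul_apply, Module.End.mul_apply, wordE_nil, wordE_nil,
    map_zero, map_zero, sub_zero]

theorem wordE_serre {i j : Fin (n - 1)} (h : rootRoot i j = -1) :
    serrePoly q (wordE q z i) (wordE q z j) = 0 := by
  refine eq_zero_of_commute_wordF (fun k => (wordF_commute_serre q z h k).symm) ?_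
  rw [serrePoly, LinearMap.add_apply, LinearMap.sub_apply, LinearMap.smul_apply,
    Module.End.mul_apply, Module.End.mul_apply, Module.End.mul_apply _ (wordE q z i),
    wordE_nil, wordE_nil, Module.End.mul_apply, Module.End.mul_apply, wordE_nil]
  simp

/-- The operators on words that have to vanish by the Serre relations for the `f_j`. -/
inductive IsSerreOp : Module.End ℂ (Words n) → Prop
  | comm (i j) (h : rootRoot i j = 0) : IsSerreOp (wordF i * wordF j - wordF j * wordF i)
  | serre (i j) (h : rootRoot i j = -1) : IsSerreOp (serrePoly q (wordF i) (wordF j))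

/-- The subspace generated by the Serre relations under multiplication by words. -/
inductive SerreRel : Words n → Prop
  | base {T} (hT : IsSerreOp q T) (u : Words n) : SerreRel (T u)
  | zero : SerreRel 0
  | add {u u'} (h : SerreRel u) (h' : SerreRel u') : SerreRel (u + u')
  | smul (a : ℂ) {u} (h : SerreRel u) : SerreRel (a • u)
  | lower (j : Fin (n - 1)) {u} (h : SerreRel u) : SerreRel (wordF j u)

variable {q}

theorem SerreRel.sub {u u' : Words n} (h : SerreRel q u) (h' : SerreRel q u') :
    SerreRel q (u - u') := by
  rw [sub_eq_add_neg, ← neg_one_smul ℂ u']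
  exact h.add (h'.smul _)

/-- An operator that commutes with the `f_j` up to scalars preserves the Serre relations. -/
theorem SerreRel.diag {D : Module.End ℂ (Words n)} {c : Fin (n - 1) → ℂ}
    (hD : ∀ j, D * wordF j = c j • (wordF j * D)) {u : Words n} (h : SerreRel q u) :
    SerreRel q (D u) := by
  induction h with
  | @base T hT u =>
    obtain ⟨a, ha⟩ : ∃ a : ℂ, D * T = a • (T * D) := by
      cases hT with
      | comm i j h =>
        refine ⟨c i * c j, ?_⟩
        exact mul_comm_sub (R := Module.End ℂ (Words n)) (hD i) (hD j)
      | serre i j h =>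
        refine ⟨c i * c i * c j, ?_⟩
        exact mul_serrePoly (R := Module.End ℂ (Words n)) q (hD i) (hD j)
    rw [← Module.End.mul_apply, ha]
    exact (SerreRel.base hT (D u)).smul a
  | zero => rw [map_zero]; exact .zero
  | add _ _ h h' => rw [map_add]; exact h.add h'
  | smul a _ h => rw [map_smul]; exact h.smul a
  | lower j _ h =>
    rw [← Module.End.mul_apply, hD]
    exact (h.lower j).smul _

theorem SerreRel.wordK {u : Words n} (h : SerreRel q u) (i : Fin n) :
    SerreRel q (QuantumGL.wordK q z i u) := h.diag (wordK_mul_wordF q z i)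

theorem SerreRel.wordKinv {u : Words n} (h : SerreRel q u) (i : Fin n) :
    SerreRel q (QuantumGL.wordKinv q z i u) := h.diag (wordKinv_mul_wordF q z i)

/-- The operators `e_k` preserve the Serre relations since they commute with the Serre
polynomials. -/
theorem SerreRel.wordE {u : Words n} (h : SerreRel q u) (k : Fin (n - 1)) :
    SerreRel q (QuantumGL.wordE q z k u) := by
  induction h with
  | @base T hT u =>
    have hc : Commute (QuantumGL.wordE q z k) T := by
      cases hT with
      | comm i j h => exact wordE_commute_comm q z h k
      | serre i j h => exact wordE_commute_serre q z h k
    rw [← Module.End.mul_apply, hc.eq]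
    exact .base hT _
  | zero => rw [map_zero]; exact .zero
  | add _ _ h h' => rw [map_add]; exact h.add h'
  | smul a _ h => rw [map_smul]; exact h.smul a
  | @lower j u hu h =>
    rw [← Module.End.mul_apply, wordE_mul_wordF, LinearMap.add_apply, LinearMap.smul_apply,
      LinearMap.sub_apply]
    exact (h.lower j).add ((((hu.wordKinv z _).wordK z _).sub
      ((hu.wordK z _).wordKinv z _)).smul _)

variable (q n) in
/-- The subspace generated by the Serre relations. -/
def serreSub : Submodule ℂ (Words n) where
  carrier := {u | SerreRel q u}
  add_mem' h h' := SerreRel.add h h'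
  zero_mem' := SerreRel.zero
  smul_mem' a _ h := SerreRel.smul a h

variable (q) in
/-- The action of the generators on words. -/
def wordGen : Gen n → Module.End ℂ (Words n)
  | .k i => wordK q z i
  | .kinv i => wordKinv q z i
  | .e j => wordE q z j
  | .f j => wordF j

theorem wordGen_mem (g : Gen n) : serreSub q n ≤ (serreSub q n).comap (wordGen q z g) :=
  fun u (h : SerreRel q u) => by
    cases g with
    | k i => exact h.wordK z i
    | kinv i => exact h.wordKinv z i
    | e j => exact h.wordE z j
    | f j => exact h.lower j

variable (q) in
/-- The space of words modulo the Serre relations, a model of the Verma module of weight `z`. As a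
space it does not depend on `z`, but the action of `U_q(gl_n)` on it does. -/
def WordModule (_z : Fin n → ℂˣ) : Type := Words n ⧸ serreSub q n

instance : AddCommGroup (WordModule q z) := inferInstanceAs (AddCommGroup (Words n ⧸ serreSub q n))

instance : Module ℂ (WordModule q z) := inferInstanceAs (Module ℂ (Words n ⧸ serreSub q n))

variable (q) in
/-- The class of a combination of words. -/
def wordMk : Words n →ₗ[ℂ] WordModule q z := (serreSub q n).mkQ

theorem wordMk_eq_zero {u : Words n} (h : SerreRel q u) : wordMk q z u = 0 :=
  (Submodule.Quotient.mk_eq_zero _).2 h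

variable (q) in
/-- The action of the generators on words modulo the Serre relations. -/
def wordModuleGen (g : Gen n) : Module.End ℂ (WordModule q z) :=
  (serreSub q n).mapQ (serreSub q n) (wordGen q z g) (wordGen_mem z g)

theorem lift_wordModuleGen (a : FreeAlgebra ℂ (Gen n)) (u : Words n) :
    FreeAlgebra.lift ℂ (wordModuleGen q z) a (wordMk q z u) =
      wordMk q z (FreeAlgebra.lift ℂ (wordGen q z) a u) := by
  induction a using FreeAlgebra.induction generalizing u with
  | grade0 r => rw [AlgHom.commutes, AlgHom.commutes]; rfl
  | grade1 g => rw [FreeAlgebra.lift_ι_apply, FreeAlgebra.lift_ι_apply]; rfl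
  | mul a b ha hb =>
    rw [map_mul, map_mul, Module.End.mul_apply, Module.End.mul_apply, hb, ha]
  | add a b ha hb =>
    rw [map_add, map_add, LinearMap.add_apply, LinearMap.add_apply, ha, hb, map_add]

theorem wordModuleGen_rel ⦃a b : FreeAlgebra ℂ (Gen n)⦄
    (hq : (q : ℂ) - (q : ℂ)⁻¹ ≠ 0) (h : Rel q n a b) :
    FreeAlgebra.lift ℂ (wordModuleGen q z) a = FreeAlgebra.lift ℂ (wordModuleGen q z) b := by
  refine LinearMap.ext fun u => ?_
  obtain ⟨u, rfl⟩ := (serreSub q n).mkQ_surjective u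
  change FreeAlgebra.lift ℂ (wordModuleGen q z) a (wordMk q z u) =
    FreeAlgebra.lift ℂ (wordModuleGen q z) b (wordMk q z u)
  rw [lift_wordModuleGen, lift_wordModuleGen]
  cases h with
  | f_comm i j h =>
    rw [← sub_eq_zero, ← map_sub, ← LinearMap.sub_apply]
    refine wordMk_eq_zero z ?_
    simp only [map_mul, FreeAlgebra.lift_ι_apply, wordGen]
    exact .base (.comm i j h) u
  | f_serre i j h =>
    rw [map_zero, LinearMap.zero_apply, map_zero]
    refine wordMk_eq_zero z ?_
    simp only [map_add, map_sub, map_mul, map_smul, FreeAlgebra.lift_ι_apply, wordGen]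
    exact .base (.serre i j h) u
  | k_kinv i => simp only [map_mul, FreeAlgebra.lift_ι_apply, wordGen, map_one, wordK_mul_wordKinv]
  | kinv_k i => simp only [map_mul, FreeAlgebra.lift_ι_apply, wordGen, map_one, wordKinv_mul_wordK]
  | k_comm i j => simp only [map_mul, FreeAlgebra.lift_ι_apply, wordGen, (wordK_comm q z i j).eq]
  | k_e i j =>
    simp only [map_mul, map_smul, FreeAlgebra.lift_ι_apply, wordGen, wordK_mul_wordE]
  | k_f i j =>
    simp only [map_mul, map_smul, FreeAlgebra.lift_ι_apply, wordGen, wordK_mul_wordF]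
  | e_f_same j =>
    simp only [map_mul, map_sub, map_smul, FreeAlgebra.lift_ι_apply, wordGen]
    have h := wordE_mul_wordF q z j j
    rw [if_pos rfl] at h
    exact congrArg (fun T : Module.End ℂ (Words n) => wordMk q z (T u))
      (smul_bracket (R := Module.End ℂ (Words n)) hq h)
  | e_f_ne i j h =>
    simp only [map_mul, FreeAlgebra.lift_ι_apply, wordGen]
    rw [wordE_mul_wordF, if_neg (Ne.symm h), zero_smul, add_zero]
  | e_comm i j h =>
    simp only [map_mul, FreeAlgebra.lift_ι_apply, wordGen]
    rw [sub_eq_zero (G := Module.End ℂ (Words n)).1 (wordE_comm q z h)]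
  | e_serre i j h =>
    simp only [map_add, map_sub, map_mul, map_smul, FreeAlgebra.lift_ι_apply, wordGen, map_zero]
    exact congrArg (fun T : Module.End ℂ (Words n) => wordMk q z (T u)) (wordE_serre q z h)

theorem exists_wordModule_rep (hq : (q : ℂ) - (q : ℂ)⁻¹ ≠ 0) :
    ∃ ρ : Uq q n →ₐ[ℂ] Module.End ℂ (WordModule q z),
      (∀ i u, ρ (Uq.k q i) (wordMk q z u) = wordMk q z (wordK q z i u)) ∧
      (∀ j u, ρ (Uq.e q j) (wordMk q z u) = wordMk q z (wordE q z j u)) ∧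
      ∀ j u, ρ (Uq.f q j) (wordMk q z u) = wordMk q z (wordF j u) := by
  have h : ∀ g u, Uq.lift q (wordModuleGen q z) (fun _ _ h => wordModuleGen_rel z hq h)
      (Uq.mk q (gen g)) (wordMk q z u) = wordMk q z (wordGen q z g u) := fun g u => by
    rw [Uq.lift_mk, FreeAlgebra.lift_ι_apply]
    rfl
  exact ⟨_, fun i u => h (.k i) u, fun j u => h (.e j) u, fun j u => h (.f j) u⟩

/-- The coordinates of a word under the map that replaces `f_j` by the matrix unit `E_{j,j+1}` and
the empty word by the `m`-th basis vector. -/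
def columnWord (m : ℕ) : List (Fin (n - 1)) → ℕ → ℂ
  | [] => fun s => if s = m then 1 else 0
  | j :: w => fun s => if s = j then columnWord m w (s + 1) else 0

variable (n) in
/-- The linear extension of `columnWord`. -/
def columnWords (m : ℕ) : Words n →ₗ[ℂ] (ℕ → ℂ) := Finsupp.linearCombination ℂ (columnWord m)

theorem columnWords_single (m : ℕ) (w : List (Fin (n - 1))) :
    columnWords n m (Finsupp.single w 1) = columnWord m w := by simp [columnWords]

theorem columnWords_wordF (m : ℕ) (j : Fin (n - 1)) (u : Words n) (s : ℕ) :
    columnWords n m (wordF j u) s = if s = j then columnWords n m u (s + 1) else 0 := by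
  induction u using Finsupp.induction_linear with
  | zero => simp
  | add u u' h h' =>
    rw [map_add, map_add, map_add, Pi.add_apply, Pi.add_apply, h, h']
    split_ifs <;> simp
  | single w a =>
    rw [← Finsupp.smul_single_one, map_smul, map_smul, map_smul, wordF_single, columnWords_single,
      columnWords_single, Pi.smul_apply, Pi.smul_apply, columnWord]
    split_ifs <;> simp [*]

/-- The matrix units `E_{j,j+1}` satisfy the Serre relations: every product occurring in them
vanishes. -/
theorem columnWords_eq_zero (m : ℕ) {u : Words n} (h : SerreRel q u) : columnWords n m u = 0 := by
  induction h with
  | base hT u =>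
    funext s
    cases hT with
    | comm i j h =>
      have h1 : (i : ℕ) + 1 ≠ j ∧ (j : ℕ) + 1 ≠ i := by
        simp only [rootRoot, epsRoot, lo, hi, Fin.mk.injEq] at h
        split_ifs at h <;> omega
      rw [LinearMap.sub_apply, Module.End.mul_apply, Module.End.mul_apply, map_sub, Pi.sub_apply]
      simp only [columnWords_wordF]
      split_ifs <;> first | omega | simp
    | serre i j h =>
      have h1 : (i : ℕ) ≠ j := by
        rintro h1
        rw [Fin.ext h1, rootRoot_self] at h
        omega
      rw [serrePoly, LinearMap.add_apply, LinearMap.sub_apply, LinearMap.smul_apply, map_add,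
        map_sub, map_smul]
      simp only [Module.End.mul_apply, Pi.add_apply, Pi.sub_apply, Pi.smul_apply,
        columnWords_wordF]
      split_ifs <;> first | omega | simp
  | zero => exact map_zero _
  | add _ _ h h' => rw [map_add, h, h', add_zero]
  | smul a _ h => rw [map_smul, h, smul_zero]
  | lower j _ h =>
    funext s
    rw [columnWords_wordF, h]
    simp

/-- The Verma module has a map to columns that transforms `f_j` into the matrix unit `E_{j,j+1}`.
It is obtained from the action of `U_q(gl_n)` on words modulo the Serre relations. -/
theorem nonempty_columnMap_verma (hq : (q : ℂ) - (q : ℂ)⁻¹ ≠ 0) (m : ℕ) :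
    Nonempty (ColumnMap q n (vermaVec q z) m) := by
  obtain ⟨ρ, hk, he, hf⟩ := exists_wordModule_rep z hq
  let v : WordModule q z := wordMk q z (Finsupp.single [] 1)
  let c : WordModule q z →ₗ[ℂ] (ℕ → ℂ) :=
    (serreSub q n).liftQ (columnWords n m) fun u hu => columnWords_eq_zero m hu
  have hc : ∀ u, c (wordMk q z u) = columnWords n m u := fun u => rfl
  have hcf : ∀ j : Fin (n - 1), ∀ y s,
      c (ρ (Uq.f q j) y) s = if s = j then c y (s + 1) else 0 := fun j y s => by
    obtain ⟨u, rfl⟩ : ∃ u, wordMk q z u = y := (serreSub q n).mkQ_surjective y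
    rw [hf, hc, hc, columnWords_wordF]
  let ev : Uq q n →ₗ[ℂ] WordModule q z := (LinearMap.applyₗ v).comp ρ.toLinearMap
  have hev : ∀ x ∈ vermaIdeal q z, ev x = 0 := by
    intro x hx
    induction hx using Submodule.span_induction with
    | mem x hx =>
      rcases hx with ⟨j, rfl⟩ | ⟨i, rfl⟩
      · change ρ (Uq.e q j) v = 0
        rw [he, wordE_nil, map_zero]
      · change ρ (Uq.k q i - algebraMap ℂ (Uq q n) (z i)) v = 0
        rw [map_sub, LinearMap.sub_apply, hk, wordK, wordDiag_single, AlgHom.commutes, map_smul,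
          Module.algebraMap_end_apply, wordWt]
        exact sub_self _
    | zero => exact map_zero ev
    | add x y _ _ h h' => rw [map_add, h, h', add_zero]
    | smul a x _ h =>
      change ρ (a * x) v = 0
      rw [map_mul, Module.End.mul_apply]
      exact (congrArg (ρ a) h).trans (map_zero _)
  let Φ : Verma q z →ₗ[ℂ] WordModule q z :=
    ((vermaIdeal q z).restrictScalars ℂ).liftQ ev hev
  have hΦ : ∀ x : Uq q n, Φ ((vermaIdeal q z).mkQ x) = ρ x v := fun x => rfl
  refine ⟨⟨c.comp Φ, fun s => ?_, fun j hj y s => ?_⟩⟩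
  · rw [LinearMap.comp_apply, vermaVec, hΦ, map_one, Module.End.one_apply, hc, columnWords_single]
    rfl
  · obtain ⟨x, rfl⟩ := (vermaIdeal q z).mkQ_surjective y
    rw [fN_of_lt (by omega : j < n - 1), ← map_smul, smul_eq_mul, LinearMap.comp_apply, hΦ, map_mul,
      Module.End.mul_apply, hcf]
    rfl

end WordModel

/-! ### The modules `M_{σ·λ}` -/

section Bridge

theorem sub_inv_ne_zero_of_not_root_of_unity {q : ℂˣ} (hq : ∀ m : ℕ, 0 < m → q ^ m ≠ 1) :
    (q : ℂ) - (q : ℂ)⁻¹ ≠ 0 := by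
  intro h
  have h1 : (q : ℂ) * q = 1 := by
    rw [sub_eq_zero] at h
    nth_rw 2 [h]
    exact mul_inv_cancel₀ q.ne_zero
  exact hq 2 (by norm_num) (Units.ext (by push_cast; rw [pow_two, h1]))

theorem add_inv_ne_zero_of_not_root_of_unity {q : ℂˣ} (hq : ∀ m : ℕ, 0 < m → q ^ m ≠ 1) :
    (q : ℂ) + (q : ℂ)⁻¹ ≠ 0 := by
  intro h
  have h1 : (q : ℂ) * q = -1 := by
    rw [add_eq_zero_iff_eq_neg] at h
    nth_rw 2 [h]
    rw [mul_neg, mul_inv_cancel₀ q.ne_zero]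
  refine hq 4 (by norm_num) (Units.ext ?_)
  push_cast
  linear_combination ((q : ℂ) * q - 1) * h1

variable {q : ℂˣ} {n : ℕ}

/-- The extension of a weight to all natural indices. -/
def extWt (z : Fin n → ℂˣ) (i : ℕ) : ℂˣ := if h : i < n then z ⟨i, h⟩ else 1

theorem extWt_of_lt (z : Fin n → ℂˣ) {i : ℕ} (h : i < n) : extWt z i = z ⟨i, h⟩ := dif_pos h

theorem extWt_val (z : Fin n → ℂˣ) (i : Fin n) : extWt z i = z i := extWt_of_lt z i.2

theorem xHat_eq (z : Fin n → ℂˣ) (i : Fin n) : xHat q z i = xN q (extWt z) i := by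
  rw [xHat, xN, extWt_val, neg_mul, zpow_neg, show (2 : ℤ) * (i : ℕ) = ((2 * i : ℕ) : ℤ) by simp,
    zpow_natCast]
  push_cast
  rw [inv_pow]

theorem dynRootAux_eq (hq : (q : ℂ) - (q : ℂ)⁻¹ ≠ 0) (z : Fin n → ℂˣ) :
    ∀ (d i : ℕ) (h : i + d < n), dynRootAux q z d i h = dynN q n (extWt z) d i
  | 0, _, _ => rfl
  | 1, i, h => by rw [dynN_one hq, dynRootAux, fN_of_lt]
  | d + 2, i, h => by
    rw [dynN_succ, dynRootAux, dynRootAux_eq hq z (d + 1) (i + 1),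
      fN_of_lt (by omega : i < n - 1), extWt_of_lt z (by omega : i + 1 < n),
      extWt_of_lt z (by omega : i + (d + 1) + 1 < n)]
    rfl

theorem dynRoot_eq (hq : (q : ℂ) - (q : ℂ)⁻¹ ≠ 0) (z : Fin n → ℂˣ) {i j : Fin n} (h : i ≤ j) :
    dynRoot q z i j = dynN q n (extWt z) (j - i) i := by
  rw [dynRoot, dif_pos h, dynRootAux_eq hq]

section Module

variable {M : Type*} [AddCommGroup M] [Module ℂ M] [Module (Uq q n) M]
  [IsScalarTower ℂ (Uq q n) M]

/-- The recursive definition of `uN` unfolds to the formula for `û_m`. -/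
theorem uN_eq_sum (ζ : ℕ → ℂˣ) (y : M) {m d r : ℕ} (h : r + d = m) :
    uN q n ζ y d r = ∑ i ∈ Finset.Ico r (m + 1), ((-(q : ℂ)) ^ (i - r) *
      ∏ j ∈ Finset.Ico r i, qNumber q (ζ j / ζ m * q ^ ((m : ℤ) - (j : ℤ) - 1))) •
        wN q n i (dynN q n ζ (m - i) i • y) := by
  subst h
  induction d generalizing r with
  | zero => simp [uN_zero, dynN_zero]
  | succ d ih =>
    rw [uN_succ, ih, Finset.sum_eq_sum_Ico_succ_bot (show r < r + (d + 1) + 1 by omega),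
      Nat.sub_self, pow_zero,
      Finset.Ico_self, Finset.prod_empty, mul_one, one_smul, Nat.add_sub_cancel_left,
      sub_eq_add_neg, ← neg_smul, Finset.smul_sum, show r + 1 + d = r + (d + 1) by omega]
    congr 1
    refine Finset.sum_congr rfl fun i hi => ?_
    have hi := Finset.mem_Ico.1 hi
    rw [smul_smul, Finset.prod_eq_prod_Ico_succ_bot (by omega : r < i),
      show i - r = i - (r + 1) + 1 by omega, pow_succ, aN,
      show ((r + (d + 1) : ℕ) : ℤ) - r - 1 = d by push_cast; ring, zpow_natCast, ← add_assoc]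
    congr 1
    ring

/-- Under a column map, a dynamical root vector becomes a multiple of a matrix unit: of the two
products in its recursion, one always acts by zero. -/
theorem ColumnMap.map_dynN (hq : (q : ℂ) - (q : ℂ)⁻¹ ≠ 0) {v : M} {m : ℕ}
    (Ψ : ColumnMap q n v m) (ζ : ℕ → ℂˣ) {d i : ℕ} (hn : i + d + 1 < n) :
    ∃ a : ℂ, ∀ y s, Ψ.map (dynN q n ζ (d + 1) i • y) s =
      if s = i then a * Ψ.map y (i + d + 1) else 0 := by
  induction d generalizing i with
  | zero => 
    refine ⟨1, fun y s => ?_⟩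
    rw [dynN_one hq, Ψ.map_lower i hn, one_mul, add_zero]
    split_ifs with h
    · rw [h]
    · rfl
  | succ d ih =>
    obtain ⟨a, ha⟩ := ih (i := i + 1) (by omega)
    refine ⟨qNumber q (ζ (i + 1) / ζ (i + (d + 1) + 1) * q ^ (d + 1)) * a, fun y s => ?_⟩
    rw [dynN_succ_smul, map_sub, LinearMap.map_smul, LinearMap.map_smul, Pi.sub_apply,
      Pi.smul_apply, Pi.smul_apply, Ψ.map_lower i (by omega), ha, ha, Ψ.map_lower i (by omega),
      if_neg (show i + 1 + d + 1 ≠ i by omega), show i + 1 + d + 1 = i + (d + 1) + 1 by omega]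
    rcases eq_or_ne s i with rfl | hs
    · simp [mul_assoc]
    · simp [hs]

end Module

theorem isHW_vermaVec (z : Fin n → ℂˣ) : IsHW q n (extWt z) (vermaVec q z) := by
  have hmk : ∀ x : Uq q n, x • vermaVec q z = (vermaIdeal q z).mkQ x := fun x => by
    rw [vermaVec, ← map_smul, smul_eq_mul, mul_one]
  refine ⟨fun j => ?_, fun i hi => ?_⟩
  · by_cases hj : j < n - 1
    · rw [fun h => eN_of_lt h, hmk, Submodule.mkQ_apply, Submodule.Quotient.mk_eq_zero]
      · exact Submodule.subset_span (.inl ⟨⟨j, hj⟩, rfl⟩)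
      · exact hj
    · rw [eN_of_le (by omega), zero_smul]
  · have h : (vermaIdeal q z).mkQ (Uq.k q ⟨i, hi⟩ - algebraMap ℂ (Uq q n) (z ⟨i, hi⟩)) = 0 := by
      rw [Submodule.mkQ_apply, Submodule.Quotient.mk_eq_zero]
      exact Submodule.subset_span (.inr ⟨⟨i, hi⟩, rfl⟩)
    rw [map_sub, sub_eq_zero, ← hmk, ← hmk, algebraMap_smul] at h
    rw [kN_of_lt hi, extWt_of_lt z hi, h]

theorem span_vermaVec (z : Fin n → ℂˣ) : Submodule.span (Uq q n) {vermaVec q z} = ⊤ := by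
  rw [eq_top_iff]
  intro y _
  obtain ⟨x, rfl⟩ := (vermaIdeal q z).mkQ_surjective y
  rw [Submodule.mem_span_singleton]
  exact ⟨x, by rw [vermaVec, ← map_smul, smul_eq_mul, mul_one]⟩

section Sigma

variable (c : Composition n) (σ : Equiv.Perm (Fin n)) (t : Fin c.length → ℂˣ)

theorem sigmaProj_smul (x : Uq q n) (y : Verma q (sigmaWeight q c σ t)) :
    sigmaProj q c σ t (x • y) = x • sigmaProj q c σ t y := rfl

theorem isHW_sigmaVec : IsHW q n (extWt (sigmaWeight q c σ t)) (sigmaVec q c σ t) := by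
  obtain ⟨h1, h2⟩ := isHW_vermaVec (q := q) (sigmaWeight q c σ t)
  refine ⟨fun j => ?_, fun i hi => ?_⟩
  · rw [sigmaVec, ← sigmaProj_smul, h1, map_zero]
  · rw [sigmaVec, ← sigmaProj_smul, h2 i hi, LinearMap.map_smul]

theorem span_sigmaVec : Submodule.span (Uq q n) {sigmaVec q c σ t} = ⊤ := by
  rw [eq_top_iff]
  intro y _
  obtain ⟨y, rfl⟩ := (sigmaSub q c σ t).mkQ_surjective y
  obtain ⟨x, rfl⟩ := Submodule.mem_span_singleton.1
    (span_vermaVec (q := q) (sigmaWeight q c σ t) ▸ Submodule.mem_top : y ∈ _)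
  exact Submodule.mem_span_singleton.2 ⟨x, rfl⟩

variable {c σ}

/-- The value of `σ·λ` at `σ(a)`, where `t` gives the values of `λ` on the blocks. -/
theorem sigmaWeight_apply (a : Fin n) : sigmaWeight q c σ t (σ a) =
    t (c.index a) * q ^ (((σ a : Fin n) : ℤ) - (a : ℤ)) := by
  rw [sigmaWeight, dotAction, Equiv.symm_apply_apply, leviWeight]

theorem xHat_sigmaWeight (a : Fin n) :
    xHat q (sigmaWeight q c σ t) (σ a) = xHat q (leviWeight c t) a := by
  rw [xHat, xHat, sigmaWeight_apply, leviWeight, mul_pow,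
    ← zpow_natCast (q ^ (((σ a : Fin n) : ℤ) - (a : ℤ))), ← zpow_mul, mul_assoc,
    ← zpow_add]
  congr 4
  push_cast
  ring

/-- An index that is not the head of its block has a predecessor in the block. -/
theorem blockHead_or_exists_isLeviSimple (c : Composition n) (b : Fin n) :
    b = blockHead c (c.index b) ∨ ∃ a, IsLeviSimple c a b := by
  obtain ⟨k, hk⟩ : ∃ k, b = c.embedding (c.index b) k := ⟨_, (c.embedding_comp_inv b).symm⟩
  obtain ⟨k, hk'⟩ := k
  rcases k with _ | k
  · exact .inl hk
  · refine .inr ⟨c.embedding (c.index b) ⟨k, by omega⟩, ?_, ?_⟩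
    · rw [c.coe_embedding]
      nth_rw 1 [hk]
      rw [c.coe_embedding]
      rfl
    · rw [c.index_embedding]

theorem not_isLeviSimple_blockHead (c : Composition n) (a : Fin n) (i : Fin c.length) :
    ¬ IsLeviSimple c a (blockHead c i) := by
  rintro ⟨h1, h2⟩
  have h3 : c.index (blockHead c i) = i := c.index_embedding _ _
  rw [h3] at h2
  have h4 := c.sizeUpTo_index_le a
  rw [h2] at h4
  rw [blockHead, c.coe_embedding] at h1
  simp only [add_zero] at h1
  omega

theorem headPos_injective : Function.Injective (headPos c σ) := fun i j h => by
  have h1 := congrArg c.index (σ.injective h)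
  rwa [blockHead, blockHead, c.index_embedding, c.index_embedding] at h1

/-- For consecutive `a`, `b` in a block, `(σ·λ + ρ, ε_{σ(a)} - ε_{σ(b)}) = 1`, so that
`f̌_{ε_{σ(a)} - ε_{σ(b)}} v_{σ·λ}` is a singular vector. -/
theorem sigmaWeight_div {a b : Fin n} (h : IsLeviSimple c a b) {d : ℕ}
    (hd : (σ a : ℕ) + d + 1 = σ b) : sigmaWeight q c σ t (σ a) / sigmaWeight q c σ t (σ b) * q ^ d =
      1 := by
  rw [sigmaWeight_apply, sigmaWeight_apply, h.2, mul_div_mul_left_eq_div, div_eq_mul_inv,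
    ← zpow_sub,
    ← zpow_natCast, ← zpow_add, ← zpow_zero q, h.1, ← hd]
  congr 1
  push_cast
  ring

/-- For the index `p_i`, the column map of the Verma module descends to `M_{σ·λ}`: it annihilates
the submodules generated by the singular vectors `f̌ v_{σ·λ}`, because `f̌` becomes a multiple of
a matrix unit with column index `σ(a + 1)`, which is different from `p_i`. -/
theorem nonempty_columnMap_sigma (hq : (q : ℂ) - (q : ℂ)⁻¹ ≠ 0) (hσ : Admissible c σ)
    (i : Fin c.length) : Nonempty (ColumnMap q n (sigmaVec q c σ t) (headPos c σ i)) := by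
  obtain ⟨Ψ⟩ := nonempty_columnMap_verma (sigmaWeight q c σ t) hq (headPos c σ i)
  have hv := isHW_vermaVec (q := q) (sigmaWeight q c σ t)
  have h : ∀ y ∈ sigmaSub q c σ t, ∀ x : Uq q n, Ψ.map (x • y) = 0 := by
    intro y hy
    induction hy using Submodule.span_induction with
    | mem y hy =>
      obtain ⟨a, b, hab, rfl⟩ := hy
      have hlt : σ a < σ b := hσ a b hab.2 (by rw [Fin.lt_def, hab.1]; omega)
      obtain ⟨d, hd⟩ : ∃ d, (σ a : ℕ) + d + 1 = σ b := ⟨σ b - σ a - 1, by omega⟩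
      have hn : (σ a : ℕ) + d + 1 < n := by omega
      rw [dynRoot_eq hq _ hlt.le, show (σ b : ℕ) - σ a = d + 1 by omega]
      -- the generators of the submodule are singular since the quantum number is `[0]_q`
      have ha : aN q (extWt (sigmaWeight q c σ t)) d (σ a) = 0 := by
        rw [aN, hd, extWt_val, extWt_val, sigmaWeight_div t hab hd, qNumber_one]
      have hg : IsHW q n (shiftWt q (extWt (sigmaWeight q c σ t)) (σ a) (σ a + (d + 1)))
          (dynN q n (extWt (sigmaWeight q c σ t)) (d + 1) (σ a) •
            vermaVec q (sigmaWeight q c σ t)) := by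
        refine ⟨fun j => ?_, hv.2.dynN _ _ _⟩
        by_cases hj : j = σ a
        · rw [hj, (eN_dynN_smul hq hv.2 hn fun j _ _ => hv.1 j).2, ha, zero_smul]
        · exact hv.eN_dynN_smul hq hn hj
      obtain ⟨r, hr⟩ := Ψ.map_dynN hq (extWt (sigmaWeight q c σ t)) hn
      refine fun x => (?_ : ∀ y, LowerClosure q n _ y → Ψ.map y = 0) _
        (LowerClosure.of_isHW hq hg x)
      intro y hy
      induction hy with
      | base h =>
        obtain rfl := h
        funext s
        have hne : (σ b : ℕ) ≠ headPos c σ i := fun h =>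
          not_isLeviSimple_blockHead c a i (σ.injective (Fin.ext h) ▸ hab)
        rw [hr, hd, Ψ.map_vec, if_neg hne]
        simp
      | zero => exact map_zero _
      | add _ _ h h' => rw [map_add, h, h', add_zero]
      | smul a _ h => rw [LinearMap.map_smul, h, smul_zero]
      | lower hj _ h =>
        funext s
        rw [Ψ.map_lower _ hj, h]
        simp
    | zero => intro x; rw [smul_zero, map_zero]
    | add y y' _ _ h h' => intro x; rw [smul_add, map_add, h, h', add_zero]
    | smul a y _ h => intro x; rw [← mul_smul, h]
  let Φ : SigmaModule q c σ t →ₗ[ℂ] (ℕ → ℂ) :=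
    ((sigmaSub q c σ t).restrictScalars ℂ).liftQ Ψ.map fun y hy => by
      simpa using h y hy 1
  have hΦ : ∀ y, Φ (sigmaProj q c σ t y) = Ψ.map y := fun y => rfl
  refine ⟨⟨Φ, fun s => ?_, fun j hj y s => ?_⟩⟩
  · rw [sigmaVec, hΦ, Ψ.map_vec]
  · obtain ⟨y, rfl⟩ := (sigmaSub q c σ t).mkQ_surjective y
    exact Ψ.map_lower j hj y s

/-- Under the regularity assumption, the filtration of `ℂ^n ⊗ M_{σ·λ}` can jump only at the indices
`p_i`. -/
theorem wN_sigmaVec_mem_flag (hq : (q : ℂ) - (q : ℂ)⁻¹ ≠ 0) (hσ : Admissible c σ)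
    (hreg : PrincipalRegular q c σ t) {l : ℕ} (hl : l < n) (h : ∀ i, (headPos c σ i : ℕ) ≠ l) :
    wN q n l (sigmaVec q c σ t) ∈ flag q n (sigmaVec q c σ t) l := by
  obtain ⟨b, hb⟩ := σ.surjective ⟨l, hl⟩
  obtain rfl : (σ b : ℕ) = l := by rw [hb]
  rcases blockHead_or_exists_isLeviSimple c b with h1 | ⟨a, hab⟩
  · exact absurd (by rw [headPos, ← h1]) (h (c.index b))
  have hlt : σ a < σ b := hσ a b hab.2 (by rw [Fin.lt_def, hab.1]; omega)
  obtain ⟨d, hd⟩ : ∃ d, (σ a : ℕ) + d + 1 = σ b := ⟨σ b - σ a - 1, by omega⟩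
  rw [← hd]
  refine wN_mem_flag_of_dynN_smul_eq_zero hq (isHW_sigmaVec c σ t).2 (by omega) ?_ ?_
  · intro r hr hr'
    have := hreg a b hab ⟨r, by omega⟩ hr (by rw [Fin.lt_def]; simp only; omega)
    rwa [xHat_eq, xHat_eq, ← hd] at this
  · rw [sigmaVec, ← sigmaProj_smul]
    refine (Submodule.Quotient.mk_eq_zero _).2 (Submodule.subset_span ⟨a, b, hab, ?_⟩)
    rw [dynRoot_eq hq _ hlt.le, show (σ b : ℕ) - σ a = d + 1 by omega]

variable (c σ) in
/-- The set of the indices `p_i`. -/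
def headSet : Finset ℕ := Finset.univ.image fun i => (headPos c σ i : ℕ)

theorem mem_headSet {l : ℕ} : l ∈ headSet c σ ↔ ∃ i, (headPos c σ i : ℕ) = l := by
  simp [headSet]

theorem xEig_eq (i : Fin c.length) :
    xEig q c t i = xN q (extWt (sigmaWeight q c σ t)) (headPos c σ i) := by
  rw [← xHat_eq, headPos, xHat_sigmaWeight, xEig]

theorem prod_headSet {β : Type*} [CommMonoid β] (f : ℕ → β) (i : Fin c.length) :
    ∏ l ∈ headSet c σ with l < (headPos c σ i : ℕ), f l =
      ∏ j ∈ Finset.univ.filter (fun j => headPos c σ j < headPos c σ i), f (headPos c σ j) := by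
  rw [headSet, Finset.filter_image, Finset.prod_image]
  · rfl
  · intro a _ b _ h
    exact headPos_injective (Fin.ext h)

/-- The vector `u_i` is the eigenvector of `𝒬` attached to the jump `p_i` of the filtration. -/
theorem uSigma_eq (i : Fin c.length) : uSigma q c σ t i =
    headVec q n (extWt (sigmaWeight q c σ t)) (sigmaVec q c σ t) (headSet c σ) (headPos c σ i) := by
  rw [uSigma, headVec, headPoly, prod_headSet, wN_val]
  simp only [xEig_eq (σ := σ)]

theorem cBar_eq (i : Fin c.length) : cBar q c σ t i =
    ∏ l ∈ Finset.range (headPos c σ i) with l ∉ headSet c σ,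
      (xN q (extWt (sigmaWeight q c σ t)) (headPos c σ i) -
        xN q (extWt (sigmaWeight q c σ t)) l) := by
  rw [cBar]
  refine Finset.prod_bij (fun l _ => (l : ℕ)) ?_ ?_ ?_ ?_
  · intro l hl
    obtain ⟨-, h1, h2⟩ := Finset.mem_filter.1 hl
    refine Finset.mem_filter.2 ⟨Finset.mem_range.2 h1, fun h => ?_⟩
    obtain ⟨j, hj⟩ := mem_headSet.1 h
    exact h2 j (Fin.ext hj)
  · intro a _ b _ h
    exact Fin.ext h
  · intro l hl
    obtain ⟨h1, h2⟩ := Finset.mem_filter.1 hl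
    have h1 := Finset.mem_range.1 h1
    exact ⟨⟨l, by omega⟩, Finset.mem_filter.2 ⟨Finset.mem_univ _, h1, fun j hj =>
      h2 (mem_headSet.2 ⟨j, by rw [hj]⟩)⟩, rfl⟩
  · intro l _
    rw [xEig_eq (σ := σ), xHat_eq]

theorem idTensor_wTensor {M M' : Type*} [AddCommGroup M] [Module ℂ M] [AddCommGroup M']
    [Module ℂ M'] (φ : M →ₗ[ℂ] M') (i : Fin n) (y : M) :
    idTensor q n φ (wTensor q n i y) = wTensor q n i (φ y) := rfl

/-- The vector `(id ⊗ ϖ)(û_m)` is the full sum `uN`. -/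
theorem idTensor_uHat (hq : (q : ℂ) - (q : ℂ)⁻¹ ≠ 0) (m : Fin n) :
    idTensor q n (sigmaProj q c σ t) (uHat q (sigmaWeight q c σ t) m) =
      uN q n (extWt (sigmaWeight q c σ t)) (sigmaVec q c σ t) m 0 := by
  rw [uN_eq_sum _ _ (zero_add _), uHat, map_sum]
  refine Finset.sum_bij (fun i _ => (i : ℕ)) ?_ ?_ ?_ ?_
  · intro i hi
    have := Fin.le_def.1 (Finset.mem_filter.1 hi).2
    exact Finset.mem_Ico.2 ⟨by omega, by omega⟩
  · intro a _ b _ h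
    exact Fin.ext h
  · intro i hi
    have := Finset.mem_Ico.1 hi
    exact ⟨⟨i, by omega⟩,
      Finset.mem_filter.2 ⟨Finset.mem_univ _, Fin.le_def.2 (by simp only; omega)⟩, rfl⟩
  · intro i hi
    have hi := (Finset.mem_filter.1 hi).2
    rw [LinearMap.map_smul, idTensor_wTensor, sigmaProj_smul, dynRoot_eq hq _ hi, wN_val, sigmaVec,
      Nat.sub_zero]
    congr 2
    refine Finset.prod_bij (fun l _ => (l : ℕ)) ?_ ?_ ?_ ?_
    · intro l hl
      exact Finset.mem_Ico.2 ⟨by omega, (Finset.mem_filter.1 hl).2⟩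
    · intro a _ b _ h
      exact Fin.ext h
    · intro l hl
      have := Finset.mem_Ico.1 hl
      exact ⟨⟨l, by omega⟩, Finset.mem_filter.2 ⟨Finset.mem_univ _, this.2⟩, rfl⟩
    · intro l _
      rw [extWt_val, extWt_val]

end Sigma

end Bridge

/-! ### The decomposition of `ℂ^n ⊗ M_{σ·λ}` -/

section Decomposition

open Polynomial

variable {q : ℂˣ} {n : ℕ} {c : Composition n} {σ : Equiv.Perm (Fin n)} (t : Fin c.length → ℂˣ)

/-- For every block there is a functional on `ℂ^n ⊗ M_{σ·λ}` that annihilates the step `p_i` of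
the filtration, is `1` on `w_{p_i} ⊗ v`, and on which polynomials in `𝒬` act by their values at
`x_i`. It witnesses that the filtration jumps at `p_i`. -/
theorem exists_functional_sigma (hq₀ : (q : ℂ) + (q : ℂ)⁻¹ ≠ 0) (hq : (q : ℂ) - (q : ℂ)⁻¹ ≠ 0)
    (hσ : Admissible c σ) (i : Fin c.length) :
    ∃ φ : NatTensor q n (SigmaModule q c σ t) →ₗ[ℂ] ℂ,
      φ (wN q n (headPos c σ i) (sigmaVec q c σ t)) = 1 ∧
      (∀ u ∈ flag q n (sigmaVec q c σ t) (headPos c σ i), φ u = 0) ∧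
      ∀ (p : ℂ[X]) u, φ (aeval (qOperator q n (SigmaModule q c σ t)) p u) =
        p.eval (xEig q c t i) * φ u := by
  obtain ⟨Ψ⟩ := nonempty_columnMap_sigma t hq hσ i
  obtain ⟨φ, h1, h2, h3⟩ := Ψ.exists_functional hq₀ hq (isHW_sigmaVec c σ t)
    (span_sigmaVec c σ t) (headPos c σ i).2
  refine ⟨φ, h1, h2, fun p u => ?_⟩
  rw [← xEig_eq] at h3
  induction p using Polynomial.induction_on' with
  | add p p' h h' => rw [map_add, LinearMap.add_apply, map_add, h, h', eval_add, add_mul]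
  | monomial k a =>
    rw [aeval_monomial, Module.End.mul_apply, Module.algebraMap_end_apply, LinearMap.map_smul,
      eval_monomial, smul_eq_mul, mul_assoc]
    congr 1
    induction k with
    | zero => simp
    | succ k ih => rw [pow_succ', Module.End.mul_apply, h3, ih, pow_succ', mul_assoc]

/-- The functional of block `i` takes a non-zero value on `u_i` if `x_i` is different from all
preceding eigenvalues. -/
theorem uSigma_ne_zero (hq₀ : (q : ℂ) + (q : ℂ)⁻¹ ≠ 0) (hq : (q : ℂ) - (q : ℂ)⁻¹ ≠ 0)
    (hσ : Admissible c σ) (i : Fin c.length)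
    (hx : ∀ j, headPos c σ j < headPos c σ i → xEig q c t i ≠ xEig q c t j) :
    uSigma q c σ t i ≠ 0 := by
  intro h0
  obtain ⟨φ, h1, -, h3⟩ := exists_functional_sigma t hq₀ hq hσ i
  have h := congrArg φ h0
  rw [uSigma, h3, ← wN_val, h1, map_zero, mul_one, eval_prod, Finset.prod_eq_zero_iff] at h
  obtain ⟨j, hj, h⟩ := h
  rw [eval_sub, eval_X, eval_C, sub_eq_zero] at h
  exact hx j (Finset.mem_filter.1 hj).2 h

/-- If two of the eigenvalues coincide, then the functional of the block with the larger `p_i`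
annihilates all summands. -/
theorem xEig_injective_of_iSup_eq_top (hq₀ : (q : ℂ) + (q : ℂ)⁻¹ ≠ 0)
    (hq : (q : ℂ) - (q : ℂ)⁻¹ ≠ 0) (hσ : Admissible c σ)
    (htop : iSup (sigmaSummand q c σ t) = ⊤) : Function.Injective (xEig q c t) := by
  have key : ∀ i j, headPos c σ j < headPos c σ i → xEig q c t i ≠ xEig q c t j := by
    intro i j hji hx
    obtain ⟨φ, h1, h2, h3⟩ := exists_functional_sigma t hq₀ hq hσ i
    have h : ∀ u ∈ iSup (sigmaSummand q c σ t), φ u = 0 := by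
      intro u hu
      induction hu using Submodule.iSup_induction' with
      | mem s u hu =>
        obtain ⟨y, rfl⟩ := Submodule.mem_span_singleton.1 hu
        rw [uSigma, ← aeval_qOperator_smul hq₀ hq, h3, ← wN_val]
        rcases lt_or_ge (headPos c σ j) (headPos c σ s) with h | h
        · rw [eval_prod, Finset.prod_eq_zero (Finset.mem_filter.2 ⟨Finset.mem_univ j, h⟩), zero_mul]
          rw [eval_sub, eval_X, eval_C, hx, sub_self]
        · rw [h2, mul_zero]
          exact Submodule.smul_mem _ _ (wN_mem_flag (lt_of_le_of_lt h hji))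
      | zero => exact map_zero φ
      | add u u' _ _ h h' => rw [map_add, h, h', add_zero]
    rw [h _ (htop ▸ Submodule.mem_top)] at h1
    exact zero_ne_one h1
  intro i j hij
  by_contra hne
  rcases lt_or_gt_of_ne (fun h => hne (headPos_injective (σ := σ) h)) with h | h
  · exact key j i h hij.symm
  · exact key i j h hij

theorem qOperator_sigmaSummand (hq₀ : (q : ℂ) + (q : ℂ)⁻¹ ≠ 0) (hq : (q : ℂ) - (q : ℂ)⁻¹ ≠ 0)
    (hσ : Admissible c σ) (hreg : PrincipalRegular q c σ t) (i : Fin c.length)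
    {u : NatTensor q n (SigmaModule q c σ t)} (hu : u ∈ sigmaSummand q c σ t i) :
    qOperator q n (SigmaModule q c σ t) u = xEig q c t i • u := by
  obtain ⟨y, rfl⟩ := Submodule.mem_span_singleton.1 hu
  rw [qOperator_smul hq₀ hq, uSigma_eq, qOperator_headVec hq₀ hq (isHW_sigmaVec c σ t)
    (headPos c σ i).2, smul_smul_comm', xEig_eq (σ := σ)]
  exact fun l hl h => wN_sigmaVec_mem_flag t hq hσ hreg (by omega) fun j hj =>
    h (mem_headSet.2 ⟨j, hj⟩)

/-- `wN_sigmaVec_mem_flag` in terms of the set of the `p_i`. -/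
theorem mem_flag_of_notMem_headSet (hq : (q : ℂ) - (q : ℂ)⁻¹ ≠ 0)
    (hσ : Admissible c σ) (hreg : PrincipalRegular q c σ t) :
    ∀ l < n, l ∉ headSet c σ →
      wN q n l (sigmaVec q c σ t) ∈ flag q n (sigmaVec q c σ t) l :=
  fun _ hl h => wN_sigmaVec_mem_flag t hq hσ hreg hl fun j hj => h (mem_headSet.2 ⟨j, hj⟩)

/-- For distinct `x_i`, the vectors `u_i` generate `ℂ^n ⊗ M_{σ·λ}`, and the summands are independent
because they lie in different eigenspaces of `𝒬`. -/
theorem isInternal_sigmaSummand (hq₀ : (q : ℂ) + (q : ℂ)⁻¹ ≠ 0) (hq : (q : ℂ) - (q : ℂ)⁻¹ ≠ 0)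
    (hσ : Admissible c σ) (hreg : PrincipalRegular q c σ t)
    (hx : Function.Injective (xEig q c t)) : DirectSum.IsInternal (sigmaSummand q c σ t) := by
  have htop : iSup (sigmaSummand q c σ t) = ⊤ := by
    have h := flag_le_span_headVec hq₀ hq (isHW_sigmaVec c σ t) (S := headSet c σ) le_rfl
      (mem_flag_of_notMem_headSet t hq hσ hreg) (by
        intro a ha b hb hab
        obtain ⟨i, rfl⟩ := mem_headSet.1 ha
        obtain ⟨j, rfl⟩ := mem_headSet.1 hb
        rw [← xEig_eq, ← xEig_eq] at hab
        rw [hx hab])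
    rw [flag_eq_top (span_sigmaVec c σ t), top_le_iff] at h
    rw [eq_top_iff, ← h, Submodule.span_le]
    rintro _ ⟨l, hl, -, rfl⟩
    obtain ⟨i, rfl⟩ := mem_headSet.1 hl
    rw [← uSigma_eq]
    exact Submodule.mem_iSup_of_mem i (Submodule.mem_span_singleton_self _)
  have hint : DirectSum.IsInternal fun i => (sigmaSummand q c σ t i).restrictScalars ℂ := by
    rw [DirectSum.isInternal_submodule_iff_iSupIndep_and_iSup_eq_top]
    constructor
    · refine iSupIndep.mono ((Module.End.eigenspaces_iSupIndep
        (qOperator q n (SigmaModule q c σ t))).comp hx) fun i u hu => ?_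
      exact Module.End.mem_eigenspace_iff.2 (qOperator_sigmaSummand t hq₀ hq hσ hreg i hu)
    · rw [← Submodule.restrictScalars_iSup, htop, Submodule.restrictScalars_top]
  exact hint

/-- The eigenvalues are roots of the polynomial that annihilates the last step of the filtration.
Conversely, among the `u_j` with `x_j = x_i` the first one is non-zero. -/
theorem hasEigenvalue_iff (hq₀ : (q : ℂ) + (q : ℂ)⁻¹ ≠ 0) (hq : (q : ℂ) - (q : ℂ)⁻¹ ≠ 0)
    (hσ : Admissible c σ) (hreg : PrincipalRegular q c σ t) (x : ℂ) :
    (qOperator q n (SigmaModule q c σ t)).HasEigenvalue x ↔ ∃ i, xEig q c t i = x := by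
  constructor
  · intro h
    obtain ⟨u, hu⟩ := h.exists_hasEigenvector
    have h1 := aeval_headPoly_eq_zero hq₀ hq (isHW_sigmaVec c σ t) (S := headSet c σ) le_rfl
      (mem_flag_of_notMem_headSet t hq hσ hreg) (u := u)
      (by rw [flag_eq_top (span_sigmaVec c σ t)]; trivial)
    rw [Module.End.aeval_apply_of_hasEigenvector hu, smul_eq_zero, or_iff_left hu.2, eval_headPoly,
      Finset.prod_eq_zero_iff] at h1
    obtain ⟨l, hl, h1⟩ := h1
    obtain ⟨i, rfl⟩ := mem_headSet.1 (Finset.mem_filter.1 hl).1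
    exact ⟨i, by rw [xEig_eq (σ := σ), sub_eq_zero.1 h1]⟩
  · rintro ⟨i, rfl⟩
    -- among the blocks with the given eigenvalue, the one with the smallest `p_j` is chosen
    obtain ⟨j, hj, hmin⟩ := Finset.exists_min_image
      (Finset.univ.filter fun j => xEig q c t j = xEig q c t i) (headPos c σ) ⟨i, by simp⟩
    have hj := (Finset.mem_filter.1 hj).2
    refine Module.End.hasEigenvalue_of_hasEigenvector (x := uSigma q c σ t j)
      ⟨Module.End.mem_eigenspace_iff.2 ?_, uSigma_ne_zero t hq₀ hq hσ j fun l hl hx => ?_⟩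
    · rw [← hj]
      exact qOperator_sigmaSummand t hq₀ hq hσ hreg j (Submodule.mem_span_singleton_self _)
    · exact absurd (hmin l (Finset.mem_filter.2 ⟨Finset.mem_univ _, hx ▸ hj⟩)) (not_le.2 hl)

theorem singularEquations_uSigma (hq₀ : (q : ℂ) + (q : ℂ)⁻¹ ≠ 0) (hq : (q : ℂ) - (q : ℂ)⁻¹ ≠ 0)
    (hσ : Admissible c σ) (hreg : PrincipalRegular q c σ t) (i : Fin c.length) :
    SingularEquations q (addEps q (sigmaWeight q c σ t) (headPos c σ i)) (uSigma q c σ t i) := by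
  have hS : ∀ l < (headPos c σ i : ℕ), l ∉ headSet c σ → _ := fun l hl =>
    mem_flag_of_notMem_headSet t hq hσ hreg l (by omega)
  rw [uSigma_eq]
  refine ⟨fun j => ?_, fun a => ?_⟩
  · rw [← eN_val]
    exact eN_smul_headVec hq₀ hq (isHW_sigmaVec c σ t) (headPos c σ i).2 hS j
  · rw [← kN_val, kN_smul_headVec hq₀ hq (isHW_sigmaVec c σ t) a.2, addEps, extWt_val]
    congr 1
    rcases eq_or_ne a (headPos c σ i) with h | h
    · rw [if_pos (by rw [h]), if_pos h, Units.val_mul, mul_comm]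
    · rw [if_neg (fun h' => h (Fin.ext h'.symm)), if_neg h, one_mul]

end Decomposition

end QuantumGL

end

open QuantumGL in
theorem mainTheorem3 (q : ℂˣ) (hq : ∀ m : ℕ, 0 < m → q ^ m ≠ 1) {n : ℕ} (c : Composition n)
    (σ : Equiv.Perm (Fin n)) (hσ : Admissible c σ) (t : Fin c.length → ℂˣ) :
    (DirectSum.IsInternal (sigmaSummand q c σ t) → Function.Injective (xEig q c t)) ∧
    (PrincipalRegular q c σ t →
      (DirectSum.IsInternal (sigmaSummand q c σ t) ↔ Function.Injective (xEig q c t)) ∧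
      (∀ x : ℂ, (qOperator q n (SigmaModule q c σ t)).HasEigenvalue x ↔
        ∃ i, xEig q c t i = x) ∧
      (∀ i, SingularEquations q (addEps q (sigmaWeight q c σ t) (headPos c σ i))
          (uSigma q c σ t i) ∧
        ∃ κ : ℂ, κ ≠ 0 ∧ cBar q c σ t i • uSigma q c σ t i =
          κ • idTensor q n (sigmaProj q c σ t)
            (uHat q (sigmaWeight q c σ t) (headPos c σ i))) ∧
      (Function.Injective (xEig q c t) → ∀ i, uSigma q c σ t i ≠ 0)) := by
  have hq₀ := add_inv_ne_zero_of_not_root_of_unity hq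
  have hq₁ := sub_inv_ne_zero_of_not_root_of_unity hq
  have ha : DirectSum.IsInternal (sigmaSummand q c σ t) → Function.Injective (xEig q c t) :=
    fun h => xEig_injective_of_iSup_eq_top t hq₀ hq₁ hσ h.submodule_iSup_eq_top
  refine ⟨ha, fun hreg => ⟨⟨ha, isInternal_sigmaSummand t hq₀ hq₁ hσ hreg⟩,
    hasEigenvalue_iff t hq₀ hq₁ hσ hreg, fun i => ⟨?_, ?_⟩, fun hx i => ?_⟩⟩
  · exact singularEquations_uSigma t hq₀ hq₁ hσ hreg i
  · rw [idTensor_uHat t hq₁, cBar_eq, uSigma_eq]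
    exact exists_smul_headVec_eq_uN hq₀ hq₁ (isHW_sigmaVec c σ t) (headPos c σ i).2 fun l hl =>
      mem_flag_of_notMem_headSet t hq₁ hσ hreg l (by omega)
  · exact uSigma_ne_zero t hq₀ hq₁ hσ i fun j hj h => hj.ne (by rw [hx h])
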